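/- Let $\alpha,\beta,\gamma>0$ and let $A,B$ be real constants with $A\ge 0$ and $A+B>0$. For $x,t\in[0,1]$ let $$w(x,t)=x^{\alpha}(1-x)^{\beta}|x-t|^{\gamma}\bigl(A+B\,\theta(x-t)\bigr),$$ where $\theta(x)=1$ for $x>0$ and $\theta(x)=0$ otherwise. For $n\ge 0$ let $$D_n(t)=\det\left(\int_0^1 x^{i+j}\,w(x,t)\,dx\right)_{i,j=0}^{n-1},\qquad H_n(t)=t(t-1)\frac{d}{dt}\ln D_n(t).$$ Then $D_n$ is positive and differentiable on $(0,1)$, so that $H_n(t)$ is well defined for $0<t<1$. Moreover, in the double-scaling limit $n\to\infty$, $t\to0^{+}$ with $s=-n^2t<0$ fixed, the limit $$\sigma(s):=-\lim_{n\to\infty}H_n\left(-\frac{s}{n^2}\right)$$ exists for every $s<0$, the function $\sigma$ is twice differentiable on $(-\infty,0)$, and it satisfies there the Jimbo--Miwa--Okamoto $\sigma$-form of the Painlevé III equation $$\bigl(s\sigma''(s)\bigr)^2=4\sigma'(s)\bigl(\sigma'(s)-1\bigr)\bigl(\sigma(s)-s\sigma'(s)\bigr)+\bigl(\nu_1\sigma'(s)-\nu_2\bigr)^2,\qquad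 \nu_1=\alpha+\gamma,\quad \nu_2=\gamma.$$ -/

import Mathlib

/-- The Heaviside step function: `1` for `x > 0` and `0` otherwise. -/
noncomputable def heavisideStep (x : ℝ) : ℝ :=
  if 0 < x then 1 else 0

/-- The perturbed Jacobi weight
`w(x, t) = x ^ α (1 - x) ^ β |x - t| ^ γ (A + B θ(x - t))`, for `x, t ∈ [0, 1]`. -/
noncomputable def jacobiWeight (α β γ A B x t : ℝ) : ℝ :=
  x ^ α * (1 - x) ^ β * |x - t| ^ γ * (A + B * heavisideStep (x - t))

/-- The Hankel determinant `D_n(t) = det (∫₀¹ x ^ (i + j) w(x, t) dx)`, `0 ≤ i, j ≤ n - 1`. -/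
noncomputable def hankelDet (α β γ A B : ℝ) (n : ℕ) (t : ℝ) : ℝ :=
  Matrix.det (Matrix.of fun i j : Fin n =>
    ∫ x in (0 : ℝ)..1, x ^ ((i : ℕ) + (j : ℕ)) * jacobiWeight α β γ A B x t)

/-- `H_n(t) = t (t - 1) d/dt ln D_n(t)`. -/
noncomputable def hankelH (α β γ A B : ℝ) (n : ℕ) (t : ℝ) : ℝ :=
  t * (t - 1) * deriv (fun u : ℝ => Real.log (hankelDet α β γ A B n u)) t

/-! Two independent arguments meet: an exact second-order equation in t for each fixed n, and a
compactness argument at the hard edge that lets this equation pass to the limit.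

Fixed n. D_n is the product of the squared norms h_k of the monic orthogonal polynomials P_k of w(·,
t) (`det_functional_eq_prod`). Testing the Pearson relation w'/w = α/x + β/(x-1) + γ/(x-t) on
X(1-X)P_k² makes the logarithmic derivative of D_n telescope, so H_n is affine in the subleading
coefficient p of P_n, up to an explicit term linear in t (`sum_log_deriv`). Put r = p'. The
functionals of w/x, w/(x-1) and w/(x-t) on P_n², P_n P_{n-1}, P_{n-1}² each obey one quadratic
relation (`resolvent_mul_resolvent`). Together with the linear Pearson relations these give the sum
and the product of two quantities whose difference is, up to sign, t(t-1)r'. The identity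
(difference)² = (sum)² - 4(product) is then the differential equation (`recursion_ode`,
`exists_ode`). Since γ may be below 1, all t-derivatives are taken after an integration by parts
that trades |x-t|^γ for the smoother (x-t)|x-t|^γ.

Limit. At t = 0 the weight is A+B times the Jacobi weight x^(α+γ)(1-x)^β. In the basis of its
orthogonal polynomials, with t = τ/n², D_n is a constant times det(1 + M_n(τ)/n). Hypergeometric
asymptotics and a closed formula for integrals against y^(α+γ-1) show that the entries of M_n are
bounded and converge, so the determinants converge to a Fredholm determinant
(`exists_tendsto_det_one_add`). The entries extend holomorphically to a complex disc in τ, where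
Hadamard's inequality bounds the determinants uniformly in n; comparison with a Jacobi weight shrunk
to [t, 1] keeps them away from 0 at real τ (`le_edgeDet`). Bounded holomorphic functions converging
on the real points of a disc converge there with their derivatives
(`IsNormalAt.exists_tendsto_deriv`). Hence -H_n(τ/n²) converges together with two derivatives.
Rewritten by `recS_sq_sub_eq` so that every term stays bounded, the finite-n equation tends to
Painlevé III; β cancels in the limit, and s = -τ. -/

section

open Polynomial MeasureTheory Set Filter Topology

/-! ### The perturbed weight and its elementary properties -/

/-- The one-sided power `|u| ^ γ (A + B θ(u))`. -/
noncomputable def stepPower (γ A B u : ℝ) : ℝ :=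
  |u| ^ γ * (A + B * heavisideStep u)

/-- The Jacobi weight `x ^ α (1 - x) ^ β`. -/
noncomputable def baseWeight (α β x : ℝ) : ℝ :=
  x ^ α * (1 - x) ^ β

theorem jacobiWeight_eq (α β γ A B x t : ℝ) :
    jacobiWeight α β γ A B x t = baseWeight α β x * stepPower γ A B (x - t) := by
  simp only [jacobiWeight, baseWeight, stepPower]; ring

theorem stepPower_of_pos {γ A B u : ℝ} (hu : 0 < u) :
    stepPower γ A B u = (A + B) * u ^ γ := by
  simp [stepPower, heavisideStep, hu, abs_of_pos hu, mul_comm]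

theorem stepPower_of_nonpos {γ A B u : ℝ} (hu : u ≤ 0) :
    stepPower γ A B u = A * (-u) ^ γ := by
  simp [stepPower, heavisideStep, not_lt.2 hu, abs_of_nonpos hu, mul_comm]

theorem stepPower_eq_add {γ A B : ℝ} (hγ : 0 < γ) (u : ℝ) :
    stepPower γ A B u = A * |u| ^ γ + B * (max u 0) ^ γ := by
  rcases lt_or_ge 0 u with h | h
  · rw [stepPower_of_pos h, abs_of_pos h, max_eq_left h.le]; ring
  · rw [stepPower_of_nonpos h, abs_of_nonpos h, max_eq_right h, Real.zero_rpow hγ.ne']; ring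

theorem continuous_stepPower {γ A B : ℝ} (hγ : 0 < γ) : Continuous (stepPower γ A B) := by
  have : stepPower γ A B = fun u => A * |u| ^ γ + B * (max u 0) ^ γ :=
    funext fun u => stepPower_eq_add hγ u
  rw [this]
  refine (continuous_const.mul ((continuous_abs).rpow_const fun _ => Or.inr hγ.le)).add
    (continuous_const.mul ((continuous_id.max continuous_const).rpow_const fun _ => Or.inr hγ.le))

theorem stepPower_nonneg {γ A B : ℝ} (hA : 0 ≤ A) (hAB : 0 < A + B) (u : ℝ) :
    0 ≤ stepPower γ A B u := by
  rcases lt_or_ge 0 u with h | h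
  · rw [stepPower_of_pos h]; positivity
  · rw [stepPower_of_nonpos h]; have : 0 ≤ -u := by linarith
    positivity

/-- The factor u absorbs the singularity at 0: the difference quotient there is `stepPower` itself,
which tends to 0. For γ < 1 the function `stepPower` need not be differentiable at 0, so this
product is the smooth object through which every t-derivative is taken. -/
theorem hasDerivAt_mul_stepPower {γ A B : ℝ} (hγ : 0 < γ) (u : ℝ) :
    HasDerivAt (fun u => u * stepPower γ A B u) ((γ + 1) * stepPower γ A B u) u := by
  rcases lt_trichotomy u 0 with h | h | h
  · have h1 : HasDerivAt (fun u : ℝ => u * (A * (-u) ^ γ))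
        (1 * (A * (-u) ^ γ) + u * (A * (-1 * γ * (-u) ^ (γ - 1)))) u :=
      (hasDerivAt_id u).mul (((hasDerivAt_id u).neg.rpow_const (Or.inl (by simp; exact h.ne))).const_mul A)
    have h2 : (-u) ^ γ = (-u) ^ (γ - 1) * (-u) := by
      rw [← Real.rpow_add_one (by linarith : -u ≠ 0)]; simp
    rw [stepPower_of_nonpos h.le]
    refine (h1.congr_of_eventuallyEq ?_).congr_deriv (by rw [h2]; ring)
    filter_upwards [Iio_mem_nhds h] with v hv
    rw [stepPower_of_nonpos (le_of_lt hv)]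
  · subst h
    have h0 : stepPower γ A B 0 = 0 := by
      rw [stepPower_of_nonpos le_rfl]; simp [Real.zero_rpow hγ.ne']
    rw [h0, mul_zero, hasDerivAt_iff_tendsto_slope]
    have := ((continuous_stepPower (A := A) (B := B) hγ).tendsto 0).mono_left
      (nhdsWithin_le_nhds (s := {0}ᶜ))
    rw [h0] at this
    refine this.congr' ?_
    filter_upwards [self_mem_nhdsWithin] with v hv
    have : v ≠ 0 := hv
    simp [slope_def_field, this]
  · have h1 : HasDerivAt (fun u : ℝ => u * ((A + B) * u ^ γ))
        (1 * ((A + B) * u ^ γ) + u * ((A + B) * (1 * γ * u ^ (γ - 1)))) u :=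
      (hasDerivAt_id u).mul (((hasDerivAt_id u).rpow_const (Or.inl h.ne')).const_mul _)
    have h2 : u ^ γ = u ^ (γ - 1) * u := by
      rw [← Real.rpow_add_one h.ne']; simp
    rw [stepPower_of_pos h]
    refine (h1.congr_of_eventuallyEq ?_).congr_deriv (by rw [h2]; ring)
    filter_upwards [Ioi_mem_nhds h] with v hv
    rw [stepPower_of_pos hv]

theorem continuous_baseWeight {α β : ℝ} (hα : 0 ≤ α) (hβ : 0 ≤ β) :
    Continuous (baseWeight α β) :=
  (continuous_id.rpow_const fun _ => Or.inr hα).mul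
    ((continuous_const.sub continuous_id).rpow_const fun _ => Or.inr hβ)

theorem baseWeight_pos {α β x : ℝ} (h0 : 0 < x) (h1 : x < 1) : 0 < baseWeight α β x :=
  mul_pos (Real.rpow_pos_of_pos h0 _) (Real.rpow_pos_of_pos (by linarith) _)

theorem baseWeight_div_self {α β x : ℝ} (h0 : 0 < x) :
    baseWeight α β x / x = baseWeight (α - 1) β x := by
  simp only [baseWeight]; rw [Real.rpow_sub_one h0.ne']; ring

theorem baseWeight_div_sub_one {α β x : ℝ} (h1 : x < 1) :
    baseWeight α β x / (x - 1) = -baseWeight α (β - 1) x := by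
  have : (1 - x) ≠ 0 := by linarith
  have h2 : x - 1 ≠ 0 := by linarith
  simp only [baseWeight]; rw [Real.rpow_sub_one this]; field_simp; ring

theorem intervalIntegrable_baseWeight {α β : ℝ} (hα : -1 < α) (hβ : -1 < β) :
    IntervalIntegrable (baseWeight α β) volume 0 1 := by
  have h1 : IntervalIntegrable (baseWeight α β) volume 0 (1 / 2) := by
    refine IntervalIntegrable.mul_continuousOn (intervalIntegral.intervalIntegrable_rpow' hα) ?_
    intro x hx
    rw [uIcc_of_le (by norm_num)] at hx
    refine ContinuousAt.continuousWithinAt ?_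
    exact ((continuous_const.sub continuous_id).continuousAt).rpow_const
      (Or.inl (by change (1 : ℝ) - x ≠ 0; linarith [hx.2]))
  have h2 : IntervalIntegrable (baseWeight α β) volume (1 / 2) 1 := by
    have h3 : IntervalIntegrable (fun x : ℝ => (1 - x) ^ β) volume (1 / 2) 1 := by
      have := (intervalIntegral.intervalIntegrable_rpow' (a := 0) (b := 1 / 2) hβ).comp_sub_left 1
      norm_num at this
      exact this.symm
    refine IntervalIntegrable.continuousOn_mul h3 ?_
    intro x hx
    rw [uIcc_of_le (by norm_num)] at hx
    exact (continuousAt_id.rpow_const (Or.inl (by simp only [id]; linarith [hx.1]))).continuousWithinAt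
  exact h1.trans h2

theorem intervalIntegrable_baseWeight_div_self {α β : ℝ} (hα : 0 < α) (hβ : -1 < β) :
    IntervalIntegrable (fun x => baseWeight α β x / x) volume 0 1 := by
  refine (intervalIntegrable_baseWeight (α := α - 1) (β := β) (by linarith) hβ).congr ?_
  rw [uIoc_of_le zero_le_one]
  intro x hx
  exact (baseWeight_div_self hx.1).symm

theorem intervalIntegrable_congr_Ioo {f g : ℝ → ℝ} {a b : ℝ} (hab : a ≤ b)
    (h : ∀ x ∈ Ioo a b, f x = g x) (hf : IntervalIntegrable f volume a b) :
    IntervalIntegrable g volume a b := by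
  rw [intervalIntegrable_iff_integrableOn_Ioo_of_le hab] at hf ⊢
  exact hf.congr_fun h measurableSet_Ioo

/-- Identities for powers of x and 1 - x, and quotients by them, can fail at the endpoints under
Lean's conventions for 0; the two endpoints are null sets. -/
theorem intervalIntegral_congr_Ioo {E : Type*} [NormedAddCommGroup E] [NormedSpace ℝ E]
    {f g : ℝ → E} {a b : ℝ} (hab : a ≤ b)
    (h : ∀ x ∈ Ioo a b, f x = g x) : ∫ x in a..b, f x = ∫ x in a..b, g x := by
  rw [intervalIntegral.integral_of_le hab, intervalIntegral.integral_of_le hab,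
    integral_Ioc_eq_integral_Ioo, integral_Ioc_eq_integral_Ioo]
  exact setIntegral_congr_fun measurableSet_Ioo h

theorem intervalIntegrable_baseWeight_div_sub_one {α β : ℝ} (hα : -1 < α) (hβ : 0 < β) :
    IntervalIntegrable (fun x => baseWeight α β x / (x - 1)) volume 0 1 :=
  intervalIntegrable_congr_Ioo zero_le_one
    (fun _ hx => (baseWeight_div_sub_one hx.2).symm)
    (intervalIntegrable_baseWeight (α := α) (β := β - 1) hα (by linarith)).neg

theorem hasDerivAt_baseWeight {α β x : ℝ} (h0 : 0 < x) (h1 : x < 1) :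
    HasDerivAt (baseWeight α β)
      (α * (baseWeight α β x / x) + β * (baseWeight α β x / (x - 1))) x := by
  have e1 : HasDerivAt (fun x : ℝ => x ^ α) (1 * α * x ^ (α - 1)) x :=
    (hasDerivAt_id x).rpow_const (Or.inl h0.ne')
  have e2 : HasDerivAt (fun x : ℝ => (1 - x) ^ β) (-1 * β * (1 - x) ^ (β - 1)) x :=
    ((hasDerivAt_id x).const_sub 1).rpow_const (Or.inl (by simp only [id]; linarith))
  refine (e1.mul e2).congr_deriv ?_
  rw [baseWeight_div_self h0, baseWeight_div_sub_one h1]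
  simp only [baseWeight]; ring

/-! ### Moment functionals on polynomials -/

/-- The linear functional `f ↦ ∫₀¹ f ω` on polynomials. -/
noncomputable def weightFunctional (ω : ℝ → ℝ) (hω : IntervalIntegrable ω volume 0 1) :
    ℝ[X] →ₗ[ℝ] ℝ where
  toFun f := ∫ x in (0 : ℝ)..1, f.eval x * ω x
  map_add' f g := by
    simp only [eval_add, add_mul]
    exact intervalIntegral.integral_add (hω.continuousOn_mul f.continuous.continuousOn)
      (hω.continuousOn_mul g.continuous.continuousOn)
  map_smul' c f := by
    simp only [eval_smul, smul_eq_mul, mul_assoc, RingHom.id_apply]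
    exact intervalIntegral.integral_const_mul _ _

theorem weightFunctional_apply {ω : ℝ → ℝ} (hω : IntervalIntegrable ω volume 0 1) (f : ℝ[X]) :
    weightFunctional ω hω f = ∫ x in (0 : ℝ)..1, f.eval x * ω x := rfl

theorem weightFunctional_sub_mul {ω ω' : ℝ → ℝ} (hω : IntervalIntegrable ω volume 0 1)
    (hω' : IntervalIntegrable ω' volume 0 1) {c : ℝ} (h : ∀ x ∈ Ioo (0 : ℝ) 1, ω' x * (x - c) = ω x)
    (f : ℝ[X]) : weightFunctional ω' hω' ((X - C c) * f) = weightFunctional ω hω f := by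
  rw [weightFunctional_apply, weightFunctional_apply]
  refine intervalIntegral_congr_Ioo zero_le_one fun x hx => ?_
  rw [← h x hx]; simp; ring

/-- A nonzero polynomial has finitely many roots, so positivity of the weight on one nontrivial
interval is enough. Only (t, 1) is available, because A = 0 is allowed and the weight then vanishes
to the left of t. -/
theorem weightFunctional_sq_pos {ω : ℝ → ℝ} (hω : IntervalIntegrable ω volume 0 1) {t : ℝ}
    (ht : t ∈ Ico (0 : ℝ) 1)
    (h0 : ∀ x ∈ Ioo (0 : ℝ) 1, 0 ≤ ω x) (h1 : ∀ x ∈ Ioo t 1, 0 < ω x) {f : ℝ[X]} (hf : f ≠ 0) :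
    0 < weightFunctional ω hω (f * f) := by
  rw [weightFunctional_apply]
  have hint : IntervalIntegrable (fun x => (f * f).eval x * ω x) volume 0 1 :=
    hω.continuousOn_mul (f * f).continuous.continuousOn
  rw [intervalIntegral.integral_of_le zero_le_one, integral_Ioc_eq_integral_Ioo]
  have hint' : IntegrableOn (fun x => (f * f).eval x * ω x) (Ioo 0 1) volume :=
    (intervalIntegrable_iff_integrableOn_Ioo_of_le zero_le_one).1 hint
  rw [setIntegral_pos_iff_support_of_nonneg_ae _ hint']
  · have hsub : Ioo t 1 \ (f.rootSet ℝ) ⊆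
        (Function.support fun x => (f * f).eval x * ω x) ∩ Ioo 0 1 := by
      intro x hx
      refine ⟨?_, lt_of_le_of_lt ht.1 hx.1.1, hx.1.2⟩
      have hfx : f.eval x ≠ 0 := by
        intro h
        exact hx.2 (by rw [mem_rootSet]; exact ⟨hf, by simpa using h⟩)
      simp [hfx, (h1 x hx.1).ne']
    refine lt_of_lt_of_le ?_ (measure_mono hsub)
    rw [measure_sdiff_null ((f.rootSet_finite ℝ).measure_zero _)]
    simp [ht.2]
  · filter_upwards [ae_restrict_mem measurableSet_Ioo] with x hx
    have := h0 x hx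
    simp only [eval_mul, Pi.zero_apply]
    exact mul_nonneg (mul_self_nonneg _) this

/-! ### Differentiation of the moments in t -/

section perturbed

variable {α β γ A B : ℝ}

theorem intervalIntegrable_jacobiWeight (hα : 0 < α) (hβ : 0 < β) (hγ : 0 < γ) (t : ℝ) :
    IntervalIntegrable (fun x => jacobiWeight α β γ A B x t) volume 0 1 := by
  simp only [jacobiWeight_eq]
  exact (((continuous_baseWeight hα.le hβ.le)).mul
    ((continuous_stepPower hγ).comp (continuous_id.sub continuous_const))).intervalIntegrable _ _

theorem intervalIntegrable_jacobiWeight_div_self (hα : 0 < α) (hβ : 0 < β) (hγ : 0 < γ) (t : ℝ) :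
    IntervalIntegrable (fun x => jacobiWeight α β γ A B x t / x) volume 0 1 := by
  simp only [jacobiWeight_eq, mul_div_right_comm]
  exact (intervalIntegrable_baseWeight_div_self hα (by linarith)).mul_continuousOn
    ((continuous_stepPower hγ).comp (continuous_id.sub continuous_const)).continuousOn

theorem intervalIntegrable_jacobiWeight_div_sub_one (hα : 0 < α) (hβ : 0 < β) (hγ : 0 < γ)
    (t : ℝ) :
    IntervalIntegrable (fun x => jacobiWeight α β γ A B x t / (x - 1)) volume 0 1 := by
  simp only [jacobiWeight_eq, mul_div_right_comm]
  exact (intervalIntegrable_baseWeight_div_sub_one (by linarith) hβ).mul_continuousOn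
    ((continuous_stepPower hγ).comp (continuous_id.sub continuous_const)).continuousOn

/-- The derivative of `f(x) x ^ α (1 - x) ^ β`. -/
noncomputable def baseDeriv (α β : ℝ) (f : ℝ[X]) (x : ℝ) : ℝ :=
  (derivative f).eval x * baseWeight α β x +
    f.eval x * (α * (baseWeight α β x / x) + β * (baseWeight α β x / (x - 1)))

theorem hasDerivAt_eval_mul_baseWeight (f : ℝ[X]) {x : ℝ} (h0 : 0 < x) (h1 : x < 1) :
    HasDerivAt (fun x => f.eval x * baseWeight α β x) (baseDeriv α β f x) x :=
  (f.hasDerivAt x).mul (hasDerivAt_baseWeight h0 h1)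

theorem intervalIntegrable_baseDeriv (hα : 0 < α) (hβ : 0 < β) (f : ℝ[X]) :
    IntervalIntegrable (baseDeriv α β f) volume 0 1 := by
  refine IntervalIntegrable.add
    (((derivative f).continuous.mul (continuous_baseWeight hα.le hβ.le)).intervalIntegrable _ _)
    (IntervalIntegrable.continuousOn_mul (IntervalIntegrable.add ?_ ?_) f.continuous.continuousOn)
  · exact (intervalIntegrable_baseWeight_div_self hα (by linarith)).const_mul _
  · exact (intervalIntegrable_baseWeight_div_sub_one (by linarith) hβ).const_mul _

/-- Integration by parts against (x-t)·`stepPower`; the boundary terms vanish because α and β are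
positive. -/
theorem integral_baseDeriv_mul (hα : 0 < α) (hβ : 0 < β) (hγ : 0 < γ) (f : ℝ[X]) (t : ℝ) :
    ∫ x in (0 : ℝ)..1, baseDeriv α β f x * ((x - t) * stepPower γ A B (x - t)) =
      -((γ + 1) * ∫ x in (0 : ℝ)..1, f.eval x * jacobiWeight α β γ A B x t) := by
  have hW : Continuous fun x => stepPower γ A B (x - t) :=
    (continuous_stepPower hγ).comp (continuous_id.sub continuous_const)
  have hV : Continuous fun x => (x - t) * stepPower γ A B (x - t) :=
    (continuous_id.sub continuous_const).mul hW
  have hg : Continuous fun x => f.eval x * baseWeight α β x :=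
    f.continuous.mul (continuous_baseWeight hα.le hβ.le)
  have i1 := (intervalIntegrable_baseDeriv hα hβ f).mul_continuousOn
    (hV.continuousOn (s := uIcc 0 1))
  have i2 : IntervalIntegrable
      (fun x => f.eval x * baseWeight α β x * ((γ + 1) * stepPower γ A B (x - t))) volume 0 1 :=
    (hg.mul (continuous_const.mul hW)).intervalIntegrable _ _
  have key := intervalIntegral.integral_eq_sub_of_hasDerivAt_of_le zero_le_one
    ((hg.mul hV).continuousOn (s := Icc 0 1))
    (fun x hx => (hasDerivAt_eval_mul_baseWeight (α := α) (β := β) f hx.1 hx.2).mul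
      ((hasDerivAt_mul_stepPower (A := A) (B := B) hγ (x - t)).comp_sub_const x t)) (i1.add i2)
  rw [intervalIntegral.integral_add i1 i2] at key
  have e0 : baseWeight α β 0 = 0 := by simp [baseWeight, Real.zero_rpow hα.ne']
  have e1 : baseWeight α β 1 = 0 := by simp [baseWeight, Real.zero_rpow hβ.ne']
  have e2 : ∫ x in (0 : ℝ)..1, f.eval x * baseWeight α β x * ((γ + 1) * stepPower γ A B (x - t)) =
      (γ + 1) * ∫ x in (0 : ℝ)..1, f.eval x * jacobiWeight α β γ A B x t := by
    rw [← intervalIntegral.integral_const_mul]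
    congr 1; ext x; rw [jacobiWeight_eq]; ring
  simp only [Pi.mul_apply, e0, e1, mul_zero, zero_mul, sub_zero] at key
  rw [e2] at key
  linarith

/-- Direct differentiation under the integral would produce |x-t|^(γ-1), which has no bound locally
uniform in t when γ < 1. After `integral_baseDeriv_mul` the parameter occurs only in
(x-t)·`stepPower`, which is C¹, and the singular factors at 0 and 1 no longer depend on t. -/
theorem hasDerivAt_integral_jacobiWeight (hα : 0 < α) (hβ : 0 < β) (hγ : 0 < γ) (f : ℝ[X])
    (t : ℝ) :
    HasDerivAt (fun t => ∫ x in (0 : ℝ)..1, f.eval x * jacobiWeight α β γ A B x t)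
      (∫ x in (0 : ℝ)..1, baseDeriv α β f x * stepPower γ A B (x - t)) t := by
  have hγ1 : γ + 1 ≠ 0 := by linarith
  have hrep : (fun t => ∫ x in (0 : ℝ)..1, f.eval x * jacobiWeight α β γ A B x t) =
      fun t => -(γ + 1)⁻¹ *
        ∫ x in (0 : ℝ)..1, baseDeriv α β f x * ((x - t) * stepPower γ A B (x - t)) := by
    ext s; rw [integral_baseDeriv_mul hα hβ hγ]; field_simp
  -- For x in (0, 1] and |s - t| < 1, the difference x - s stays within |t| + 2 of 0.
  obtain ⟨K, hK⟩ : ∃ K, ∀ u ∈ Icc (-(|t| + 2)) (|t| + 2), ‖(γ + 1) * stepPower γ A B u‖ ≤ K :=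
    isCompact_Icc.exists_bound_of_continuousOn
      (continuous_const.mul (continuous_stepPower hγ)).continuousOn
  have hd := intervalIntegrable_baseDeriv hα hβ f
  have hc : ∀ s, Continuous fun x : ℝ => (x - s) * stepPower γ A B (x - s) := fun s =>
    (continuous_id.sub continuous_const).mul
      ((continuous_stepPower hγ).comp (continuous_id.sub continuous_const))
  have hc' : Continuous fun x : ℝ => -((γ + 1) * stepPower γ A B (x - t)) :=
    (continuous_const.mul
      ((continuous_stepPower hγ).comp (continuous_id.sub continuous_const))).neg
  have key := intervalIntegral.hasDerivAt_integral_of_dominated_loc_of_deriv_le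
    (μ := volume) (a := (0 : ℝ)) (b := 1) (x₀ := t) (s := Metric.ball t 1)
    (F := fun s x => baseDeriv α β f x * ((x - s) * stepPower γ A B (x - s)))
    (F' := fun s x => baseDeriv α β f x * (-((γ + 1) * stepPower γ A B (x - s))))
    (bound := fun x => ‖baseDeriv α β f x‖ * K) (Metric.ball_mem_nhds t one_pos)
    (Eventually.of_forall fun s =>
      (hd.mul_continuousOn (hc s).continuousOn).def'.aestronglyMeasurable)
    (hd.mul_continuousOn (hc t).continuousOn)
    (hd.mul_continuousOn hc'.continuousOn).def'.aestronglyMeasurable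
    (Eventually.of_forall fun x hx s hs => by
      rw [norm_mul, norm_neg]
      refine mul_le_mul_of_nonneg_left (hK _ ?_) (norm_nonneg _)
      rw [uIoc_of_le zero_le_one] at hx
      rw [Metric.mem_ball, Real.dist_eq] at hs
      have h1 := abs_lt.1 hs
      have h2 := neg_abs_le t
      have h3 := le_abs_self t
      constructor <;> linarith [hx.1, hx.2])
    (hd.norm.mul_const K)
    (Eventually.of_forall fun x _ s _ => by
      have := (hasDerivAt_mul_stepPower (A := A) (B := B) hγ (x - s)).comp s
        ((hasDerivAt_id s).const_sub x)
      simpa using this.const_mul (baseDeriv α β f x))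
  rw [hrep]
  refine (key.2.const_mul (-(γ + 1)⁻¹)).congr_deriv ?_
  rw [← intervalIntegral.integral_const_mul]
  congr 1; ext x; field_simp

end perturbed

/-! ### Orthogonal polynomials of a positive functional -/

/-- The monic orthogonal polynomials of a linear functional, by Gram–Schmidt. -/
noncomputable def monicOP (L : ℝ[X] →ₗ[ℝ] ℝ) (n : ℕ) : ℝ[X] :=
  X ^ n - ∑ k : Fin n, C (L (X ^ n * monicOP L k) / L (monicOP L k * monicOP L k)) * monicOP L k
termination_by n
decreasing_by exact k.2

/-- The squared norm of the `n`-th monic orthogonal polynomial. -/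
noncomputable def opNorm (L : ℝ[X] →ₗ[ℝ] ℝ) (n : ℕ) : ℝ :=
  L (monicOP L n * monicOP L n)

/-- Positive definiteness of a linear functional on polynomials. -/
def IsPosFunctional (L : ℝ[X] →ₗ[ℝ] ℝ) : Prop := ∀ f : ℝ[X], f ≠ 0 → 0 < L (f * f)

section algebra

variable {L : ℝ[X] →ₗ[ℝ] ℝ}

/-- No positivity is needed: if a denominator in Gram–Schmidt vanishes, Lean's quotient is 0, and in
any case only coefficients below the leading one are affected. -/
theorem monicOP_aux (L : ℝ[X] →ₗ[ℝ] ℝ) (n : ℕ) :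
    (monicOP L n).Monic ∧ (monicOP L n).natDegree = n := by
  induction n using Nat.strong_induction_on with
  | _ n ih =>
    rw [monicOP]
    have hdeg : (∑ k : Fin n, C (L (X ^ n * monicOP L k) / L (monicOP L k * monicOP L k)) *
        monicOP L k).degree < n := by
      rw [degree_lt_iff_coeff_zero]
      intro m hm
      rw [finsetSum_coeff]
      refine Finset.sum_eq_zero fun k _ => ?_
      rw [coeff_C_mul, coeff_eq_zero_of_natDegree_lt, mul_zero]
      rw [(ih k k.2).2]; exact lt_of_lt_of_le k.2 hm
    exact ⟨monic_X_pow_sub hdeg, natDegree_eq_of_degree_eq_some (by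
      rw [degree_sub_eq_left_of_degree_lt (by rwa [degree_X_pow]), degree_X_pow])⟩

theorem monicOP_monic (L : ℝ[X] →ₗ[ℝ] ℝ) (n : ℕ) : (monicOP L n).Monic := (monicOP_aux L n).1

theorem natDegree_monicOP (L : ℝ[X] →ₗ[ℝ] ℝ) (n : ℕ) : (monicOP L n).natDegree = n :=
  (monicOP_aux L n).2

theorem monicOP_coeff_self (L : ℝ[X] →ₗ[ℝ] ℝ) (n : ℕ) : (monicOP L n).coeff n = 1 := by
  have := monicOP_monic L n
  rwa [Monic, leadingCoeff, natDegree_monicOP] at this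

theorem monicOP_coeff_of_lt (L : ℝ[X] →ₗ[ℝ] ℝ) {n m : ℕ} (h : n < m) :
    (monicOP L n).coeff m = 0 :=
  coeff_eq_zero_of_natDegree_lt (by rwa [natDegree_monicOP])

theorem opNorm_pos (hL : IsPosFunctional L) (n : ℕ) : 0 < opNorm L n :=
  hL _ (monicOP_monic L n).ne_zero

theorem monicOP_orthogonal_of_lt (hL : IsPosFunctional L) (n : ℕ) :
    ∀ j < n, L (monicOP L n * monicOP L j) = 0 := by
  induction n using Nat.strong_induction_on with
  | _ n ih =>
    intro j hj
    rw [monicOP, sub_mul, map_sub, Finset.sum_mul, map_sum, sub_eq_zero,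
      Finset.sum_eq_single ⟨j, hj⟩]
    · rw [mul_assoc, C_mul', map_smul, smul_eq_mul, div_mul_cancel₀]
      exact (opNorm_pos hL j).ne'
    · intro k _ hk
      rw [mul_assoc, C_mul', map_smul, smul_eq_mul]
      rcases lt_trichotomy (k : ℕ) j with h | h | h
      · rw [mul_comm (monicOP L k) (monicOP L j), ih j hj k h, mul_zero]
      · exact absurd (Fin.ext h) hk
      · rw [ih k k.2 j h, mul_zero]
    · simp

theorem degree_sub_coeff_mul_monicOP (L : ℝ[X] →ₗ[ℝ] ℝ) {m : ℕ} {q : ℝ[X]}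
    (hq : q.degree < (m + 1 : ℕ)) : (q - C (q.coeff m) * monicOP L m).degree < m := by
  rw [degree_lt_iff_coeff_zero] at hq ⊢
  intro k hk
  rw [coeff_sub, coeff_C_mul]
  rcases hk.eq_or_lt with rfl | h
  · rw [monicOP_coeff_self]; ring
  · rw [hq k h, monicOP_coeff_of_lt L h]; ring

theorem monicOP_mul_of_degree_lt (hL : IsPosFunctional L) {n : ℕ} {q : ℝ[X]}
    (hq : q.degree < n) : L (monicOP L n * q) = 0 := by
  suffices h : ∀ m ≤ n, ∀ q : ℝ[X], q.degree < m → L (monicOP L n * q) = 0 from h n le_rfl q hq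
  intro m
  induction m with
  | zero =>
    intro _ q hq
    have : q = 0 := by
      rw [← degree_eq_bot]; simpa using hq
    simp [this]
  | succ m ih =>
    intro hm q hq
    have h1 := ih (by omega) _ (degree_sub_coeff_mul_monicOP L hq)
    rw [mul_sub, map_sub, mul_left_comm, C_mul', map_smul,
      monicOP_orthogonal_of_lt hL n m (by omega), smul_zero, sub_zero] at h1
    exact h1

theorem monicOP_orthogonal (hL : IsPosFunctional L) {n j : ℕ} (h : n ≠ j) :
    L (monicOP L n * monicOP L j) = 0 := by
  rcases lt_or_gt_of_ne h with h | h
  · rw [mul_comm]; exact monicOP_orthogonal_of_lt hL j n h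
  · exact monicOP_orthogonal_of_lt hL n j h

theorem monicOP_mul_of_degree_lt_succ (hL : IsPosFunctional L) {n : ℕ} {q : ℝ[X]}
    (hq : q.degree < (n + 1 : ℕ)) : L (monicOP L n * q) = q.coeff n * opNorm L n := by
  have h1 := monicOP_mul_of_degree_lt hL (degree_sub_coeff_mul_monicOP L hq)
  rw [mul_sub, map_sub, mul_left_comm, C_mul', map_smul, sub_eq_zero] at h1
  exact h1

/-- Subtracting a multiple of P_{n+1} from q lowers its degree without changing L(P_n q), so only
the two top coefficients of q matter. -/
theorem monicOP_mul_of_degree_lt_succ_succ (hL : IsPosFunctional L) {n : ℕ} {q : ℝ[X]}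
    (hq : q.degree < (n + 2 : ℕ)) : L (monicOP L n * q) =
      (q.coeff n - q.coeff (n + 1) * (monicOP L (n + 1)).coeff n) * opNorm L n := by
  have h1 := monicOP_mul_of_degree_lt_succ hL (degree_sub_coeff_mul_monicOP L (m := n + 1) hq)
  rw [mul_sub, map_sub, mul_left_comm, C_mul', map_smul,
    monicOP_orthogonal hL (Nat.succ_ne_self n).symm, smul_zero, sub_zero] at h1
  rw [h1, coeff_sub, coeff_C_mul]

theorem degree_monicOP_lt (L : ℝ[X] →ₗ[ℝ] ℝ) {n m : ℕ} (h : n < m) :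
    (monicOP L n).degree < m := by
  rw [degree_lt_iff_coeff_zero]
  exact fun k hk => monicOP_coeff_of_lt L (lt_of_lt_of_le h hk)

/-- Minimality of the norm of the monic orthogonal polynomials. -/
theorem opNorm_le (hL : IsPosFunctional L) {n : ℕ} {q : ℝ[X]} (hq : q.Monic)
    (hn : q.natDegree = n) : opNorm L n ≤ L (q * q) := by
  have hd : q.degree < (n + 1 : ℕ) := by
    rw [degree_lt_iff_coeff_zero]
    exact fun k hk => coeff_eq_zero_of_natDegree_lt (by omega)
  have hc : q.coeff n = 1 := by rw [← hn]; exact hq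
  have h1 := monicOP_mul_of_degree_lt_succ hL hd
  rw [hc, one_mul] at h1
  have h2 : 0 ≤ L ((q - monicOP L n) * (q - monicOP L n)) := by
    by_cases h : q - monicOP L n = 0
    · simp [h]
    · exact (hL _ h).le
  have h3 : (q - monicOP L n) * (q - monicOP L n) =
      q * q - 2 * (monicOP L n * q) + monicOP L n * monicOP L n := by ring
  have h4 : L (2 * (monicOP L n * q)) = 2 * L (monicOP L n * q) := by
    rw [show (2 : ℝ[X]) = C 2 from rfl, C_mul', map_smul, smul_eq_mul]
  rw [h3, map_add, map_sub, h4, h1] at h2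
  change 0 ≤ _ - 2 * opNorm L n + opNorm L n at h2
  linarith

/-- A triangular change of basis conjugates the moment matrix. It is used twice: with the orthogonal
polynomials themselves, where the Gram matrix is diagonal, and with the Jacobi polynomials of the
weight at t = 0, where it is a perturbation of a multiple of the identity. -/
theorem det_functional_of_triangular (L : ℝ[X] →ₗ[ℝ] ℝ) (n : ℕ) (q : ℕ → ℝ[X])
    (hq : ∀ i, (q i).degree < (i + 1 : ℕ)) :
    (Matrix.of fun i j : Fin n => L (q i * q j)).det =
      (∏ i : Fin n, (q i).coeff i) ^ 2 *
        (Matrix.of fun i j : Fin n => L (X ^ ((i : ℕ) + (j : ℕ)))).det := by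
  set M : Matrix (Fin n) (Fin n) ℝ := Matrix.of fun i j => (q i).coeff j
  have hM : M.det = ∏ i : Fin n, (q i).coeff i := by
    refine Matrix.det_of_isLowerTriangular M fun i j hij => ?_
    have : (i : ℕ) < j := hij
    exact (degree_lt_iff_coeff_zero _ _).1 (hq i) j this
  have hexp : ∀ i : Fin n, q i = ∑ k : Fin n, M i k • (X : ℝ[X]) ^ (k : ℕ) := by
    intro i
    have hlt : (q i).natDegree < n := by
      have : (q i).natDegree ≤ i := natDegree_le_iff_coeff_eq_zero.2 fun N hN =>
        (degree_lt_iff_coeff_zero _ _).1 (hq i) N hN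
      omega
    conv_lhs => rw [as_sum_range' (q i) n hlt, ← Fin.sum_univ_eq_sum_range]
    refine Finset.sum_congr rfl fun k _ => ?_
    rw [← C_mul_X_pow_eq_monomial, C_mul']; rfl
  have hG : (Matrix.of fun i j : Fin n => L (q i * q j)) =
      M * (Matrix.of fun i j : Fin n => L (X ^ ((i : ℕ) + (j : ℕ)))) * M.transpose := by
    ext i j
    rw [Matrix.of_apply, hexp i, hexp j, Matrix.mul_apply]
    simp only [Matrix.mul_apply, Matrix.of_apply, Matrix.transpose_apply, Finset.sum_mul,
      Finset.mul_sum, map_sum]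
    refine Finset.sum_congr rfl fun k _ => Finset.sum_congr rfl fun l _ => ?_
    rw [smul_mul_smul_comm, map_smul, ← pow_add, smul_eq_mul]; ring
  rw [hG, Matrix.det_mul, Matrix.det_mul, Matrix.det_transpose, hM]; ring

theorem det_functional_eq_prod (hL : IsPosFunctional L) (n : ℕ) :
    (Matrix.of fun i j : Fin n => L (X ^ ((i : ℕ) + (j : ℕ)))).det =
      ∏ k ∈ Finset.range n, opNorm L k := by
  have h := det_functional_of_triangular L n (monicOP L)
    fun i => degree_monicOP_lt L (Nat.lt_succ_self i)
  simp only [monicOP_coeff_self, Finset.prod_const_one, one_pow, one_mul] at h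
  rw [← h]
  have : (Matrix.of fun i j : Fin n => L (monicOP L i * monicOP L j)) =
      Matrix.diagonal fun i : Fin n => opNorm L i := by
    ext i j
    by_cases hij : i = j
    · subst hij; simp [opNorm]
    · rw [Matrix.diagonal_apply_ne _ hij, Matrix.of_apply,
        monicOP_orthogonal hL fun h => hij (Fin.ext h)]
  rw [this, Matrix.det_diagonal, Fin.prod_univ_eq_prod_range (fun k => opNorm L k)]

/-- K is L divided by X - c. Dividing q by X - c, the quotient has degree below n and is killed by
orthogonality, so only the remainder q(c) survives. -/
theorem resolvent_monicOP_mul (hL : IsPosFunctional L) {K : ℝ[X] →ₗ[ℝ] ℝ} {c : ℝ}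
    (hK : ∀ f, K ((X - C c) * f) = L f) {n : ℕ} {q : ℝ[X]} (hq : q.degree < (n + 1 : ℕ)) :
    K (monicOP L n * q) = q.eval c * K (monicOP L n) := by
  have h1 : q = (X - C c) * (q /ₘ (X - C c)) + C (q.eval c) := by
    conv_lhs => rw [← modByMonic_add_div q (X - C c), modByMonic_X_sub_C_eq_C_eval]
    ring
  have h2 : (q /ₘ (X - C c)).degree < n := by
    rw [degree_lt_iff_coeff_zero]
    intro k hk
    by_cases h0 : q.natDegree = 0
    · rw [eq_C_of_natDegree_eq_zero h0, (divByMonic_eq_zero_iff (monic_X_sub_C c)).2 (by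
        rw [degree_X_sub_C]; exact lt_of_le_of_lt degree_C_le (by norm_num)), coeff_zero]
    · apply coeff_eq_zero_of_natDegree_lt
      have : q.natDegree ≤ n := natDegree_le_iff_coeff_eq_zero.2 fun N hN =>
        (degree_lt_iff_coeff_zero _ _).1 hq N hN
      rw [natDegree_divByMonic q (monic_X_sub_C c), natDegree_X_sub_C]
      omega
  conv_lhs => rw [h1]
  rw [mul_add, map_add, mul_left_comm, hK, monicOP_mul_of_degree_lt hL h2, zero_add,
    mul_comm, C_mul', map_smul, smul_eq_mul]

theorem degree_X_sub_C_mul_monicOP (L : ℝ[X] →ₗ[ℝ] ℝ) (c : ℝ) (n : ℕ) :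
    Polynomial.degree (monicOP L (n + 1) - (X - C c) * monicOP L n) < (n + 1 : ℕ) := by
  rw [degree_lt_iff_coeff_zero]
  intro k hk
  obtain ⟨k, rfl⟩ : ∃ j, k = j + 1 := ⟨k - 1, by omega⟩
  rw [coeff_sub, sub_mul, coeff_sub, coeff_X_mul, coeff_C_mul,
    monicOP_coeff_of_lt L (show n < k + 1 by omega)]
  rcases Nat.eq_or_lt_of_le hk with h | h
  · obtain rfl : n = k := by omega
    rw [monicOP_coeff_self, monicOP_coeff_self]; ring
  · rw [monicOP_coeff_of_lt L h, monicOP_coeff_of_lt L (show n < k by omega)]; ring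

/-- The determinant relation for a functional `K` with `K((X - c) f) = L(f)`. -/
theorem resolvent_mul_resolvent (hL : IsPosFunctional L) {K : ℝ[X] →ₗ[ℝ] ℝ} {c : ℝ}
    (hK : ∀ f, K ((X - C c) * f) = L f) (n : ℕ) :
    K (monicOP L (n + 1) * monicOP L (n + 1)) * K (monicOP L n * monicOP L n) =
      K (monicOP L (n + 1) * monicOP L n) *
        (K (monicOP L (n + 1) * monicOP L n) - opNorm L n) := by
  -- Each value of K factors as P(c)·K(P'), with P and P' among P_n and P_{n+1}. The mixed value
  -- factors in two ways, as P_n(c)K(P_{n+1}) and as P_{n+1}(c)K(P_n) + h_n; the second uses that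
  -- P_{n+1} - (X-c)P_n has degree at most n.
  have h1 := resolvent_monicOP_mul hL hK (degree_monicOP_lt L (Nat.lt_succ_self (n + 1)))
  have h2 := resolvent_monicOP_mul hL hK (degree_monicOP_lt L (Nat.lt_succ_self n))
  have h3 := resolvent_monicOP_mul hL hK
    (degree_monicOP_lt L (show n < n + 1 + 1 by omega))
  have h4 := resolvent_monicOP_mul hL hK (degree_X_sub_C_mul_monicOP L c n)
  have h5 : K (monicOP L (n + 1) * monicOP L n) - opNorm L n =
      (monicOP L (n + 1)).eval c * K (monicOP L n) := by
    rw [mul_sub, map_sub, mul_left_comm, hK] at h4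
    simp only [eval_sub, eval_mul, eval_X, eval_C, sub_self, zero_mul, sub_zero] at h4
    rw [← h4, mul_comm (monicOP L n)]; rfl
  rw [h5, h1, h2, h3]; ring

end algebra

/-! ### Dependence of orthogonal polynomials on a parameter -/

/-- The coefficient of `X ^ (n - 1)` in the `n`-th monic orthogonal polynomial. -/
noncomputable def opSubCoeff (L : ℝ[X] →ₗ[ℝ] ℝ) (n : ℕ) : ℝ :=
  (monicOP L n).nextCoeff

section family

variable {L : ℝ → ℝ[X] →ₗ[ℝ] ℝ} {t₀ : ℝ}

theorem functional_eq_sum (K : ℝ[X] →ₗ[ℝ] ℝ) {f : ℝ[X]} {m : ℕ} (hf : f.natDegree < m) :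
    K f = ∑ i ∈ Finset.range m, f.coeff i * K (X ^ i) := by
  conv_lhs => rw [as_sum_range' f m hf, map_sum]
  refine Finset.sum_congr rfl fun i _ => ?_
  rw [← C_mul_X_pow_eq_monomial, C_mul', map_smul, smul_eq_mul]

theorem differentiableAt_functional (hL : ∀ g, DifferentiableAt ℝ (fun t => L t g) t₀)
    {f : ℝ → ℝ[X]} {m : ℕ} (hf : ∀ t, (f t).natDegree < m)
    (hc : ∀ i, DifferentiableAt ℝ (fun t => (f t).coeff i) t₀) :
    DifferentiableAt ℝ (fun t => L t (f t)) t₀ := by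
  simp only [fun t => functional_eq_sum (L t) (hf t)]
  exact DifferentiableAt.fun_sum fun i _ => (hc i).mul (hL _)

/-- The variation of f contributes nothing, because the difference of the two functionals vanishes
at t₀. What remains is the derivative of the functional alone. -/
theorem hasDerivAt_functional_sub {L' : ℝ[X] →ₗ[ℝ] ℝ}
    (hL : ∀ g, HasDerivAt (fun t => L t g) (L' g) t₀)
    {f : ℝ → ℝ[X]} {m : ℕ} (hf : ∀ t, (f t).natDegree < m)
    (hc : ∀ i, DifferentiableAt ℝ (fun t => (f t).coeff i) t₀) :
    HasDerivAt (fun t => L t (f t) - L t₀ (f t)) (L' (f t₀)) t₀ := by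
  simp only [fun t => functional_eq_sum (L t) (hf t), functional_eq_sum (L t₀) (hf _),
    ← Finset.sum_sub_distrib, ← mul_sub]
  rw [functional_eq_sum L' (hf t₀)]
  refine HasDerivAt.fun_sum fun i _ => ?_
  refine ((hc i).hasDerivAt.mul ((hL (X ^ i)).sub_const _)).congr_deriv ?_
  ring

theorem differentiableAt_coeff_mul {f g : ℝ → ℝ[X]}
    (hf : ∀ i, DifferentiableAt ℝ (fun t => (f t).coeff i) t₀)
    (hg : ∀ i, DifferentiableAt ℝ (fun t => (g t).coeff i) t₀) (i : ℕ) :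
    DifferentiableAt ℝ (fun t => (f t * g t).coeff i) t₀ := by
  simp only [coeff_mul]
  exact DifferentiableAt.fun_sum fun x _ => (hf _).mul (hg _)

/-- By Gram–Schmidt the coefficients are rational in finitely many moments, the denominators being
norms that do not vanish at t₀. -/
theorem differentiableAt_monicOP_coeff (hL : ∀ g, DifferentiableAt ℝ (fun t => L t g) t₀)
    (hpos : IsPosFunctional (L t₀)) (n : ℕ) :
    ∀ i, DifferentiableAt ℝ (fun t => (monicOP (L t) n).coeff i) t₀ := by
  induction n using Nat.strong_induction_on with
  | _ n ih =>
    intro i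
    have : (fun t => (monicOP (L t) n).coeff i) = fun t => (X ^ n : ℝ[X]).coeff i -
        ∑ k : Fin n, (L t (X ^ n * monicOP (L t) k) / L t (monicOP (L t) k * monicOP (L t) k)) *
          (monicOP (L t) k).coeff i := by
      ext t
      rw [monicOP, coeff_sub, finsetSum_coeff]
      simp only [coeff_C_mul]
    rw [this]
    refine (differentiableAt_const _).sub (DifferentiableAt.fun_sum fun k _ => ?_)
    refine DifferentiableAt.mul (DifferentiableAt.div ?_ ?_ (opNorm_pos hpos k).ne') (ih k k.2 i)
    · refine differentiableAt_functional hL (m := n + k + 1) (fun t => ?_)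
        (differentiableAt_coeff_mul (fun _ => differentiableAt_const _) (ih k k.2))
      refine lt_of_le_of_lt natDegree_mul_le ?_
      rw [natDegree_monicOP, natDegree_X_pow]; omega
    · refine differentiableAt_functional hL (m := k + k + 1) (fun t => ?_)
        (differentiableAt_coeff_mul (ih k k.2) (ih k k.2))
      refine lt_of_le_of_lt natDegree_mul_le ?_
      rw [natDegree_monicOP]; omega

variable {L' : ℝ[X] →ₗ[ℝ] ℝ}

/-- Both P_n(t) and P_n(t₀) are monic, so the product P_n(t)P_n(t₀) has value h_n(t) under L_t and
h_n(t₀) under L_{t₀}. Thus h_n(t) - h_n(t₀) is exactly the difference treated by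
`hasDerivAt_functional_sub`. -/
theorem hasDerivAt_opNorm (hL : ∀ g, HasDerivAt (fun t => L t g) (L' g) t₀)
    (hpos : ∀ᶠ t in 𝓝 t₀, IsPosFunctional (L t)) (n : ℕ) :
    HasDerivAt (fun t => opNorm (L t) n) (L' (monicOP (L t₀) n * monicOP (L t₀) n)) t₀ := by
  have hd := differentiableAt_monicOP_coeff (fun g => (hL g).differentiableAt) hpos.self_of_nhds n
  have h1 := hasDerivAt_functional_sub hL
    (f := fun t => monicOP (L t) n * monicOP (L t₀) n) (m := n + n + 1)
    (fun t => by
      refine lt_of_le_of_lt natDegree_mul_le ?_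
      rw [natDegree_monicOP, natDegree_monicOP]; omega)
    (differentiableAt_coeff_mul hd fun _ => differentiableAt_const _)
  refine (h1.add_const (opNorm (L t₀) n)).congr_of_eventuallyEq ?_
  filter_upwards [hpos] with t ht
  have e1 := monicOP_mul_of_degree_lt_succ ht (degree_monicOP_lt (L t₀) (Nat.lt_succ_self n))
  have e2 := monicOP_mul_of_degree_lt_succ hpos.self_of_nhds
    (degree_monicOP_lt (L t) (Nat.lt_succ_self n))
  rw [monicOP_coeff_self, one_mul] at e1 e2
  rw [mul_comm] at e2
  simp only [e1, e2]; ring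

theorem opSubCoeff_succ (K : ℝ[X] →ₗ[ℝ] ℝ) (n : ℕ) :
    opSubCoeff K (n + 1) = (monicOP K (n + 1)).coeff n := by
  simp [opSubCoeff, nextCoeff, natDegree_monicOP]

theorem opSubCoeff_zero (K : ℝ[X] →ₗ[ℝ] ℝ) : opSubCoeff K 0 = 0 := by
  simp [opSubCoeff, nextCoeff, natDegree_monicOP]

/-- The product P_{n+1}(t)P_n(t₀) is killed by L_t, while L_{t₀} returns the increment of the
subleading coefficient times h_n(t₀). -/
theorem hasDerivAt_opSubCoeff (hL : ∀ g, HasDerivAt (fun t => L t g) (L' g) t₀)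
    (hpos : ∀ᶠ t in 𝓝 t₀, IsPosFunctional (L t)) (n : ℕ) :
    HasDerivAt (fun t => opSubCoeff (L t) (n + 1))
      (-L' (monicOP (L t₀) (n + 1) * monicOP (L t₀) n) / opNorm (L t₀) n) t₀ := by
  have hd := differentiableAt_monicOP_coeff (fun g => (hL g).differentiableAt)
    hpos.self_of_nhds (n + 1)
  have h1 := hasDerivAt_functional_sub hL
    (f := fun t => monicOP (L t) (n + 1) * monicOP (L t₀) n) (m := n + 1 + n + 1)
    (fun t => by
      refine lt_of_le_of_lt natDegree_mul_le ?_
      rw [natDegree_monicOP, natDegree_monicOP]; omega)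
    (differentiableAt_coeff_mul hd fun _ => differentiableAt_const _)
  refine ((h1.neg.div_const (opNorm (L t₀) n)).add_const
    (opSubCoeff (L t₀) (n + 1))).congr_of_eventuallyEq ?_
  filter_upwards [hpos] with t ht
  have e1 := monicOP_mul_of_degree_lt ht (degree_monicOP_lt (L t₀) (Nat.lt_succ_self n))
  have e2 := monicOP_mul_of_degree_lt_succ_succ hpos.self_of_nhds
    (degree_monicOP_lt (L t) (show n + 1 < n + 2 by omega))
  rw [monicOP_coeff_self, one_mul, mul_comm] at e2
  have h0 := (opNorm_pos hpos.self_of_nhds n).ne'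
  simp only [Pi.neg_apply, e1, e2, opSubCoeff_succ]
  field_simp; ring

end family

/-! ### Pearson relations for the perturbed Jacobi functionals -/

/-- The properties of the moment functionals of `w`, `w / x`, `w / (x - 1)`, `w / (x - t)`
for the perturbed Jacobi weight that determine the dependence on `t`. -/
structure IsPerturbedJacobi (α β γ : ℝ) (L L₀ L₁ Lₜ : ℝ → ℝ[X] →ₗ[ℝ] ℝ) : Prop where
  pos : ∀ t ∈ Ioo (0 : ℝ) 1, IsPosFunctional (L t)
  zero : ∀ t f, L₀ t ((X - C 0) * f) = L t f
  one : ∀ t f, L₁ t ((X - C 1) * f) = L t f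
  sing : ∀ t f, Lₜ t ((X - C t) * f) = L t f
  pearson : ∀ t f, L t (derivative f) = -(α * L₀ t f + β * L₁ t f + γ * Lₜ t f)
  hasDerivAt : ∀ t f, HasDerivAt (fun s => L s f) ((-γ • Lₜ t) f) t

namespace IsPerturbedJacobi

variable {α β γ : ℝ} {L L₀ L₁ Lₜ : ℝ → ℝ[X] →ₗ[ℝ] ℝ}

theorem eventually_pos (h : IsPerturbedJacobi α β γ L L₀ L₁ Lₜ) {t : ℝ}
    (ht : t ∈ Ioo (0 : ℝ) 1) : ∀ᶠ s in 𝓝 t, IsPosFunctional (L s) := by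
  filter_upwards [Ioo_mem_nhds ht.1 ht.2] with s hs using h.pos s hs

theorem zero' (h : IsPerturbedJacobi α β γ L L₀ L₁ Lₜ) (t : ℝ) (f : ℝ[X]) :
    L₀ t (X * f) = L t f := by
  simpa using h.zero t f

theorem one' (h : IsPerturbedJacobi α β γ L L₀ L₁ Lₜ) (t : ℝ) (f : ℝ[X]) :
    L₁ t (X * f) = L t f + L₁ t f := by
  rw [← h.one t f, ← map_add]; congr 1; simp; ring

theorem sing' (h : IsPerturbedJacobi α β γ L L₀ L₁ Lₜ) (t : ℝ) (f : ℝ[X]) :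
    Lₜ t (X * f) = L t f + t * Lₜ t f := by
  rw [← h.sing t f, ← smul_eq_mul t, ← map_smul, ← map_add]; congr 1; rw [← C_mul']; ring

end IsPerturbedJacobi

section coefficients

variable {K : ℝ[X] →ₗ[ℝ] ℝ}

theorem monicOP_mul_X_mul (hK : IsPosFunctional K) (n : ℕ) :
    K (X * (monicOP K n * monicOP K n)) =
      (opSubCoeff K n - opSubCoeff K (n + 1)) * opNorm K n := by
  have hd : Polynomial.degree (X * monicOP K n) < (n + 2 : ℕ) := by
    rw [degree_lt_iff_coeff_zero]
    intro k hk
    obtain ⟨k, rfl⟩ : ∃ j, k = j + 1 := ⟨k - 1, by omega⟩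
    rw [coeff_X_mul, monicOP_coeff_of_lt K (by omega)]
  have h := monicOP_mul_of_degree_lt_succ_succ hK hd
  rw [coeff_X_mul, monicOP_coeff_self, one_mul, ← opSubCoeff_succ] at h
  rw [mul_left_comm, h]
  cases n with
  | zero => simp [opSubCoeff_zero]
  | succ n => rw [coeff_X_mul, opSubCoeff_succ K n]

theorem monicOP_mul_X_mul_derivative (hK : IsPosFunctional K) (n : ℕ) :
    K (monicOP K n * (X * derivative (monicOP K n))) = n * opNorm K n := by
  have hc : ∀ k, (X * derivative (monicOP K n)).coeff k = (monicOP K n).coeff k * k := by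
    intro k
    cases k with
    | zero => simp
    | succ k => rw [coeff_X_mul, coeff_derivative]; push_cast; ring
  have hd : Polynomial.degree (X * derivative (monicOP K n)) < (n + 1 : ℕ) := by
    rw [degree_lt_iff_coeff_zero]
    intro k hk
    rw [hc, monicOP_coeff_of_lt K (by omega), zero_mul]
  rw [monicOP_mul_of_degree_lt_succ hK hd, hc, monicOP_coeff_self, one_mul]

theorem monicOP_mul_X_sq_mul_derivative (hK : IsPosFunctional K) (n : ℕ) :
    K (monicOP K n * (X * (X * derivative (monicOP K n)))) =
      ((n - 1) * opSubCoeff K n - n * opSubCoeff K (n + 1)) * opNorm K n := by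
  have hc : ∀ k, (X * derivative (monicOP K n)).coeff k = (monicOP K n).coeff k * k := by
    intro k
    cases k with
    | zero => simp
    | succ k => rw [coeff_X_mul, coeff_derivative]; push_cast; ring
  have hd : Polynomial.degree (X * (X * derivative (monicOP K n))) < (n + 2 : ℕ) := by
    rw [degree_lt_iff_coeff_zero]
    intro k hk
    obtain ⟨k, rfl⟩ : ∃ j, k = j + 1 := ⟨k - 1, by omega⟩
    rw [coeff_X_mul, hc, monicOP_coeff_of_lt K (by omega), zero_mul]
  rw [monicOP_mul_of_degree_lt_succ_succ hK hd, coeff_X_mul, hc, monicOP_coeff_self, one_mul,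
    ← opSubCoeff_succ]
  cases n with
  | zero => simp [opSubCoeff_zero]
  | succ n => rw [coeff_X_mul, hc, opSubCoeff_succ K n]; push_cast; ring

theorem degree_derivative_monicOP (K : ℝ[X] →ₗ[ℝ] ℝ) (n : ℕ) :
    (derivative (monicOP K n)).degree < n := by
  rw [degree_lt_iff_coeff_zero]
  intro k hk
  rw [coeff_derivative, monicOP_coeff_of_lt K (by omega), zero_mul]

theorem monicOP_mul_derivative (hK : IsPosFunctional K) (n : ℕ) :
    K (monicOP K n * derivative (monicOP K n)) = 0 :=
  monicOP_mul_of_degree_lt hK (degree_derivative_monicOP K n)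

theorem monicOP_mul_derivative_succ (hK : IsPosFunctional K) (n : ℕ) :
    K (monicOP K n * derivative (monicOP K (n + 1))) = (n + 1) * opNorm K n := by
  rw [monicOP_mul_of_degree_lt_succ hK (degree_derivative_monicOP K (n + 1)), coeff_derivative,
    monicOP_coeff_self, one_mul]

theorem monicOP_mul_X_mul_derivative_succ (hK : IsPosFunctional K) (n : ℕ) :
    K (monicOP K n * (X * derivative (monicOP K (n + 1)))) =
      -opSubCoeff K (n + 1) * opNorm K n := by
  have hc : ∀ k, (X * derivative (monicOP K (n + 1))).coeff k =
      (monicOP K (n + 1)).coeff k * k := by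
    intro k
    cases k with
    | zero => simp
    | succ k => rw [coeff_X_mul, coeff_derivative]; push_cast; ring
  have hd : Polynomial.degree (X * derivative (monicOP K (n + 1))) < (n + 2 : ℕ) := by
    rw [degree_lt_iff_coeff_zero]
    intro k hk
    rw [hc, monicOP_coeff_of_lt K (by omega), zero_mul]
  rw [monicOP_mul_of_degree_lt_succ_succ hK hd, hc, hc, monicOP_coeff_self, opSubCoeff_succ]
  push_cast; ring

theorem monicOP_succ_mul_derivative (hK : IsPosFunctional K) (n : ℕ) :
    K (monicOP K (n + 1) * derivative (monicOP K n)) = 0 :=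
  monicOP_mul_of_degree_lt hK ((degree_derivative_monicOP K n).trans (by norm_cast; omega))

theorem monicOP_succ_mul_X_mul_derivative (hK : IsPosFunctional K) (n : ℕ) :
    K (monicOP K (n + 1) * (X * derivative (monicOP K n))) = 0 := by
  refine monicOP_mul_of_degree_lt hK ?_
  rw [degree_lt_iff_coeff_zero]
  intro k hk
  obtain ⟨k, rfl⟩ : ∃ j, k = j + 1 := ⟨k - 1, by omega⟩
  rw [coeff_X_mul, coeff_derivative, monicOP_coeff_of_lt K (by omega), zero_mul]

end coefficients

namespace IsPerturbedJacobi

variable {α β γ : ℝ} {L L₀ L₁ Lₜ : ℝ → ℝ[X] →ₗ[ℝ] ℝ} {t : ℝ}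

/-- The five relations from here on are the Pearson relation on well-chosen test polynomials. On
P_n² the derivative term vanishes by orthogonality; a factor X removes the pole at 0, a factor
X(1-X) the poles at 0 and 1. The same is then done with P_{n+1}P_n. -/
theorem diag_sum (h : IsPerturbedJacobi α β γ L L₀ L₁ Lₜ) (ht : t ∈ Ioo (0 : ℝ) 1) (n : ℕ) :
    α * L₀ t (monicOP (L t) n * monicOP (L t) n) + β * L₁ t (monicOP (L t) n * monicOP (L t) n) +
      γ * Lₜ t (monicOP (L t) n * monicOP (L t) n) = 0 := by
  have h1 := h.pearson t (monicOP (L t) n * monicOP (L t) n)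
  rw [derivative_mul, map_add, mul_comm (derivative _),
    monicOP_mul_derivative (h.pos t ht)] at h1
  linarith

theorem diag_X (h : IsPerturbedJacobi α β γ L L₀ L₁ Lₜ) (ht : t ∈ Ioo (0 : ℝ) 1) (n : ℕ) :
    β * L₁ t (monicOP (L t) n * monicOP (L t) n) +
      γ * t * Lₜ t (monicOP (L t) n * monicOP (L t) n) =
      -(2 * n + 1 + (α + β + γ)) * opNorm (L t) n := by
  have h1 := h.pearson t (X * (monicOP (L t) n * monicOP (L t) n))
  rw [h.zero', h.one', h.sing', derivative_mul, derivative_X, one_mul, derivative_mul,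
    show X * (derivative (monicOP (L t) n) * monicOP (L t) n +
        monicOP (L t) n * derivative (monicOP (L t) n)) =
      monicOP (L t) n * (X * derivative (monicOP (L t) n)) +
        monicOP (L t) n * (X * derivative (monicOP (L t) n)) by ring, map_add, map_add,
    monicOP_mul_X_mul_derivative (h.pos t ht)] at h1
  have : L t (monicOP (L t) n * monicOP (L t) n) = opNorm (L t) n := rfl
  rw [this] at h1
  linarith

/-- With the test polynomial X(1-X)P_n² only the pole at t survives, which isolates the logarithmic
derivative of h_n. -/
theorem diag_quadratic (h : IsPerturbedJacobi α β γ L L₀ L₁ Lₜ) (ht : t ∈ Ioo (0 : ℝ) 1)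
    (n : ℕ) :
    t * (1 - t) * (γ * Lₜ t (monicOP (L t) n * monicOP (L t) n)) =
      (-(2 * n + 1 + (α + γ) - γ * t) - (2 * n + 2 + (α + β + γ)) * opSubCoeff (L t) (n + 1) +
        (2 * n + (α + β + γ)) * opSubCoeff (L t) n) * opNorm (L t) n := by
  set P := monicOP (L t) n with hP
  have hp := h.pos t ht
  have h1 := h.pearson t (X * (P * P) - X * (X * (P * P)))
  have e1 : L t (X * (P * P)) = _ := monicOP_mul_X_mul hp n
  have e2 : L t (P * (X * derivative P)) = _ := monicOP_mul_X_mul_derivative hp n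
  have e3 : L t (P * (X * (X * derivative P))) = _ := monicOP_mul_X_sq_mul_derivative hp n
  have e4 : L t (P * P) = opNorm (L t) n := rfl
  have e5 : derivative (X * (P * P) - X * (X * (P * P))) =
      P * P + P * (X * derivative P) + P * (X * derivative P) - X * (P * P) - X * (P * P)
        - P * (X * (X * derivative P)) - P * (X * (X * derivative P)) := by
    simp only [derivative_sub, derivative_mul, derivative_X]; ring
  rw [e5] at h1
  simp only [map_sub, map_add, h.zero', h.one', h.sing', e1, e2, e3, e4] at h1
  linear_combination h1

theorem offdiag_sum (h : IsPerturbedJacobi α β γ L L₀ L₁ Lₜ) (ht : t ∈ Ioo (0 : ℝ) 1) (n : ℕ) :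
    α * L₀ t (monicOP (L t) (n + 1) * monicOP (L t) n) +
      β * L₁ t (monicOP (L t) (n + 1) * monicOP (L t) n) +
      γ * Lₜ t (monicOP (L t) (n + 1) * monicOP (L t) n) = -(n + 1) * opNorm (L t) n := by
  have h1 := h.pearson t (monicOP (L t) (n + 1) * monicOP (L t) n)
  rw [derivative_mul, map_add, mul_comm (derivative _),
    monicOP_mul_derivative_succ (h.pos t ht), monicOP_succ_mul_derivative (h.pos t ht)] at h1
  linarith

theorem offdiag_X (h : IsPerturbedJacobi α β γ L L₀ L₁ Lₜ) (ht : t ∈ Ioo (0 : ℝ) 1) (n : ℕ) :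
    β * L₁ t (monicOP (L t) (n + 1) * monicOP (L t) n) +
      γ * t * Lₜ t (monicOP (L t) (n + 1) * monicOP (L t) n) =
      opSubCoeff (L t) (n + 1) * opNorm (L t) n := by
  set P := monicOP (L t) (n + 1) with hP
  set Q := monicOP (L t) n with hQ
  have hp := h.pos t ht
  have h1 := h.pearson t (X * (P * Q))
  have e1 : L t (Q * (X * derivative P)) = _ := monicOP_mul_X_mul_derivative_succ hp n
  have e2 : L t (P * (X * derivative Q)) = _ := monicOP_succ_mul_X_mul_derivative hp n
  have e3 : L t (P * Q) = 0 := monicOP_orthogonal hp (Nat.succ_ne_self n)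
  have e5 : derivative (X * (P * Q)) = P * Q + Q * (X * derivative P) + P * (X * derivative Q) := by
    simp only [derivative_mul, derivative_X]; ring
  rw [e5] at h1
  simp only [map_add, h.zero', h.one', h.sing', e1, e2, e3] at h1
  linear_combination h1

end IsPerturbedJacobi

/-! ### The second-order equation for the subleading coefficient -/

/-- With `b₁ = p - t r` and `b₀ = -m - p + (t - 1) r`, the quantity
`(2m + 1 + c)(2m - 1 + c) β_m` expressed through `p` and `r`. -/
noncomputable def recF (α β γ m t p r : ℝ) : ℝ :=
  t * (t - 1) * (r * (r - γ)) - (t - 1) * ((p - t * r) * (p - t * r - β)) +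
    t * ((-m - p + (t - 1) * r) * (-m - p + (t - 1) * r - α))

/-- The companion of `recF`. -/
noncomputable def recS (α β γ m t p r : ℝ) : ℝ :=
  (p - t * r) * (p - t * r - β) - (-m - p + (t - 1) * r) * (-m - p + (t - 1) * r - α) -
    (2 * t - 1) * (r * (r - γ))

/-- Put k = 2m+1+c and k' = (2m-1+c)b. The hypotheses give xy, (k+tx)(k'+ty) and
(k+(t-1)x)(k'+(t-1)y), which are linear in the three unknowns kk', ky+k'x and xy. Solving for the
first two gives `recF` and `recS`. -/
theorem rec_identities {α β γ m t p r x y b c : ℝ} (hxy : x * y = r * (r - γ))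
    (h1 : (-(2 * m + 1 + c) - t * x) * (-(2 * m - 1 + c) * b - t * y) =
      (p - t * r) * (p - t * r - β))
    (h0 : ((2 * m + 1 + c) + (t - 1) * x) * ((2 * m - 1 + c) * b + (t - 1) * y) =
      (-m - p + (t - 1) * r) * (-m - p + (t - 1) * r - α)) :
    (2 * m + 1 + c) * (2 * m - 1 + c) * b = recF α β γ m t p r ∧
    (2 * m + 1 + c) * y + (2 * m - 1 + c) * b * x = recS α β γ m t p r := by
  unfold recF recS
  rw [← h1, ← h0, ← hxy]
  constructor <;> ring

/-- The terms quadratic in r cancel. Hence r can be solved for rationally in t, p and b, which is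
how its differentiability is obtained. -/
theorem recF_eq (α β γ m t p r : ℝ) : recF α β γ m t p r =
    -(t * (t - 1) * (2 * m + (α + β + γ))) * r +
      (t * ((m + p) * (m + p + α)) - (t - 1) * (p * (p - β))) := by
  unfold recF; ring

/-- In the notation of `rec_identities`, ky+k'x is `recS` and the product of ky and k'x is
`recF`·r(r-γ). Differentiating the expression of r through p and b shows that t(t-1)r' is minus the
difference ky - k'x, whose square is therefore a discriminant. -/
theorem recursion_ode {α β γ m t : ℝ} {p r b : ℝ → ℝ} {x y : ℝ} (ht : t ∈ Ioo (0 : ℝ) 1)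
    (hm : 0 < 2 * m + (α + β + γ))
    (hF : ∀ᶠ s in 𝓝 t, (2 * m + 1 + (α + β + γ)) * (2 * m - 1 + (α + β + γ)) * b s =
      recF α β γ m s (p s) (r s))
    (hS : (2 * m + 1 + (α + β + γ)) * y + (2 * m - 1 + (α + β + γ)) * b t * x =
      recS α β γ m t (p t) (r t))
    (hxy : x * y = r t * (r t - γ))
    (hp : HasDerivAt p (r t) t) (hb : HasDerivAt b (y - b t * x) t) :
    ∃ r₁, HasDerivAt r r₁ t ∧ (t * (t - 1) * r₁) ^ 2 =
      recS α β γ m t (p t) (r t) ^ 2 - 4 * recF α β γ m t (p t) (r t) * (r t * (r t - γ)) := by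
  set K := 2 * m + (α + β + γ) with hK
  have ht0 : t ≠ 0 := ht.1.ne'
  have ht1 : t - 1 ≠ 0 := by linarith [ht.2]
  have hr : r =ᶠ[𝓝 t] fun s => ((s * ((m + p s) * (m + p s + α)) - (s - 1) * (p s * (p s - β))) -
      (2 * m + 1 + (α + β + γ)) * (2 * m - 1 + (α + β + γ)) * b s) / (s * (s - 1) * K) := by
    filter_upwards [hF, Ioo_mem_nhds ht.1 ht.2] with s hs hs'
    have h0 : s ≠ 0 := hs'.1.ne'
    have h1 : s - 1 ≠ 0 := by linarith [hs'.2]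
    rw [hs, recF_eq]; field_simp; ring
  have hid := hasDerivAt_id t
  have hd := (((hid.mul ((hp.const_add m).mul ((hp.const_add m).add_const α))).sub
    ((hid.sub_const 1).mul (hp.mul (hp.sub_const β)))).sub
    (hb.const_mul ((2 * m + 1 + (α + β + γ)) * (2 * m - 1 + (α + β + γ))))).div
    ((hid.mul (hid.sub_const 1)).mul_const K) (by simp; exact ⟨⟨ht0, ht1⟩, hm.ne'⟩)
  refine ⟨_, hd.congr_of_eventuallyEq hr, ?_⟩
  have hFt := hF.self_of_nhds
  have key : ∀ d : ℝ, d * (t * (t - 1) * K) = ((m + p t) * (m + p t + α) - p t * (p t - β)) +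
      (t * (2 * (m + p t) + α) - (t - 1) * (2 * p t - β)) * r t -
      (2 * m + 1 + (α + β + γ)) * (2 * m - 1 + (α + β + γ)) * (y - b t * x) -
      (2 * t - 1) * K * r t →
      (t * (t - 1) * d) ^ 2 =
      recS α β γ m t (p t) (r t) ^ 2 - 4 * recF α β γ m t (p t) (r t) * (r t * (r t - γ)) := by
    intro d hd
    -- The differentiated relation gives the difference ky - k'x only after the sum `recS` has been
    -- used; K cancels because it is positive.
    have e1 : K * (t * (t - 1) * d) =
        K * -((2 * m + 1 + (α + β + γ)) * y - (2 * m - 1 + (α + β + γ)) * b t * x) := by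
      rw [show K * (t * (t - 1) * d) = d * (t * (t - 1) * K) by ring, hd]
      have hS' := hS
      unfold recS at hS'
      rw [hK]
      linear_combination hS'
    rw [mul_left_cancel₀ hm.ne' e1, ← hS, ← hFt, ← hxy]; ring
  apply key
  have hrt := hr.self_of_nhds
  have e2 : (t * ((m + p t) * (m + p t + α)) - (t - 1) * (p t * (p t - β))) -
      (2 * m + 1 + (α + β + γ)) * (2 * m - 1 + (α + β + γ)) * b t = r t * (t * (t - 1) * K) := by
    rw [hrt]; field_simp
  simp only [Pi.mul_apply, Pi.sub_apply, id]
  rw [e2]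
  field_simp
  ring

namespace IsPerturbedJacobi

variable {α β γ : ℝ} {L L₀ L₁ Lₜ : ℝ → ℝ[X] →ₗ[ℝ] ℝ}

theorem hasDerivAt_norm (h : IsPerturbedJacobi α β γ L L₀ L₁ Lₜ) {t : ℝ}
    (ht : t ∈ Ioo (0 : ℝ) 1) (n : ℕ) :
    HasDerivAt (fun s => opNorm (L s) n)
      (-(γ * Lₜ t (monicOP (L t) n * monicOP (L t) n))) t := by
  refine (hasDerivAt_opNorm (h.hasDerivAt t) (h.eventually_pos ht) n).congr_deriv ?_
  simp

/-- The second-order equation satisfied by the subleading coefficient. -/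
theorem exists_ode (h : IsPerturbedJacobi α β γ L L₀ L₁ Lₜ) (hc : 0 < α + β + γ) (n : ℕ) :
    ∃ r r₁ : ℝ → ℝ, ∀ t ∈ Ioo (0 : ℝ) 1,
      HasDerivAt (fun s => opSubCoeff (L s) (n + 1)) (r t) t ∧ HasDerivAt r (r₁ t) t ∧
      (t * (t - 1) * r₁ t) ^ 2 =
        recS α β γ (n + 1) t (opSubCoeff (L t) (n + 1)) (r t) ^ 2 -
          4 * recF α β γ (n + 1) t (opSubCoeff (L t) (n + 1)) (r t) * (r t * (r t - γ)) := by
  -- Here r is p', b is the recurrence coefficient h_{n+1}/h_n, x is -(log h_{n+1})' and y is -b(log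
  -- h_n)', so that b' = y - bx.
  set r : ℝ → ℝ := fun t => γ * Lₜ t (monicOP (L t) (n + 1) * monicOP (L t) n) / opNorm (L t) n
    with hr
  set b : ℝ → ℝ := fun t => opNorm (L t) (n + 1) / opNorm (L t) n with hb
  set x : ℝ → ℝ := fun t => γ * Lₜ t (monicOP (L t) (n + 1) * monicOP (L t) (n + 1)) /
    opNorm (L t) (n + 1) with hx
  set y : ℝ → ℝ := fun t => γ * Lₜ t (monicOP (L t) n * monicOP (L t) n) *
    opNorm (L t) (n + 1) / opNorm (L t) n ^ 2 with hy
  set p : ℝ → ℝ := fun t => opSubCoeff (L t) (n + 1) with hp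
  have halg : ∀ t ∈ Ioo (0 : ℝ) 1, x t * y t = r t * (r t - γ) ∧
      (2 * ((n : ℝ) + 1) + 1 + (α + β + γ)) * (2 * ((n : ℝ) + 1) - 1 + (α + β + γ)) * b t =
        recF α β γ (n + 1) t (p t) (r t) ∧
      (2 * ((n : ℝ) + 1) + 1 + (α + β + γ)) * y t +
        (2 * ((n : ℝ) + 1) - 1 + (α + β + γ)) * b t * x t = recS α β γ (n + 1) t (p t) (r t) := by
    intro t ht
    have hpos := h.pos t ht
    have n0 := (opNorm_pos hpos n).ne'
    have n1 := (opNorm_pos hpos (n + 1)).ne'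
    have k0 := resolvent_mul_resolvent hpos (h.zero t) n
    have k1 := resolvent_mul_resolvent hpos (h.one t) n
    have kt := resolvent_mul_resolvent hpos (h.sing t) n
    have d1 := h.diag_X ht n
    have d1' := h.diag_X ht (n + 1)
    have d0 := h.diag_sum ht n
    have d0' := h.diag_sum ht (n + 1)
    have o0 := h.offdiag_sum ht n
    have o1 := h.offdiag_X ht n
    have hxy : x t * y t = r t * (r t - γ) := by
      simp only [hx, hy, hr]
      field_simp
      linear_combination γ ^ 2 * kt
    push_cast at d1'
    -- The linear Pearson relations express the values of `L₁` and `L₀` through x, y, p and r. The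
    -- quadratic relations at 1 and 0 then become the two product hypotheses of `rec_identities`.
    have ex : -(2 * ((n : ℝ) + 1) + 1 + (α + β + γ)) - t * x t =
        β * L₁ t (monicOP (L t) (n + 1) * monicOP (L t) (n + 1)) / opNorm (L t) (n + 1) := by
      simp only [hx]; field_simp; linear_combination -d1'
    have ey : -(2 * ((n : ℝ) + 1) - 1 + (α + β + γ)) * b t - t * y t =
        β * L₁ t (monicOP (L t) n * monicOP (L t) n) * opNorm (L t) (n + 1) /
          opNorm (L t) n ^ 2 := by
      simp only [hb, hy]; field_simp; linear_combination -d1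
    have ex0 : (2 * ((n : ℝ) + 1) + 1 + (α + β + γ)) + (t - 1) * x t =
        α * L₀ t (monicOP (L t) (n + 1) * monicOP (L t) (n + 1)) / opNorm (L t) (n + 1) := by
      simp only [hx]; field_simp; linear_combination d1' - d0'
    have ey0 : (2 * ((n : ℝ) + 1) - 1 + (α + β + γ)) * b t + (t - 1) * y t =
        α * L₀ t (monicOP (L t) n * monicOP (L t) n) * opNorm (L t) (n + 1) /
          opNorm (L t) n ^ 2 := by
      simp only [hb, hy]; field_simp; linear_combination d1 - d0
    have eb1 : p t - t * r t =
        β * L₁ t (monicOP (L t) (n + 1) * monicOP (L t) n) / opNorm (L t) n := by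
      simp only [hp, hr]; field_simp; linear_combination -o1
    have eb0 : -((n : ℝ) + 1) - p t + (t - 1) * r t =
        α * L₀ t (monicOP (L t) (n + 1) * monicOP (L t) n) / opNorm (L t) n := by
      simp only [hp, hr]; field_simp; linear_combination o1 - o0
    refine ⟨hxy, rec_identities hxy ?_ ?_⟩
    · rw [ex, ey, eb1]; field_simp; linear_combination β ^ 2 * k1
    · rw [ex0, ey0, eb0]; field_simp; linear_combination α ^ 2 * k0
  have hder : ∀ t ∈ Ioo (0 : ℝ) 1, HasDerivAt p (r t) t := by
    intro t ht
    refine (hasDerivAt_opSubCoeff (h.hasDerivAt t) (h.eventually_pos ht) n).congr_deriv ?_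
    simp [hr]
  have hodd : ∀ t ∈ Ioo (0 : ℝ) 1, ∃ r₁, HasDerivAt r r₁ t ∧ (t * (t - 1) * r₁) ^ 2 =
      recS α β γ (n + 1) t (p t) (r t) ^ 2 -
        4 * recF α β γ (n + 1) t (p t) (r t) * (r t * (r t - γ)) := by
    intro t ht
    have n0 := (opNorm_pos (h.pos t ht) n).ne'
    have n1 := (opNorm_pos (h.pos t ht) (n + 1)).ne'
    refine recursion_ode (b := b) (x := x t) (y := y t) ht (by positivity) ?_ (halg t ht).2.2
      (halg t ht).1 (hder t ht) ?_
    · filter_upwards [Ioo_mem_nhds ht.1 ht.2] with s hs using (halg s hs).2.1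
    · refine ((h.hasDerivAt_norm ht (n + 1)).div (h.hasDerivAt_norm ht n) n0).congr_deriv ?_
      simp only [hb, hx, hy]; field_simp; ring
  choose! r₁ hr₁ using hodd
  exact ⟨r, r₁, fun t ht => ⟨hder t ht, hr₁ t ht⟩⟩

/-- The logarithmic derivative of the Hankel determinant. -/
theorem sum_log_deriv (h : IsPerturbedJacobi α β γ L L₀ L₁ Lₜ) {t : ℝ}
    (ht : t ∈ Ioo (0 : ℝ) 1) (n : ℕ) :
    t * (1 - t) * ∑ k ∈ Finset.range n,
        γ * Lₜ t (monicOP (L t) k * monicOP (L t) k) / opNorm (L t) k =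
      -((n : ℝ) ^ 2 + n * (α + γ) - n * γ * t) -
        (2 * n + (α + β + γ)) * opSubCoeff (L t) n := by
  induction n with
  | zero => simp [opSubCoeff_zero]
  | succ n ih =>
    rw [Finset.sum_range_succ, mul_add, ih]
    have n0 := (opNorm_pos (h.pos t ht) n).ne'
    -- The coefficients of the subleading terms are 2n+2+c at n+1 and 2n+c at n, with c = α+β+γ, so
    -- the sum telescopes.
    have := h.diag_quadratic ht n
    rw [mul_div_assoc', this, mul_div_cancel_right₀ _ n0]
    push_cast; ring

end IsPerturbedJacobi

/-! ### The concrete weight and the equation for H_n -/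

section concrete

variable {α β γ A B : ℝ}

/-- The moment functional of the perturbed Jacobi weight. -/
noncomputable def jacobiL (A B : ℝ) (hα : 0 < α) (hβ : 0 < β) (hγ : 0 < γ) (t : ℝ) :
    ℝ[X] →ₗ[ℝ] ℝ :=
  weightFunctional _ (intervalIntegrable_jacobiWeight (A := A) (B := B) hα hβ hγ t)

/-- The moment functional of `w / x`. -/
noncomputable def jacobiL₀ (A B : ℝ) (hα : 0 < α) (hβ : 0 < β) (hγ : 0 < γ) (t : ℝ) :
    ℝ[X] →ₗ[ℝ] ℝ :=
  weightFunctional _ (intervalIntegrable_jacobiWeight_div_self (A := A) (B := B) hα hβ hγ t)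

/-- The moment functional of `w / (x - 1)`. -/
noncomputable def jacobiL₁ (A B : ℝ) (hα : 0 < α) (hβ : 0 < β) (hγ : 0 < γ) (t : ℝ) :
    ℝ[X] →ₗ[ℝ] ℝ :=
  weightFunctional _ (intervalIntegrable_jacobiWeight_div_sub_one (A := A) (B := B) hα hβ hγ t)

/-- The moment functional of `w / (x - t)`, given by integration by parts. -/
noncomputable def jacobiLt (A B : ℝ) (hα : 0 < α) (hβ : 0 < β) (hγ : 0 < γ) (t : ℝ) :
    ℝ[X] →ₗ[ℝ] ℝ :=
  -γ⁻¹ • (jacobiL A B hα hβ hγ t ∘ₗ derivative + α • jacobiL₀ A B hα hβ hγ t +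
    β • jacobiL₁ A B hα hβ hγ t)

theorem jacobiL_sum_eq (hα : 0 < α) (hβ : 0 < β) (hγ : 0 < γ) (t : ℝ) (f : ℝ[X]) :
    jacobiL A B hα hβ hγ t (derivative f) + α * jacobiL₀ A B hα hβ hγ t f +
      β * jacobiL₁ A B hα hβ hγ t f =
    ∫ x in (0 : ℝ)..1, baseDeriv α β f x * stepPower γ A B (x - t) := by
  simp only [jacobiL, jacobiL₀, jacobiL₁, weightFunctional_apply]
  have i0 := (intervalIntegrable_jacobiWeight (A := A) (B := B) hα hβ hγ t).continuousOn_mul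
    (derivative f).continuous.continuousOn
  have i1 := (intervalIntegrable_jacobiWeight_div_self (A := A) (B := B) hα hβ hγ
    t).continuousOn_mul f.continuous.continuousOn
  have i2 := (intervalIntegrable_jacobiWeight_div_sub_one (A := A) (B := B) hα hβ hγ
    t).continuousOn_mul f.continuous.continuousOn
  rw [← intervalIntegral.integral_const_mul, ← intervalIntegral.integral_const_mul,
    ← intervalIntegral.integral_add i0 (i1.const_mul α),
    ← intervalIntegral.integral_add (i0.add (i1.const_mul α)) (i2.const_mul β)]
  congr 1; ext x
  simp only [jacobiWeight_eq, baseDeriv]; ring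

theorem isPerturbedJacobi (hα : 0 < α) (hβ : 0 < β) (hγ : 0 < γ)
    (hA : 0 ≤ A) (hAB : 0 < A + B) :
    IsPerturbedJacobi α β γ (jacobiL A B hα hβ hγ) (jacobiL₀ A B hα hβ hγ)
      (jacobiL₁ A B hα hβ hγ) (jacobiLt A B hα hβ hγ) where
  pos t ht f hf := by
    refine weightFunctional_sq_pos _ ⟨ht.1.le, ht.2⟩ (fun x hx => ?_) (fun x hx => ?_) hf
    · rw [jacobiWeight_eq]
      exact mul_nonneg (baseWeight_pos hx.1 hx.2).le (stepPower_nonneg hA hAB _)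
    · rw [jacobiWeight_eq, stepPower_of_pos (by linarith [hx.1])]
      have : 0 < x - t := by linarith [hx.1]
      exact mul_pos (baseWeight_pos (ht.1.trans hx.1) hx.2) (by positivity)
  zero t f := weightFunctional_sub_mul _ _ (fun x hx => by
    have := hx.1.ne'
    simp [div_mul_cancel₀ _ this]) f
  one t f := weightFunctional_sub_mul _ _ (fun x hx => by
    have : x - 1 ≠ 0 := by linarith [hx.2]
    simp [div_mul_cancel₀ _ this]) f
  -- `jacobiLt` is defined so that the Pearson relation holds by construction. That it really
  -- divides by X - t is the integration by parts `integral_baseDeriv_mul`.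
  sing t f := by
    have h1 := jacobiL_sum_eq (A := A) (B := B) hα hβ hγ t ((X - C t) * f)
    have h2 := integral_baseDeriv_mul (A := A) (B := B) hα hβ hγ f t
    have h3 : ∫ x in (0 : ℝ)..1, baseDeriv α β ((X - C t) * f) x * stepPower γ A B (x - t) =
        jacobiL A B hα hβ hγ t f + ∫ x in (0 : ℝ)..1,
          baseDeriv α β f x * ((x - t) * stepPower γ A B (x - t)) := by
      have hc : Continuous fun x : ℝ => (x - t) * stepPower γ A B (x - t) :=
        (continuous_id.sub continuous_const).mul
          ((continuous_stepPower hγ).comp (continuous_id.sub continuous_const))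
      rw [jacobiL, weightFunctional_apply, ← intervalIntegral.integral_add
        ((intervalIntegrable_jacobiWeight (A := A) (B := B) hα hβ hγ t).continuousOn_mul
          f.continuous.continuousOn)
        ((intervalIntegrable_baseDeriv hα hβ f).mul_continuousOn hc.continuousOn)]
      congr 1; ext x
      simp only [jacobiWeight_eq, baseDeriv, derivative_mul, derivative_sub, derivative_X,
        derivative_C, eval_add, eval_mul, eval_sub, eval_X, eval_C, sub_zero, eval_one]
      ring
    have h4 : ∫ x in (0 : ℝ)..1, f.eval x * jacobiWeight α β γ A B x t =
      jacobiL A B hα hβ hγ t f := rfl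
    simp only [jacobiLt, LinearMap.smul_apply, LinearMap.add_apply, LinearMap.comp_apply,
      smul_eq_mul]
    rw [h1, h3, h2, h4]
    field_simp; ring
  pearson t f := by
    simp only [jacobiLt, LinearMap.smul_apply, LinearMap.add_apply, LinearMap.comp_apply,
      smul_eq_mul]
    field_simp; ring
  hasDerivAt t f := by
    refine (hasDerivAt_integral_jacobiWeight (A := A) (B := B) hα hβ hγ f t).congr_deriv ?_
    rw [← jacobiL_sum_eq hα hβ hγ t f]
    simp only [jacobiLt, LinearMap.smul_apply, LinearMap.add_apply, LinearMap.comp_apply,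
      smul_eq_mul]
    field_simp

theorem hankelDet_eq_det (hα : 0 < α) (hβ : 0 < β) (hγ : 0 < γ) (n : ℕ) (t : ℝ) :
    hankelDet α β γ A B n t =
      (Matrix.of fun i j : Fin n =>
        jacobiL A B hα hβ hγ t (X ^ ((i : ℕ) + (j : ℕ)))).det := by
  simp [hankelDet, jacobiL, weightFunctional_apply]

theorem hankelDet_eq_prod (hα : 0 < α) (hβ : 0 < β) (hγ : 0 < γ) (hA : 0 ≤ A)
    (hAB : 0 < A + B) (n : ℕ) {t : ℝ} (ht : t ∈ Ioo (0 : ℝ) 1) :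
    hankelDet α β γ A B n t =
      ∏ k ∈ Finset.range n, opNorm (jacobiL A B hα hβ hγ t) k := by
  rw [hankelDet_eq_det hα hβ hγ, det_functional_eq_prod
    ((isPerturbedJacobi hα hβ hγ hA hAB).pos t ht)]

theorem hankelDet_pos (hα : 0 < α) (hβ : 0 < β) (hγ : 0 < γ) (hA : 0 ≤ A)
    (hAB : 0 < A + B) (n : ℕ) {t : ℝ} (ht : t ∈ Ioo (0 : ℝ) 1) :
    0 < hankelDet α β γ A B n t := by
  rw [hankelDet_eq_prod hα hβ hγ hA hAB n ht]
  exact Finset.prod_pos fun k _ => opNorm_pos ((isPerturbedJacobi hα hβ hγ hA hAB).pos t ht) k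

theorem differentiableAt_hankelDet (hα : 0 < α) (hβ : 0 < β) (hγ : 0 < γ) (n : ℕ) (t : ℝ) :
    DifferentiableAt ℝ (hankelDet α β γ A B n) t := by
  have : hankelDet α β γ A B n = fun t => ∑ σ : Equiv.Perm (Fin n), ((Equiv.Perm.sign σ : ℤ) : ℝ) *
      ∏ i : Fin n, jacobiL A B hα hβ hγ t (X ^ ((σ i : ℕ) + (i : ℕ))) := by
    ext t; rw [hankelDet_eq_det hα hβ hγ, Matrix.det_apply']; rfl
  rw [this]
  refine DifferentiableAt.fun_sum fun σ _ => DifferentiableAt.const_mul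
    (DifferentiableAt.fun_finsetProd fun i _ => ?_) _
  exact (hasDerivAt_integral_jacobiWeight (A := A) (B := B) hα hβ hγ _ t).differentiableAt

theorem hankelH_eq (hα : 0 < α) (hβ : 0 < β) (hγ : 0 < γ) (hA : 0 ≤ A)
    (hAB : 0 < A + B) (n : ℕ) {t : ℝ} (ht : t ∈ Ioo (0 : ℝ) 1) :
    hankelH α β γ A B n t = -((n : ℝ) ^ 2 + n * (α + γ) - n * γ * t) -
        (2 * n + (α + β + γ)) * opSubCoeff (jacobiL A B hα hβ hγ t) n := by
  have h := isPerturbedJacobi hα hβ hγ hA hAB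
  rw [← h.sum_log_deriv ht n]
  have hd : HasDerivAt (fun u => Real.log (hankelDet α β γ A B n u))
      (∑ k ∈ Finset.range n, -(γ * jacobiLt A B hα hβ hγ t
        (monicOP (jacobiL A B hα hβ hγ t) k * monicOP (jacobiL A B hα hβ hγ t) k)) /
          opNorm (jacobiL A B hα hβ hγ t) k) t := by
    have : HasDerivAt (fun u => ∑ k ∈ Finset.range n,
        Real.log (opNorm (jacobiL A B hα hβ hγ u) k)) _ t :=
      HasDerivAt.fun_sum fun k _ => (h.hasDerivAt_norm ht k).log (opNorm_pos (h.pos t ht) k).ne'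
    refine this.congr_of_eventuallyEq ?_
    filter_upwards [Ioo_mem_nhds ht.1 ht.2] with s hs
    rw [hankelDet_eq_prod hα hβ hγ hA hAB n hs, Real.log_prod]
    exact fun k _ => (opNorm_pos (h.pos s hs) k).ne'
  rw [hankelH, hd.deriv]
  simp only [neg_div, Finset.sum_neg_distrib]
  ring

/-- The second-order second-degree equation satisfied by `H_n`. -/
theorem hankelH_ode (hα : 0 < α) (hβ : 0 < β) (hγ : 0 < γ) (hA : 0 ≤ A)
    (hAB : 0 < A + B) {n : ℕ} (hn : n ≠ 0) :
    ∃ p r r₁ : ℝ → ℝ, ∀ t ∈ Ioo (0 : ℝ) 1,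
      hankelH α β γ A B n t = -((n : ℝ) ^ 2 + n * (α + γ) - n * γ * t) -
        (2 * n + (α + β + γ)) * p t ∧
      HasDerivAt (hankelH α β γ A B n) (n * γ - (2 * n + (α + β + γ)) * r t) t ∧
      HasDerivAt (fun t => n * γ - (2 * n + (α + β + γ)) * r t)
        (-(2 * n + (α + β + γ)) * r₁ t) t ∧
      (t * (t - 1) * r₁ t) ^ 2 =
        recS α β γ n t (p t) (r t) ^ 2 - 4 * recF α β γ n t (p t) (r t) * (r t * (r t - γ)) := by
  obtain ⟨n, rfl⟩ := Nat.exists_eq_succ_of_ne_zero hn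
  have h := isPerturbedJacobi hα hβ hγ hA hAB
  obtain ⟨r, r₁, hr⟩ := h.exists_ode (by positivity) n
  refine ⟨fun t => opSubCoeff (jacobiL A B hα hβ hγ t) (n + 1), r, r₁, fun t ht => ?_⟩
  obtain ⟨h1, h2, h3⟩ := hr t ht
  refine ⟨hankelH_eq hα hβ hγ hA hAB _ ht, ?_, ?_, ?_⟩
  · have e := (((hasDerivAt_id t).const_mul (((n + 1 : ℕ) : ℝ) * γ)).const_sub
      (((n + 1 : ℕ) : ℝ) ^ 2 + ((n + 1 : ℕ) : ℝ) * (α + γ))).neg.sub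
      (h1.const_mul (2 * ((n + 1 : ℕ) : ℝ) + (α + β + γ)))
    refine (e.congr_of_eventuallyEq ?_).congr_deriv (by simp)
    filter_upwards [Ioo_mem_nhds ht.1 ht.2] with s hs
    rw [Nat.succ_eq_add_one, hankelH_eq hα hβ hγ hA hAB _ hs]; rfl
  · refine ((h2.const_mul (2 * ((n + 1 : ℕ) : ℝ) + (α + β + γ))).const_sub _).congr_deriv ?_
    push_cast; ring
  · simpa using h3

end concrete

/-! ### Jacobi polynomials on [0, 1] -/

section jacobi

/-- The coefficients of the Jacobi polynomials on `[0, 1]` normalised by the value `1` at `0`. -/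
noncomputable def jacCoeff (a b : ℝ) (k i : ℕ) : ℝ :=
  ∏ j ∈ Finset.range i, (-((k - j) * (k + (a + b + 1) + j)) / ((a + 1 + j) * (j + 1)))

/-- The Jacobi polynomials `₂F₁(-k, k + a + b + 1; a + 1; x)`. -/
noncomputable def jacPoly (a b : ℝ) (k : ℕ) : ℝ[X] :=
  ∑ i ∈ Finset.range (k + 1), C (jacCoeff a b k i) * X ^ i

/-- The squared norm of `jacPoly a b k` for the weight `x ^ a (1 - x) ^ b`. -/
noncomputable def jacNorm (a b : ℝ) (k : ℕ) : ℝ :=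
  k.factorial * Real.Gamma (a + 1) ^ 2 * Real.Gamma (k + b + 1) /
    ((2 * k + (a + b + 1)) * Real.Gamma (k + a + 1) * Real.Gamma (k + (a + b + 1)))

theorem jacCoeff_zero (a b : ℝ) (k : ℕ) : jacCoeff a b k 0 = 1 := by simp [jacCoeff]

theorem jacCoeff_succ (a b : ℝ) (k i : ℕ) : jacCoeff a b k (i + 1) =
    jacCoeff a b k i * (-((k - i) * (k + (a + b + 1) + i)) / ((a + 1 + i) * (i + 1))) := by
  rw [jacCoeff, Finset.prod_range_succ]; rfl

theorem jacCoeff_of_lt (a b : ℝ) {k i : ℕ} (h : k < i) : jacCoeff a b k i = 0 :=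
  Finset.prod_eq_zero (Finset.mem_range.2 h) (by simp)

theorem coeff_jacPoly (a b : ℝ) (k i : ℕ) : (jacPoly a b k).coeff i = jacCoeff a b k i := by
  simp only [jacPoly, finsetSum_coeff, coeff_C_mul, coeff_X_pow, mul_ite, mul_one, mul_zero,
    Finset.sum_ite_eq, Finset.mem_range]
  split_ifs with h
  · rfl
  · rw [jacCoeff_of_lt a b (by omega)]

theorem degree_jacPoly_lt (a b : ℝ) (k : ℕ) : (jacPoly a b k).degree < (k + 1 : ℕ) := by
  rw [degree_lt_iff_coeff_zero]
  intro m hm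
  rw [coeff_jacPoly, jacCoeff_of_lt a b (by omega)]

variable {a b : ℝ}

theorem jacCoeff_self_ne_zero (ha : 0 ≤ a) (hb : 0 ≤ b) (k : ℕ) : jacCoeff a b k k ≠ 0 := by
  refine Finset.prod_ne_zero_iff.2 fun j hj => ?_
  have h1 : (0 : ℝ) < k - j := by
    have : (j : ℝ) < k := by exact_mod_cast Finset.mem_range.1 hj
    linarith
  have h2 : (0 : ℝ) < k + (a + b + 1) + j := by positivity
  have h3 : (0 : ℝ) < (a + 1 + j) * (j + 1) := by positivity
  exact div_ne_zero (neg_ne_zero.2 (mul_pos h1 h2).ne') h3.ne'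

/-- The hypergeometric equation, compared coefficient by coefficient, is the recursion
`jacCoeff_succ`. -/
theorem jacPoly_eigen (ha : 0 ≤ a) (k : ℕ) :
    X * (1 - X) * derivative (derivative (jacPoly a b k)) +
      (C (a + 1) - C (a + b + 2) * X) * derivative (jacPoly a b k) =
    C (-((k : ℝ) * (k + (a + b + 1)))) * jacPoly a b k := by
  set φ := jacPoly a b k with hφ
  have e : X * (1 - X) * derivative (derivative φ) + (C (a + 1) - C (a + b + 2) * X) * derivative φ =
      X * derivative (derivative φ) - X * (X * derivative (derivative φ)) +
        C (a + 1) * derivative φ - C (a + b + 2) * (X * derivative φ) := by ring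
  have h1 : ∀ m, (X * derivative φ).coeff m = φ.coeff m * m := by
    intro m
    cases m with
    | zero => simp
    | succ m => rw [coeff_X_mul, coeff_derivative]; push_cast; ring
  have h2 : ∀ m, (X * derivative (derivative φ)).coeff m = φ.coeff (m + 1) * (m + 1) * m := by
    intro m
    cases m with
    | zero => simp
    | succ m => rw [coeff_X_mul, coeff_derivative, coeff_derivative]; push_cast; ring
  have h3 : ∀ m, (X * (X * derivative (derivative φ))).coeff m = φ.coeff m * m * (m - 1) := by
    intro m
    cases m with
    | zero => simp
    | succ m => rw [coeff_X_mul, h2]; push_cast; ring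
  rw [e]
  ext m
  rw [coeff_sub, coeff_add, coeff_sub, coeff_C_mul, coeff_C_mul, coeff_C_mul, h1, h2, h3,
    coeff_derivative, hφ, coeff_jacPoly, coeff_jacPoly, jacCoeff_succ]
  have : a + 1 + m ≠ 0 := by positivity
  have : (m : ℝ) + 1 ≠ 0 := by positivity
  field_simp
  ring

theorem jacCoeff_shift (ha : 0 ≤ a) (k i : ℕ) : (i + 1) * jacCoeff a b (k + 1) (i + 1) =
    -((k + 1) * (k + 1 + (a + b + 1)) / (a + 1)) * jacCoeff (a + 1) (b + 1) k i := by
  have h0 : a + 1 ≠ 0 := by positivity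
  induction i with
  | zero => rw [jacCoeff_succ, jacCoeff_zero, jacCoeff_zero]; push_cast; field_simp; ring
  | succ i ih =>
    rw [jacCoeff_succ, jacCoeff_succ (a + 1), ← mul_assoc (-(_ / _)) (jacCoeff _ _ _ _), ← ih]
    have : a + 1 + ((i : ℝ) + 1) ≠ 0 := by positivity
    have : a + 1 + 1 + (i : ℝ) ≠ 0 := by positivity
    have : (i : ℝ) + 1 ≠ 0 := by positivity
    have : (i : ℝ) + 1 + 1 ≠ 0 := by positivity
    push_cast
    field_simp
    ring

theorem derivative_jacPoly_succ (ha : 0 ≤ a) (k : ℕ) : derivative (jacPoly a b (k + 1)) =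
    C (-((k + 1) * (k + 1 + (a + b + 1)) / (a + 1))) * jacPoly (a + 1) (b + 1) k := by
  ext i
  rw [coeff_derivative, coeff_C_mul, coeff_jacPoly, coeff_jacPoly, ← jacCoeff_shift ha, mul_comm]

/-- The moment functional of `x ^ a (1 - x) ^ b`. -/
noncomputable def betaFunctional (a b : ℝ) (ha : -1 < a) (hb : -1 < b) : ℝ[X] →ₗ[ℝ] ℝ :=
  weightFunctional _ (intervalIntegrable_baseWeight ha hb)

theorem betaFunctional_X_mul {a' : ℝ} (ha : -1 < a) (ha' : -1 < a') (hb : -1 < b)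
    (h : a = a' + 1) (f : ℝ[X]) :
    betaFunctional a' b ha' hb (X * f) = betaFunctional a b ha hb f := by
  simp only [betaFunctional, weightFunctional_apply]
  refine intervalIntegral_congr_Ioo zero_le_one fun x hx => ?_
  simp only [baseWeight, h, eval_mul, eval_X]
  rw [Real.rpow_add_one hx.1.ne']; ring

theorem betaFunctional_X_mul_one_sub (ha : -1 < a) (hb : -1 < b) (f : ℝ[X]) :
    betaFunctional a b ha hb (X * (1 - X) * f) =
      betaFunctional (a + 1) (b + 1) (by linarith) (by linarith) f := by
  simp only [betaFunctional, weightFunctional_apply]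
  refine intervalIntegral_congr_Ioo zero_le_one fun x hx => ?_
  have : (1 : ℝ) - x ≠ 0 := by linarith [hx.2]
  simp only [baseWeight, eval_mul, eval_X, eval_sub, eval_one]
  rw [Real.rpow_add_one hx.1.ne', Real.rpow_add_one this]; ring

/-- The integrand is the total derivative of f x^(a+1)(1-x)^(b+1), which vanishes at both ends. -/
theorem betaFunctional_pearson (ha : -1 < a) (hb : -1 < b) (f : ℝ[X]) :
    betaFunctional a b ha hb
      (X * (1 - X) * derivative f + (C (a + 1) - C (a + b + 2) * X) * f) = 0 := by
  have ha1 : 0 < a + 1 := by linarith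
  have hb1 : 0 < b + 1 := by linarith
  have key := intervalIntegral.integral_eq_sub_of_hasDerivAt_of_le zero_le_one
    ((f.continuous.mul (continuous_baseWeight ha1.le hb1.le)).continuousOn (s := Icc 0 1))
    (fun x hx => hasDerivAt_eval_mul_baseWeight (α := a + 1) (β := b + 1) f hx.1 hx.2)
    (intervalIntegrable_baseDeriv ha1 hb1 f)
  have e0 : baseWeight (a + 1) (b + 1) 0 = 0 := by simp [baseWeight, Real.zero_rpow ha1.ne']
  have e1 : baseWeight (a + 1) (b + 1) 1 = 0 := by simp [baseWeight, Real.zero_rpow hb1.ne']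
  simp only [Pi.mul_apply, e0, e1, mul_zero, sub_zero] at key
  rw [← key, betaFunctional, weightFunctional_apply]
  refine intervalIntegral_congr_Ioo zero_le_one fun x hx => ?_
  have h1 : (1 : ℝ) - x ≠ 0 := by linarith [hx.2]
  have h2 : x - 1 ≠ 0 := by linarith [hx.2]
  have h3 : x ≠ 0 := hx.1.ne'
  simp only [baseDeriv, baseWeight, eval_mul, eval_X, eval_sub, eval_one, eval_add, eval_C]
  rw [Real.rpow_add_one hx.1.ne', Real.rpow_add_one h1]
  field_simp
  ring

theorem isPosFunctional_betaFunctional (ha : -1 < a) (hb : -1 < b) :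
    IsPosFunctional (betaFunctional a b ha hb) := fun _ hf =>
  weightFunctional_sq_pos _ (t := 0) ⟨le_rfl, zero_lt_one⟩
    (fun _ hx => (baseWeight_pos hx.1 hx.2).le) (fun _ hx => baseWeight_pos hx.1 hx.2) hf

/-- Sturm–Liouville form of the hypergeometric equation. Symmetry of the right side gives
orthogonality; since derivatives are again Jacobi polynomials with parameters a+1 and b+1, it also
computes norms inductively. -/
theorem jacPoly_green (ha : 0 ≤ a) (hb : 0 ≤ b) (k : ℕ) (g : ℝ[X]) :
    k * (k + (a + b + 1)) * betaFunctional a b (by linarith) (by linarith) (g * jacPoly a b k) =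
      betaFunctional (a + 1) (b + 1) (by linarith) (by linarith)
        (derivative (jacPoly a b k) * derivative g) := by
  have h1 := betaFunctional_pearson (a := a) (b := b) (by linarith) (by linarith)
    (g * derivative (jacPoly a b k))
  have e : X * (1 - X) * derivative (g * derivative (jacPoly a b k)) +
      (C (a + 1) - C (a + b + 2) * X) * (g * derivative (jacPoly a b k)) =
      X * (1 - X) * (derivative (jacPoly a b k) * derivative g) +
      C (-((k : ℝ) * (k + (a + b + 1)))) * (g * jacPoly a b k) := by
    rw [mul_left_comm (C _) g, ← jacPoly_eigen ha, derivative_mul]; ring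
  rw [e, map_add, betaFunctional_X_mul_one_sub, C_mul', map_smul, smul_eq_mul] at h1
  linarith

theorem jacPoly_orthogonal (ha : 0 ≤ a) (hb : 0 ≤ b) {j k : ℕ} (h : j ≠ k) :
    betaFunctional a b (by linarith) (by linarith) (jacPoly a b j * jacPoly a b k) = 0 := by
  have h1 := jacPoly_green ha hb k (jacPoly a b j)
  have h2 := jacPoly_green ha hb j (jacPoly a b k)
  rw [mul_comm (jacPoly a b k), mul_comm (derivative (jacPoly a b j)), ← h1] at h2
  have h3 : ((j : ℝ) - k) * (j + k + (a + b + 1)) *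
      betaFunctional a b (by linarith) (by linarith) (jacPoly a b j * jacPoly a b k) = 0 := by
    linear_combination h2
  have h4 : ((j : ℝ) - k) ≠ 0 := sub_ne_zero.2 (by exact_mod_cast h)
  have h5 : (j : ℝ) + k + (a + b + 1) ≠ 0 := by positivity
  simpa [h4, h5] using h3

theorem jacPoly_mul_of_degree_lt (ha : 0 ≤ a) (hb : 0 ≤ b) {n : ℕ} {q : ℝ[X]}
    (hq : q.degree < n) :
    betaFunctional a b (by linarith) (by linarith) (jacPoly a b n * q) = 0 := by
  suffices h : ∀ m ≤ n, ∀ q : ℝ[X], q.degree < m →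
    betaFunctional a b (by linarith) (by linarith) (jacPoly a b n * q) = 0 from h n le_rfl q hq
  intro m
  induction m with
  | zero =>
    intro _ q hq
    have : q = 0 := by
      rw [← degree_eq_bot]; simpa using hq
    simp [this]
  | succ m ih =>
    intro hm q hq
    have hdeg : (q - C (q.coeff m / jacCoeff a b m m) * jacPoly a b m).degree < m := by
      rw [degree_lt_iff_coeff_zero] at hq ⊢
      intro k hk
      rw [coeff_sub, coeff_C_mul, coeff_jacPoly]
      rcases hk.eq_or_lt with rfl | h
      · rw [div_mul_cancel₀ _ (jacCoeff_self_ne_zero ha hb _), sub_self]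
      · rw [hq k h, jacCoeff_of_lt a b h]; ring
    have h1 := ih (by omega) _ hdeg
    rw [mul_sub, map_sub, mul_left_comm, C_mul', map_smul,
      jacPoly_orthogonal ha hb (by omega), smul_zero, sub_zero] at h1
    exact h1

theorem betaFunctional_one (ha : -1 < a) (hb : -1 < b) :
    betaFunctional a b ha hb 1 =
      Real.Gamma (a + 1) * Real.Gamma (b + 1) / Real.Gamma (a + b + 2) := by
  have h1 := ProbabilityTheory.beta_eq_betaIntegralReal (a + 1) (b + 1) (by linarith) (by linarith)
  have h2 : Complex.betaIntegral ((a + 1 : ℝ) : ℂ) ((b + 1 : ℝ) : ℂ) =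
      ((∫ x in (0 : ℝ)..1, baseWeight a b x : ℝ) : ℂ) := by
    rw [Complex.betaIntegral, ← intervalIntegral.integral_ofReal]
    refine intervalIntegral_congr_Ioo zero_le_one fun x hx => ?_
    have e1 : (0 : ℝ) ≤ 1 - x := by linarith [hx.2]
    rw [baseWeight, Complex.ofReal_mul, Complex.ofReal_cpow hx.1.le, Complex.ofReal_cpow e1]
    push_cast; simp
  rw [h2, Complex.ofReal_re, ProbabilityTheory.beta] at h1
  simp only [betaFunctional, weightFunctional_apply, eval_one, one_mul]
  rw [← h1, show a + 1 + (b + 1) = a + b + 2 by ring]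

theorem jacPoly_zero (a b : ℝ) : jacPoly a b 0 = 1 := by simp [jacPoly, jacCoeff_zero]

/-- Each step of `jacPoly_green` lowers k and raises both parameters, so the induction must hold for
all a and b at once. It ends at the Beta integral. -/
theorem betaFunctional_jacPoly_sq (k : ℕ) : ∀ {a b : ℝ} (ha : 0 ≤ a) (hb : 0 ≤ b),
    betaFunctional a b (by linarith) (by linarith) (jacPoly a b k * jacPoly a b k) =
      jacNorm a b k := by
  induction k with
  | zero =>
    intro a b ha hb
    rw [jacPoly_zero, mul_one, betaFunctional_one, jacNorm]
    have h1 : Real.Gamma (a + b + 2) = (a + b + 1) * Real.Gamma (a + b + 1) := by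
      rw [← Real.Gamma_add_one (by positivity)]; ring_nf
    have h2 := (Real.Gamma_pos_of_pos (show 0 < a + 1 by positivity)).ne'
    have h3 := (Real.Gamma_pos_of_pos (show 0 < a + b + 1 by positivity)).ne'
    rw [h1]; simp; field_simp
  | succ k ih =>
    intro a b ha hb
    have h1 := jacPoly_green ha hb (k + 1) (jacPoly a b (k + 1))
    rw [derivative_jacPoly_succ ha, mul_mul_mul_comm, ← C_mul, C_mul', map_smul, smul_eq_mul,
      ih (by linarith) (by linarith)] at h1
    have h0 : ((k + 1 : ℕ) : ℝ) * ((k + 1 : ℕ) + (a + b + 1)) ≠ 0 := by positivity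
    rw [← mul_right_inj' h0, h1]
    have g1 : Real.Gamma (a + 1 + 1) = (a + 1) * Real.Gamma (a + 1) :=
      Real.Gamma_add_one (by positivity)
    have g2 : Real.Gamma (k + (a + 1 + (b + 1) + 1)) =
        (k + 1 + (a + b + 1)) * Real.Gamma (k + 1 + (a + b + 1)) := by
      rw [← Real.Gamma_add_one (by positivity)]; ring_nf
    have h2 := (Real.Gamma_pos_of_pos (show 0 < k + 1 + a + 1 by positivity)).ne'
    have h3 := (Real.Gamma_pos_of_pos (show 0 < k + 1 + (a + b + 1) by positivity)).ne'
    have h4 : a + 1 ≠ 0 := by positivity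
    have h5 : (2 : ℝ) * (k + 1) + (a + b + 1) ≠ 0 := by positivity
    have h6 : (k : ℝ) + 1 + (a + b + 1) ≠ 0 := by positivity
    rw [jacNorm, jacNorm, g1, g2, Nat.factorial_succ]
    push_cast
    rw [show (k : ℝ) + (b + 1) + 1 = k + 1 + b + 1 by ring,
      show (k : ℝ) + (a + 1) + 1 = k + 1 + a + 1 by ring,
      show (2 : ℝ) * k + (a + 1 + (b + 1) + 1) = 2 * (k + 1) + (a + b + 1) by ring]
    field_simp

/-- The Pearson relation with parameter a-1, tested on φ², reduces the weight x^(a-1) to the weight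
x^a. This weight is needed because the perturbation decays like y^(a-1) in the hard-edge variable.
-/
theorem betaFunctional_jacPoly_sq_div (ha : 0 < a) (hb : 0 ≤ b) (k : ℕ) :
    betaFunctional (a - 1) b (by linarith) (by linarith) (jacPoly a b k * jacPoly a b k) =
      (2 * k + (a + b + 1)) / a * jacNorm a b k := by
  set φ := jacPoly a b k with hφ
  have h1 := betaFunctional_pearson (a := a - 1) (b := b) (by linarith) (by linarith) (φ * φ)
  have e : X * (1 - X) * derivative (φ * φ) + (C (a - 1 + 1) - C (a - 1 + b + 2) * X) * (φ * φ) =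
      X * (C 2 * (φ * derivative φ) - C 2 * (φ * (X * derivative φ)) - C (a + b + 1) * (φ * φ)) +
        C a * (φ * φ) := by
    rw [derivative_mul, show a - 1 + 1 = a by ring, show a - 1 + b + 2 = a + b + 1 by ring]
    rw [show (C 2 : ℝ[X]) = 2 from rfl]; ring
  have hd : (derivative φ).degree < k := by
    rw [degree_lt_iff_coeff_zero]
    intro m hm
    rw [coeff_derivative, hφ, coeff_jacPoly, jacCoeff_of_lt a b (by omega), zero_mul]
  have hd2 : Polynomial.degree (X * derivative φ - C (k : ℝ) * φ) < k := by
    rw [degree_lt_iff_coeff_zero]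
    intro m hm
    have : (X * derivative φ).coeff m = φ.coeff m * m := by
      cases m with
      | zero => simp
      | succ m => rw [coeff_X_mul, coeff_derivative]; push_cast; ring
    rw [coeff_sub, coeff_C_mul, this]
    rcases hm.eq_or_lt with rfl | h
    · ring
    · rw [hφ, coeff_jacPoly, jacCoeff_of_lt a b h]; ring
  have e1 := jacPoly_mul_of_degree_lt ha.le hb hd
  have e2 := jacPoly_mul_of_degree_lt ha.le hb hd2
  have e3 := betaFunctional_jacPoly_sq k ha.le hb
  rw [mul_sub, map_sub, mul_left_comm _ (C _), C_mul', map_smul, smul_eq_mul, sub_eq_zero] at e2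
  rw [← hφ] at e1 e2 e3
  rw [e, map_add, betaFunctional_X_mul (a := a) (by linarith) (by linarith) (by linarith)
    (by ring), map_sub, map_sub, C_mul', C_mul', C_mul', C_mul', map_smul, map_smul, map_smul,
    map_smul, e1, e2, e3] at h1
  simp only [smul_eq_mul] at h1
  field_simp
  linear_combination h1

/-- Since jacPoly takes the value 1 at 0, the polynomial of lower degree is 1 plus a multiple of X.
That multiple is killed by orthogonality, so the value depends only on the larger index. -/
theorem betaFunctional_jacPoly_mul_div (ha : 0 < a) (hb : 0 ≤ b) {j k : ℕ} (h : k ≤ j) :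
    betaFunctional (a - 1) b (by linarith) (by linarith) (jacPoly a b j * jacPoly a b k) =
      (2 * j + (a + b + 1)) / a * jacNorm a b j := by
  have main : ∀ k ≤ j, betaFunctional (a - 1) b (by linarith) (by linarith)
      (jacPoly a b j * jacPoly a b k) =
      betaFunctional (a - 1) b (by linarith) (by linarith) (jacPoly a b j) := by
    intro k hk
    have h1 : jacPoly a b k = X * divX (jacPoly a b k) + 1 := by
      conv_lhs => rw [← X_mul_divX_add (jacPoly a b k), coeff_jacPoly, jacCoeff_zero, C_1]
    have h2 : (divX (jacPoly a b k)).degree < j := by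
      rw [degree_lt_iff_coeff_zero]
      intro m hm
      rw [coeff_divX, coeff_jacPoly, jacCoeff_of_lt a b (by omega)]
    conv_lhs => rw [h1, mul_add, mul_one, map_add, mul_left_comm,
      betaFunctional_X_mul (a := a) (by linarith) (by linarith) (by linarith) (by ring),
      jacPoly_mul_of_degree_lt ha.le hb h2, zero_add]
  rw [main k h, ← main j le_rfl, betaFunctional_jacPoly_sq_div ha hb]

theorem jacNorm_pos (ha : 0 ≤ a) (hb : 0 ≤ b) (k : ℕ) : 0 < jacNorm a b k := by
  have h1 := Real.Gamma_pos_of_pos (show 0 < a + 1 by positivity)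
  have h2 := Real.Gamma_pos_of_pos (show 0 < k + b + 1 by positivity)
  have h3 := Real.Gamma_pos_of_pos (show 0 < k + a + 1 by positivity)
  have h4 := Real.Gamma_pos_of_pos (show 0 < k + (a + b + 1) by positivity)
  have h5 : (0 : ℝ) < k.factorial := by exact_mod_cast k.factorial_pos
  unfold jacNorm
  positivity

end jacobi

/-! ### Hard-edge asymptotics of the Jacobi polynomials -/

section jacobiAsymptotics

variable {a b : ℝ}

/-- Each factor has numerator at most k(k+a+b+1) and denominator at least j+1. The resulting
exponential majorant is uniform in k < n at arguments of size n⁻², also for complex ones. -/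
theorem abs_jacCoeff_le (ha : 0 ≤ a) (hb : 0 ≤ b) (k i : ℕ) :
    |jacCoeff a b k i| ≤ (k * (k + (a + b + 1))) ^ i / i.factorial := by
  induction i with
  | zero => simp [jacCoeff_zero]
  | succ i ih =>
    rcases lt_or_ge k (i + 1) with h | h
    · rw [jacCoeff_of_lt a b h, abs_zero]; positivity
    · have hik : (i : ℝ) ≤ k := by exact_mod_cast (by omega : i ≤ k)
      rw [jacCoeff_succ, abs_mul, pow_succ, Nat.factorial_succ, Nat.cast_mul, mul_comm
        ((i + 1 : ℕ) : ℝ), mul_div_mul_comm]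
      refine mul_le_mul ih ?_ (abs_nonneg _) (by positivity)
      have h1 : (0 : ℝ) ≤ (k - i) * (k + (a + b + 1) + i) :=
        mul_nonneg (by linarith) (by positivity)
      rw [neg_div, abs_neg, abs_of_nonneg (by positivity)]
      refine div_le_div₀ (by positivity) ?_ (by positivity) ?_
      · have : (0 : ℝ) ≤ i * (a + b + 1 + i) := by positivity
        nlinarith
      · have : (0 : ℝ) ≤ (a + i) * (i + 1) := by positivity
        push_cast; nlinarith

theorem norm_aeval_jacPoly_le (ha : 0 ≤ a) (hb : 0 ≤ b) (k : ℕ) (z : ℂ) :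
    ‖aeval z (jacPoly a b k)‖ ≤ Real.exp (k * (k + (a + b + 1)) * ‖z‖) := by
  rw [jacPoly, map_sum]
  refine (norm_sum_le _ _).trans ((Finset.sum_le_sum fun i _ => ?_).trans
    (Real.sum_le_exp_of_nonneg (by positivity) (k + 1)))
  rw [map_mul, map_pow, aeval_X, aeval_C, norm_mul, norm_pow, mul_pow, mul_div_right_comm]
  refine mul_le_mul_of_nonneg_right ?_ (by positivity)
  simpa using abs_jacCoeff_le ha hb k i

theorem aeval_ofReal (f : ℝ[X]) (x : ℝ) : aeval (x : ℂ) f = ((f.eval x : ℝ) : ℂ) := by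
  have := aeval_algebraMap_apply ℂ x f
  simpa using this

theorem eval_jacPoly_eq_tsum (a b : ℝ) (k : ℕ) (x : ℝ) :
    (jacPoly a b k).eval x = ∑' i, jacCoeff a b k i * x ^ i := by
  rw [tsum_eq_sum (s := Finset.range (k + 1)), jacPoly, eval_finsetSum]
  · simp
  · intro i hi
    rw [jacCoeff_of_lt a b (by simpa using hi), zero_mul]

/-- The Bessel-type series `₀F₁(; a + 1; -x)`. -/
noncomputable def besselSeries (a x : ℝ) : ℝ :=
  ∑' i : ℕ, (∏ j ∈ Finset.range i, (-1 / ((a + 1 + j) * (j + 1)))) * x ^ i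

/-- Hilb-type limit of the Jacobi polynomials at the hard edge. -/
theorem tendsto_eval_jacPoly (ha : 0 ≤ a) (hb : 0 ≤ b) {k : ℕ → ℕ} {u : ℝ}
    (hk : Tendsto (fun n : ℕ => (k n : ℝ) / n) atTop (𝓝 u)) (y : ℝ) :
    Tendsto (fun n : ℕ => (jacPoly a b (k n)).eval (y / (n : ℝ) ^ 2)) atTop
      (𝓝 (besselSeries a (u ^ 2 * y))) := by
  have hn : Tendsto (fun n : ℕ => (1 : ℝ) / n) atTop (𝓝 0) := tendsto_one_div_atTop_nhds_zero_nat
  have hprod : ∀ c d : ℝ, Tendsto (fun n : ℕ => ((k n : ℝ) + c) * (k n + d) / (n : ℝ) ^ 2) atTop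
      (𝓝 (u ^ 2)) := by
    intro c d
    have h := (hk.add (hn.const_mul c)).mul (hk.add (hn.const_mul d))
    simp only [mul_zero, add_zero, ← sq u] at h
    refine h.congr fun n => ?_
    by_cases h0 : (n : ℝ) = 0
    · simp [h0]
    · field_simp
  obtain ⟨M, hM⟩ : ∃ M, ∀ᶠ n : ℕ in atTop,
      (k n : ℝ) * (k n + (a + b + 1)) / (n : ℝ) ^ 2 ≤ M := by
    have h := hprod 0 (a + b + 1)
    simp only [add_zero] at h
    exact ⟨u ^ 2 + 1, h.eventually (eventually_le_nhds (by linarith))⟩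
  simp only [eval_jacPoly_eq_tsum, besselSeries]
  refine tendsto_tsum_of_dominated_convergence
    (bound := fun i => (M * |y|) ^ i / i.factorial) (Real.summable_pow_div_factorial _) ?_ ?_
  · intro i
    have h1 : Tendsto (fun n : ℕ => ∏ j ∈ Finset.range i,
        (-(((k n : ℝ) + (-j)) * (k n + (a + b + 1 + j)) / (n : ℝ) ^ 2) / ((a + 1 + j) * (j + 1))))
        atTop (𝓝 (∏ j ∈ Finset.range i, (-(u ^ 2) / ((a + 1 + j) * (j + 1))))) :=
      tendsto_finsetProd _ fun j _ => ((hprod _ _).neg).div_const _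
    have h2 := h1.mul_const (y ^ i)
    have e : (∏ j ∈ Finset.range i, (-(u ^ 2) / ((a + 1 + j) * ((j : ℝ) + 1)))) * y ^ i =
        (∏ j ∈ Finset.range i, (-1 / ((a + 1 + j) * ((j : ℝ) + 1)))) * (u ^ 2 * y) ^ i := by
      rw [mul_pow, ← mul_assoc]
      congr 1
      rw [Finset.pow_eq_prod_const (u ^ 2), ← Finset.prod_mul_distrib]
      exact Finset.prod_congr rfl fun j _ => by ring
    rw [← e]
    refine h2.congr fun n => ?_
    have e2 : ∏ j ∈ Finset.range i, (-(((k n : ℝ) + (-j)) * (k n + (a + b + 1 + j)) / (n : ℝ) ^ 2) /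
        ((a + 1 + j) * (j + 1))) = jacCoeff a b (k n) i * (((n : ℝ) ^ 2)⁻¹) ^ i := by
      rw [jacCoeff, Finset.pow_eq_prod_const ((n : ℝ) ^ 2)⁻¹, ← Finset.prod_mul_distrib]
      refine Finset.prod_congr rfl fun j _ => ?_
      rw [div_eq_mul_inv, div_eq_mul_inv, div_eq_mul_inv]; ring
    rw [e2, div_eq_mul_inv, mul_pow]; ring
  · filter_upwards [hM] with n hn i
    rw [norm_mul, Real.norm_eq_abs, norm_pow, Real.norm_eq_abs]
    have h1 := abs_jacCoeff_le ha hb (k n) i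
    calc |jacCoeff a b (k n) i| * |y / (n : ℝ) ^ 2| ^ i
        ≤ (k n * (k n + (a + b + 1))) ^ i / i.factorial * |y / (n : ℝ) ^ 2| ^ i := by gcongr
      _ = ((k n : ℝ) * (k n + (a + b + 1)) / (n : ℝ) ^ 2 * |y|) ^ i / i.factorial := by
          rw [abs_div, abs_of_nonneg (sq_nonneg (n : ℝ)), div_mul_eq_mul_div, ← mul_pow]
          congr 2; ring
      _ ≤ (M * |y|) ^ i / i.factorial := by gcongr

/-- Euler's limit formula, inverted: the product in `GammaSeq` is Γ(n+s+1)/Γ(s). -/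
theorem tendsto_Gamma_add_div {s : ℝ} (hs : 0 < s) :
    Tendsto (fun n : ℕ => Real.Gamma (n + s + 1) / ((n : ℝ) ^ s * n.factorial)) atTop (𝓝 1) := by
  have h1 := Real.GammaSeq_tendsto_Gamma s
  have hG := Real.Gamma_pos_of_pos hs
  have h2 := (h1.inv₀ hG.ne').mul_const (Real.Gamma s)
  rw [inv_mul_cancel₀ hG.ne'] at h2
  have hp : ∀ n : ℕ, Real.Gamma (n + s + 1) =
      (∏ j ∈ Finset.range (n + 1), (s + j)) * Real.Gamma s := by
    intro n
    induction n with
    | zero => rw [Nat.cast_zero, zero_add, Real.Gamma_add_one hs.ne']; simp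
    | succ n ih =>
      rw [Finset.prod_range_succ, mul_right_comm, ← ih,
        show ((n + 1 : ℕ) : ℝ) + s + 1 = (n + s + 1) + 1 by push_cast; ring,
        Real.Gamma_add_one (by positivity)]
      push_cast; ring
  refine h2.congr fun n => ?_
  rw [hp, Real.GammaSeq, inv_div]; ring

/-- The quotient of Gamma functions contributes k^(-2a) and the factor 2k+a+b+1 contributes 1/(2k),
whence the exponent 2a+1 and the constant. -/
theorem tendsto_jacNorm (ha : 0 < a) (hb : 0 < b) :
    Tendsto (fun k : ℕ => (k : ℝ) ^ (2 * a + 1) * jacNorm a b k) atTop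
      (𝓝 (Real.Gamma (a + 1) ^ 2 / 2)) := by
  have h1 := tendsto_Gamma_add_div ha
  have h2 := tendsto_Gamma_add_div hb
  have h3 := tendsto_Gamma_add_div (add_pos ha hb)
  have h4 : Tendsto (fun k : ℕ => 2 + (a + b + 1) * (1 / (k : ℝ))) atTop (𝓝 2) := by
    simpa using (tendsto_one_div_atTop_nhds_zero_nat.const_mul (a + b + 1)).const_add (2 : ℝ)
  have h5 := (h2.div ((h4.mul h1).mul h3) (by norm_num)).const_mul (Real.Gamma (a + 1) ^ 2)
  rw [show Real.Gamma (a + 1) ^ 2 * (1 / (2 * 1 * 1)) = Real.Gamma (a + 1) ^ 2 / 2 by ring] at h5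
  refine h5.congr' ?_
  filter_upwards [eventually_gt_atTop 0] with k hk
  have hk0 : (0 : ℝ) < k := by exact_mod_cast hk
  have e1 : (0 : ℝ) < (k : ℝ) ^ a := by positivity
  have e2 : (0 : ℝ) < (k : ℝ) ^ b := by positivity
  have g1 := (Real.Gamma_pos_of_pos (show 0 < k + a + 1 by positivity)).ne'
  have g2 := (Real.Gamma_pos_of_pos (show 0 < k + (a + b) + 1 by positivity)).ne'
  have g3 : (0 : ℝ) < k.factorial := by exact_mod_cast k.factorial_pos
  rw [jacNorm, show (k : ℝ) + (a + b + 1) = k + (a + b) + 1 by ring,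
    show 2 * a + 1 = a + a + 1 by ring, Real.rpow_add hk0 (a + a), Real.rpow_add hk0 a a,
    Real.rpow_one]
  have : (2 : ℝ) * k + (a + b + 1) ≠ 0 := by positivity
  have : 2 + (a + b + 1) * (1 / (k : ℝ)) = (2 * k + (a + b + 1)) / k := by field_simp
  simp only [Pi.div_apply]
  rw [this, Real.rpow_add hk0 a b]
  field_simp

/-- For large k the asymptotics apply and n^(2a+1) dominates k^(2a+1). The finitely many small k are
covered by a minimum, as n ≥ 1. Uniformity in all k < n bounds the normalised polynomials. -/
theorem exists_le_jacNorm (ha : 0 < a) (hb : 0 < b) :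
    ∃ c : ℝ, 0 < c ∧ ∀ k n : ℕ, k < n → c ≤ (n : ℝ) ^ (2 * a + 1) * jacNorm a b k := by
  have hG := Real.Gamma_pos_of_pos (show 0 < a + 1 by positivity)
  have h1 := (tendsto_jacNorm ha hb).eventually
    (lt_mem_nhds (show Real.Gamma (a + 1) ^ 2 / 4 < Real.Gamma (a + 1) ^ 2 / 2 by
      have : 0 < Real.Gamma (a + 1) ^ 2 := by positivity
      linarith))
  obtain ⟨K, hK⟩ := eventually_atTop.1 h1
  have key : ∀ m : ℕ, ∃ c : ℝ, 0 < c ∧ ∀ k < m, c ≤ jacNorm a b k := by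
    intro m
    induction m with
    | zero => exact ⟨1, one_pos, fun k hk => absurd hk (Nat.not_lt_zero k)⟩
    | succ m ih =>
      obtain ⟨c, hc, h⟩ := ih
      refine ⟨min c (jacNorm a b m), lt_min hc (jacNorm_pos ha.le hb.le m), fun k hk => ?_⟩
      rcases Nat.lt_succ_iff_lt_or_eq.1 hk with hk | rfl
      · exact (min_le_left _ _).trans (h k hk)
      · exact min_le_right _ _
  obtain ⟨c, hc, h⟩ := key K
  refine ⟨min c (Real.Gamma (a + 1) ^ 2 / 4), lt_min hc (by positivity), fun k n hkn => ?_⟩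
  have hN := jacNorm_pos ha.le hb.le k
  rcases lt_or_ge k K with hk | hk
  · refine (min_le_left _ _).trans ((h k hk).trans ?_)
    have h1n : (1 : ℝ) ≤ n := by exact_mod_cast (by omega : 1 ≤ n)
    exact le_mul_of_one_le_left hN.le (Real.one_le_rpow h1n (by positivity))
  · refine (min_le_right _ _).trans ((hK k hk).le.trans ?_)
    have : (k : ℝ) ≤ n := by exact_mod_cast hkn.le
    gcongr

theorem tendsto_scaled_jacNorm (ha : 0 < a) (hb : 0 < b) {k : ℕ → ℕ} {u : ℝ} (hu : 0 < u)
    (hk : Tendsto (fun n : ℕ => (k n : ℝ) / n) atTop (𝓝 u)) :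
    Tendsto (fun n : ℕ => (n : ℝ) ^ (2 * a + 1) * jacNorm a b (k n)) atTop
      (𝓝 (Real.Gamma (a + 1) ^ 2 / 2 / u ^ (2 * a + 1))) := by
  have hinf : Tendsto k atTop atTop := by
    have h1 : Tendsto (fun n : ℕ => (k n : ℝ) / n * n) atTop atTop :=
      hk.pos_mul_atTop hu tendsto_natCast_atTop_atTop
    refine tendsto_natCast_atTop_iff.1 (tendsto_atTop_mono (fun n => ?_) h1)
    by_cases h0 : (n : ℝ) = 0
    · simp [h0]
    · rw [div_mul_cancel₀ _ h0]
  have h1 := (tendsto_jacNorm ha hb).comp hinf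
  have h2 := hk.rpow_const (p := 2 * a + 1) (Or.inl hu.ne')
  refine (h1.div h2 (by positivity)).congr' ?_
  filter_upwards [eventually_gt_atTop 0, hinf.eventually (eventually_gt_atTop 0)] with n hn hkn
  have hn0 : (0 : ℝ) < n := by exact_mod_cast hn
  have hk0 : (0 : ℝ) < k n := by exact_mod_cast hkn
  simp only [Function.comp, Pi.div_apply]
  rw [Real.div_rpow hk0.le hn0.le]
  have e1 : (k n : ℝ) ^ (2 * a + 1) ≠ 0 := by positivity
  have e2 : (n : ℝ) ^ (2 * a + 1) ≠ 0 := by positivity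
  field_simp

end jacobiAsymptotics

/-! ### Rescaled Jacobi polynomials in the variable y = n²x -/

section edge

variable {a b : ℝ}

/-- The normalising factor of the rescaled Jacobi polynomials. -/
noncomputable def edgeScale (a b : ℝ) (n j : ℕ) : ℝ :=
  Real.sqrt ((n : ℝ) ^ (2 * a + 1) * jacNorm a b j)

/-- The Jacobi polynomials in the hard-edge variable `y = n² x`, normalised. -/
noncomputable def edgePoly (a b : ℝ) (n j : ℕ) : ℝ[X] :=
  C (edgeScale a b n j)⁻¹ * (jacPoly a b j).comp (C ((n : ℝ) ^ 2)⁻¹ * X)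

theorem eval_edgePoly (a b : ℝ) (n j : ℕ) (y : ℝ) :
    (edgePoly a b n j).eval y =
      (edgeScale a b n j)⁻¹ * (jacPoly a b j).eval (y / (n : ℝ) ^ 2) := by
  simp [edgePoly, div_eq_inv_mul]

theorem aeval_edgePoly (a b : ℝ) (n j : ℕ) (z : ℂ) :
    aeval z (edgePoly a b n j) =
      ((edgeScale a b n j)⁻¹ : ℝ) * aeval (z / (n : ℂ) ^ 2) (jacPoly a b j) := by
  rw [edgePoly, map_mul, aeval_C, aeval_comp]
  simp [div_eq_inv_mul]

theorem edgeScale_sq (ha : 0 ≤ a) (hb : 0 ≤ b) (n j : ℕ) :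
    edgeScale a b n j ^ 2 = (n : ℝ) ^ (2 * a + 1) * jacNorm a b j := by
  have := jacNorm_pos ha hb j
  exact Real.sq_sqrt (by positivity)

theorem edgeScale_pos (ha : 0 ≤ a) (hb : 0 ≤ b) {n : ℕ} (hn : 0 < n) (j : ℕ) :
    0 < edgeScale a b n j := by
  have := jacNorm_pos ha hb j
  have hn' : (0 : ℝ) < n := by exact_mod_cast hn
  exact Real.sqrt_pos.2 (by positivity)

theorem exists_norm_aeval_edgePoly_le (ha : 0 < a) (hb : 0 < b) (R : ℝ) :
    ∃ M : ℝ, 0 ≤ M ∧ ∀ n j : ℕ, j < n → ∀ z : ℂ, ‖z‖ ≤ R → ‖aeval z (edgePoly a b n j)‖ ≤ M := by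
  obtain ⟨c, hc, h⟩ := exists_le_jacNorm ha hb
  refine ⟨(Real.sqrt c)⁻¹ * Real.exp ((2 + a + b) * R), by positivity, fun n j hj z hz => ?_⟩
  have hn : (0 : ℝ) < n := by exact_mod_cast (by omega : 0 < n)
  have hjn : (j : ℝ) ≤ n := by exact_mod_cast hj.le
  have h1n : (1 : ℝ) ≤ n := by exact_mod_cast (by omega : 1 ≤ n)
  have hs : Real.sqrt c ≤ edgeScale a b n j := Real.sqrt_le_sqrt (h j n hj)
  rw [aeval_edgePoly, norm_mul, Complex.norm_real, Real.norm_eq_abs,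
    abs_of_pos (inv_pos.2 (edgeScale_pos ha.le hb.le (by omega) j))]
  have hR : 0 ≤ R := (norm_nonneg z).trans hz
  refine mul_le_mul (inv_anti₀ (Real.sqrt_pos.2 hc) hs)
    ((norm_aeval_jacPoly_le ha.le hb.le j _).trans (Real.exp_le_exp.2 ?_)) (norm_nonneg _)
    (by positivity)
  rw [norm_div, norm_pow, Complex.norm_natCast, mul_div_assoc', div_le_iff₀ (by positivity)]
  have h1 : (j : ℝ) * (j + (a + b + 1)) ≤ (2 + a + b) * (n : ℝ) ^ 2 := by
    have e1 : (j : ℝ) * (j + (a + b + 1)) ≤ n * (n + (a + b + 1)) := by gcongr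
    have e2 : (a + b + 1) * (n : ℝ) ≤ (a + b + 1) * (n : ℝ) ^ 2 := by
      gcongr; nlinarith
    nlinarith
  calc (j : ℝ) * (j + (a + b + 1)) * ‖z‖ ≤ (2 + a + b) * (n : ℝ) ^ 2 * R := by gcongr
    _ = (2 + a + b) * R * (n : ℝ) ^ 2 := by ring

theorem exists_tendsto_eval_edgePoly (ha : 0 < a) (hb : 0 < b) {k : ℕ → ℕ} {u : ℝ} (hu : 0 < u)
    (hk : Tendsto (fun n : ℕ => (k n : ℝ) / n) atTop (𝓝 u)) :
    ∃ q : ℝ → ℝ, ∀ y, Tendsto (fun n : ℕ => (edgePoly a b n (k n)).eval y) atTop (𝓝 (q y)) := by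
  refine ⟨fun y => (Real.sqrt (Real.Gamma (a + 1) ^ 2 / 2 / u ^ (2 * a + 1)))⁻¹ *
    besselSeries a (u ^ 2 * y), fun y => ?_⟩
  simp only [eval_edgePoly]
  refine Tendsto.mul (Tendsto.inv₀ ((tendsto_scaled_jacNorm ha hb hu hk).sqrt) ?_)
    (tendsto_eval_jacPoly ha.le hb.le hk y)
  have hG := Real.Gamma_pos_of_pos (show 0 < a + 1 by positivity)
  exact (Real.sqrt_pos.2 (by positivity)).ne'

theorem integral_eval_div_eq {c N : ℝ} (hc : -1 < c) (hb : -1 < b) (hN : 0 < N) (f : ℝ[X]) :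
    ∫ y in (0 : ℝ)..N, f.eval (y / N) * (y ^ c * (1 - y / N) ^ b) =
      N ^ (c + 1) * betaFunctional c b hc hb f := by
  have h := intervalIntegral.mul_integral_comp_mul_left (a := 0) (b := 1)
    (f := fun y => f.eval (y / N) * (y ^ c * (1 - y / N) ^ b)) (c := N)
  rw [mul_zero, mul_one] at h
  rw [← h, Real.rpow_add_one hN.ne', betaFunctional, weightFunctional_apply, mul_right_comm,
    mul_comm _ N, ← intervalIntegral.integral_const_mul, ← intervalIntegral.integral_const_mul,
    ← intervalIntegral.integral_const_mul]
  refine intervalIntegral_congr_Ioo zero_le_one fun x hx => ?_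
  rw [mul_div_cancel_left₀ _ hN.ne', Real.mul_rpow hN.le hx.1.le, baseWeight]; ring

theorem integral_edgePoly_mul {c : ℝ} (hc : -1 < c) (hb : -1 < b) {n : ℕ} (hn : 0 < n)
    (j k : ℕ) :
    ∫ y in (0 : ℝ)..(n : ℝ) ^ 2, (edgePoly a b n j * edgePoly a b n k).eval y *
        (y ^ c * (1 - y / (n : ℝ) ^ 2) ^ b) =
      ((n : ℝ) ^ 2) ^ (c + 1) * ((edgeScale a b n j)⁻¹ * (edgeScale a b n k)⁻¹ *
        betaFunctional c b hc hb (jacPoly a b j * jacPoly a b k)) := by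
  have hn' : (0 : ℝ) < (n : ℝ) ^ 2 := by positivity
  have h := integral_eval_div_eq hc hb hn' (jacPoly a b j * jacPoly a b k)
  rw [mul_left_comm, ← h, ← intervalIntegral.integral_const_mul]
  congr 1; ext y
  rw [eval_mul, eval_mul, eval_edgePoly, eval_edgePoly]; ring

theorem sq_rpow_natCast (n : ℕ) (c : ℝ) : ((n : ℝ) ^ 2) ^ c = (n : ℝ) ^ (2 * c) := by
  rw [Real.rpow_mul (Nat.cast_nonneg n)]; norm_num

/-- The squared norm is n rather than 1: with this normalisation the polynomials have finite
pointwise limits, and the factor 1/n turns matrix sums into Riemann sums. -/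
theorem integral_edgePoly_orthonormal (ha : 0 ≤ a) (hb : 0 ≤ b) {n : ℕ} (hn : 0 < n)
    (j k : ℕ) :
    ∫ y in (0 : ℝ)..(n : ℝ) ^ 2, (edgePoly a b n j * edgePoly a b n k).eval y *
        (y ^ a * (1 - y / (n : ℝ) ^ 2) ^ b) = if j = k then (n : ℝ) else 0 := by
  rw [integral_edgePoly_mul (by linarith) (by linarith) hn]
  split_ifs with h
  · subst h
    have hs := edgeScale_sq ha hb n j
    have hs0 := (edgeScale_pos ha hb hn j).ne'
    have hN := (jacNorm_pos ha hb j).ne'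
    have hn' : (0 : ℝ) < n := by exact_mod_cast hn
    rw [betaFunctional_jacPoly_sq j ha hb, sq_rpow_natCast, ← mul_inv, ← sq, hs,
      show 2 * (a + 1) = 2 * a + 1 + 1 by ring, Real.rpow_add_one hn'.ne']
    have : (n : ℝ) ^ (2 * a + 1) ≠ 0 := by positivity
    field_simp
  · rw [jacPoly_orthogonal ha hb h]; simp

theorem integral_edgePoly_div (ha : 0 < a) (hb : 0 ≤ b) {n : ℕ} (hn : 0 < n) (j k : ℕ) :
    ∫ y in (0 : ℝ)..(n : ℝ) ^ 2, (edgePoly a b n j * edgePoly a b n k).eval y *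
        (y ^ (a - 1) * (1 - y / (n : ℝ) ^ 2) ^ b) =
      (2 * (max j k : ℕ) / n + (a + b + 1) * (1 / n)) / a *
        ((n : ℝ) ^ (2 * a + 1) * jacNorm a b (max j k)) *
        (edgeScale a b n j)⁻¹ * (edgeScale a b n k)⁻¹ := by
  have hn' : (0 : ℝ) < n := by exact_mod_cast hn
  have key : betaFunctional (a - 1) b (by linarith) (by linarith)
      (jacPoly a b j * jacPoly a b k) =
      (2 * (max j k : ℕ) + (a + b + 1)) / a * jacNorm a b (max j k) := by
    rcases le_total k j with h | h
    · rw [max_eq_left h]; exact betaFunctional_jacPoly_mul_div ha hb h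
    · rw [max_eq_right h, mul_comm (jacPoly a b j)]; exact betaFunctional_jacPoly_mul_div ha hb h
  rw [integral_edgePoly_mul (by linarith) (by linarith) hn, key, sq_rpow_natCast,
    show 2 * (a - 1 + 1) = 2 * a by ring, Real.rpow_add_one hn'.ne']
  field_simp

/-- The normalisation cancels against the norm in the closed formula, leaving (2j+a+b+1)/(na),
bounded for j < n. -/
theorem integral_edgePoly_sq_div_le (ha : 0 < a) (hb : 0 ≤ b) {n j : ℕ} (hj : j < n) :
    ∫ y in (0 : ℝ)..(n : ℝ) ^ 2, (edgePoly a b n j * edgePoly a b n j).eval y *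
        (y ^ (a - 1) * (1 - y / (n : ℝ) ^ 2) ^ b) ≤ (3 + a + b) / a := by
  have hn : 0 < n := by omega
  have hn' : (1 : ℝ) ≤ n := by exact_mod_cast hn
  have hjn : (j : ℝ) ≤ n := by exact_mod_cast hj.le
  rw [integral_edgePoly_div ha hb hn, max_self, mul_assoc, ← edgeScale_sq ha.le hb,
    mul_assoc]
  have hs0 := (edgeScale_pos ha.le hb hn j).ne'
  have e : edgeScale a b n j ^ 2 * ((edgeScale a b n j)⁻¹ * (edgeScale a b n j)⁻¹) = 1 := by
    field_simp
  rw [e, mul_one]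
  refine div_le_div_of_nonneg_right ?_ ha.le
  have e1 : (2 * j : ℝ) / n ≤ 2 := by rw [div_le_iff₀ (by linarith)]; linarith
  have e2 : (1 : ℝ) / n ≤ 1 := by rw [div_le_iff₀ (by linarith)]; linarith
  have e3 : (a + b + 1) * (1 / (n : ℝ)) ≤ (a + b + 1) * 1 := by gcongr
  linarith

theorem exists_tendsto_integral_edgePoly_div (ha : 0 < a) (hb : 0 < b) {k l : ℕ → ℕ} {u v : ℝ}
    (hu : 0 < u) (hv : 0 < v) (hk : Tendsto (fun n : ℕ => (k n : ℝ) / n) atTop (𝓝 u))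
    (hl : Tendsto (fun n : ℕ => (l n : ℝ) / n) atTop (𝓝 v)) :
    ∃ I : ℝ, Tendsto (fun n : ℕ => ∫ y in (0 : ℝ)..(n : ℝ) ^ 2,
      (edgePoly a b n (k n) * edgePoly a b n (l n)).eval y *
        (y ^ (a - 1) * (1 - y / (n : ℝ) ^ 2) ^ b)) atTop (𝓝 I) := by
  have hm : Tendsto (fun n : ℕ => ((max (k n) (l n) : ℕ) : ℝ) / n) atTop (𝓝 (max u v)) := by
    refine (hk.max hl).congr fun n => ?_
    rw [Nat.cast_max, max_div_div_right (Nat.cast_nonneg n)]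
  have hG := Real.Gamma_pos_of_pos (show 0 < a + 1 by positivity)
  have h1 := ((hm.const_mul 2).add
    (tendsto_one_div_atTop_nhds_zero_nat.const_mul (a + b + 1))).div_const a
  have h2 := tendsto_scaled_jacNorm ha hb (lt_max_of_lt_left hu) hm
  have h3 := (tendsto_scaled_jacNorm ha hb hu hk).sqrt.inv₀ (Real.sqrt_pos.2 (by positivity)).ne'
  have h4 := (tendsto_scaled_jacNorm ha hb hv hl).sqrt.inv₀ (Real.sqrt_pos.2 (by positivity)).ne'
  refine ⟨_, (((h1.mul h2).mul h3).mul h4).congr' ?_⟩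
  filter_upwards [eventually_gt_atTop 0] with n hn
  rw [integral_edgePoly_div ha hb.le hn]
  simp only [edgeScale, mul_div_assoc]

end edge

/-! ### Convergence of the perturbation integrals -/

section kernel

/-- Mean value inequality on a disc avoiding the branch point. The radius 5/8 is the bound for |τ/y|
when |τ| ≤ 5τ₀/4 and y ≥ 2τ₀. -/
theorem exists_norm_one_sub_cpow_sub_one_le (c : ℝ) :
    ∃ K : ℝ, 0 ≤ K ∧ ∀ w : ℂ, ‖w‖ ≤ 5 / 8 → ‖(1 - w) ^ (c : ℂ) - 1‖ ≤ K * ‖w‖ := by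
  have hd : ∀ w ∈ Metric.closedBall (0 : ℂ) (5 / 8), HasDerivAt (fun w : ℂ => (1 - w) ^ (c : ℂ))
      ((c : ℂ) * (1 - w) ^ ((c : ℂ) - 1) * -1) w := by
    intro w hw
    rw [mem_closedBall_zero_iff] at hw
    refine ((hasDerivAt_id w).const_sub 1).cpow_const (Or.inl ?_)
    have := (Complex.abs_re_le_norm w).trans hw
    simp only [Complex.sub_re, Complex.one_re, id]
    linarith [le_abs_self w.re]
  have hcont : ContinuousOn (fun w : ℂ => (c : ℂ) * (1 - w) ^ ((c : ℂ) - 1) * -1)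
      (Metric.closedBall (0 : ℂ) (5 / 8)) := by
    intro w hw
    rw [mem_closedBall_zero_iff] at hw
    refine ContinuousAt.continuousWithinAt (ContinuousAt.mul (ContinuousAt.mul continuousAt_const
      (ContinuousAt.cpow (continuousAt_const.sub continuousAt_id) continuousAt_const
        (Or.inl ?_))) continuousAt_const)
    have := (Complex.abs_re_le_norm w).trans hw
    simp only [Complex.sub_re, Complex.one_re]
    linarith [le_abs_self w.re]
  obtain ⟨K, hK⟩ := (isCompact_closedBall (0 : ℂ) (5 / 8)).exists_bound_of_continuousOn hcont
  have h0 : (0 : ℂ) ∈ Metric.closedBall (0 : ℂ) (5 / 8) := by simp; norm_num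
  refine ⟨K, (norm_nonneg _).trans (hK 0 h0), fun w hw => ?_⟩
  have := (convex_closedBall (0 : ℂ) (5 / 8)).norm_image_sub_le_of_norm_hasDerivWithin_le
    (fun x hx => (hd x hx).hasDerivWithinAt) hK h0 (mem_closedBall_zero_iff.2 hw)
  simpa using this

/-- The derivative of the left side is -c((1-u)^(c-1) - 1), of first order in u by the previous
estimate. -/
theorem exists_abs_one_sub_rpow_sub_le (c : ℝ) :
    ∃ K : ℝ, 0 ≤ K ∧ ∀ u : ℝ, 0 ≤ u → u ≤ 1 / 2 → |(1 - u) ^ c - 1 + c * u| ≤ K * u ^ 2 := by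
  obtain ⟨K, hK, h⟩ := exists_norm_one_sub_cpow_sub_one_le (c - 1)
  refine ⟨|c| * K, by positivity, fun u hu0 hu => ?_⟩
  have hd : ∀ v ∈ Icc 0 u, HasDerivAt (fun v : ℝ => (1 - v) ^ c - 1 + c * v)
      (-1 * c * (1 - v) ^ (c - 1) + c * 1) v := fun v hv =>
    ((((hasDerivAt_id v).const_sub 1).rpow_const (Or.inl (by
      simp only [id]; linarith [hv.2]))).sub_const 1).add ((hasDerivAt_id v).const_mul c)
  have hb : ∀ v ∈ Icc 0 u, ‖-1 * c * (1 - v) ^ (c - 1) + c * 1‖ ≤ |c| * (K * u) := by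
    intro v hv
    have h1 := h (v : ℂ) (by
      rw [Complex.norm_real, Real.norm_eq_abs, abs_of_nonneg hv.1]; linarith [hv.2])
    have e : ((1 - (v : ℂ)) ^ ((c - 1 : ℝ) : ℂ) - 1) = (((1 - v) ^ (c - 1) - 1 : ℝ) : ℂ) := by
      rw [Complex.ofReal_sub ((1 - v) ^ (c - 1)) 1, Complex.ofReal_cpow (by linarith [hv.2])]
      push_cast; rfl
    rw [e, Complex.norm_real, Complex.norm_real, Real.norm_eq_abs v, abs_of_nonneg hv.1] at h1
    rw [show -1 * c * (1 - v) ^ (c - 1) + c * 1 = -c * ((1 - v) ^ (c - 1) - 1) by ring, norm_mul,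
      norm_neg, Real.norm_eq_abs c]
    refine mul_le_mul_of_nonneg_left (h1.trans ?_) (abs_nonneg c)
    exact mul_le_mul_of_nonneg_left hv.2 hK
  have := (convex_Icc 0 u).norm_image_sub_le_of_norm_hasDerivWithin_le
    (fun x hx => (hd x hx).hasDerivWithinAt) hb (left_mem_Icc.2 hu0) (right_mem_Icc.2 hu0)
  simp only [sub_zero, Real.one_rpow, mul_zero, add_zero, sub_self, Real.norm_eq_abs,
    abs_of_nonneg hu0] at this
  calc _ ≤ _ := this
    _ = _ := by ring

/-- The difference of the rescaled perturbed weight and the unperturbed one. -/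
noncomputable def edgeDiff (α γ A B τ y : ℝ) : ℝ :=
  y ^ α * stepPower γ A B (y - τ) / (A + B) - y ^ (α + γ)

/-- The perturbation integrated against a polynomial in the hard-edge variable. -/
noncomputable def edgeKernel (α β γ A B N : ℝ) (p : ℝ[X]) (τ : ℝ) : ℝ :=
  ∫ y in (0 : ℝ)..N, p.eval y * (1 - y / N) ^ β * edgeDiff α γ A B τ y

variable {α β γ A B : ℝ}

theorem continuous_edgeDiff (hα : 0 < α) (hγ : 0 < γ) (τ : ℝ) :
    Continuous (edgeDiff α γ A B τ) :=
  (((continuous_id.rpow_const fun _ => Or.inr hα.le).mul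
    ((continuous_stepPower hγ).comp (continuous_id.sub continuous_const))).div_const _).sub
    (continuous_id.rpow_const fun _ => Or.inr (add_pos hα hγ).le)

theorem continuous_one_sub_div_rpow (hβ : 0 < β) (N : ℝ) :
    Continuous fun y : ℝ => (1 - y / N) ^ β :=
  (continuous_const.sub (continuous_id.div_const N)).rpow_const fun _ => Or.inr hβ.le

theorem edgeDiff_of_lt (hAB : 0 < A + B) {τ y : ℝ} (hτ : 0 < τ) (hy : τ < y) :
    edgeDiff α γ A B τ y = y ^ (α + γ) * ((1 - τ / y) ^ γ - 1) := by
  have hy0 : 0 < y := hτ.trans hy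
  rw [edgeDiff, stepPower_of_pos (by linarith), Real.rpow_add hy0]
  have : (y - τ) ^ γ = y ^ γ * (1 - τ / y) ^ γ := by
    rw [← Real.mul_rpow hy0.le (by rw [sub_nonneg, div_le_one hy0]; exact hy.le)]
    congr 1; field_simp
  rw [this]; field_simp

/-- `edgeDiff` with its leading behaviour at infinity removed. -/
theorem exists_abs_edgeDiff_add_le (hAB : 0 < A + B) (α γ : ℝ) {τ : ℝ} (hτ : 0 < τ) :
    ∃ K : ℝ, 0 ≤ K ∧ ∀ R y : ℝ, 2 * τ ≤ R → R ≤ y →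
      |edgeDiff α γ A B τ y + γ * τ * y ^ (α + γ - 1)| ≤ K / R * y ^ (α + γ - 1) := by
  obtain ⟨K, hK, h⟩ := exists_abs_one_sub_rpow_sub_le γ
  refine ⟨K * τ ^ 2, by positivity, fun R y hR hy => ?_⟩
  have hR0 : 0 < R := by linarith
  have hy0 : 0 < y := by linarith
  have e : edgeDiff α γ A B τ y + γ * τ * y ^ (α + γ - 1) =
      y ^ (α + γ) * ((1 - τ / y) ^ γ - 1 + γ * (τ / y)) := by
    rw [edgeDiff_of_lt hAB hτ (by linarith), Real.rpow_sub_one hy0.ne']; ring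
  have h1 := h (τ / y) (by positivity) (by rw [div_le_iff₀ hy0]; linarith)
  have e2 : y ^ (α + γ) = y ^ (α + γ - 1) * y := by
    rw [← Real.rpow_add_one hy0.ne']; ring_nf
  rw [e, abs_mul, abs_of_nonneg (by positivity)]
  calc y ^ (α + γ) * |(1 - τ / y) ^ γ - 1 + γ * (τ / y)|
      ≤ y ^ (α + γ) * (K * (τ / y) ^ 2) := by gcongr
    _ = K * τ ^ 2 / y * y ^ (α + γ - 1) := by rw [e2]; field_simp
    _ ≤ K * τ ^ 2 / R * y ^ (α + γ - 1) := by gcongr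

/-- A Cauchy criterion. It spares identifying the limits, which are never needed explicitly. -/
theorem exists_tendsto_of_approx {x : ℕ → ℝ}
    (h : ∀ ε > 0, ∃ y : ℕ → ℝ, ∃ l, Tendsto y atTop (𝓝 l) ∧ ∀ᶠ n in atTop, |x n - y n| ≤ ε) :
    ∃ l, Tendsto x atTop (𝓝 l) := by
  refine cauchySeq_tendsto_of_complete (Metric.cauchySeq_iff'.2 fun ε hε => ?_)
  obtain ⟨y, l, hy, hxy⟩ := h (ε / 4) (by positivity)
  obtain ⟨K, hK⟩ := eventually_atTop.1
    (hxy.and (hy.eventually (Metric.ball_mem_nhds l (show 0 < ε / 8 by positivity))))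
  refine ⟨K, fun n hn => ?_⟩
  obtain ⟨a1, a2⟩ := hK n hn
  obtain ⟨b1, b2⟩ := hK K le_rfl
  rw [Real.dist_eq] at a2 b2
  rw [Real.dist_eq]
  rw [abs_lt] at a2 b2 ⊢
  rw [abs_le] at a1 b1
  constructor <;> linarith [a1.1, a1.2, b1.1, b1.2, a2.1, a2.2, b2.1, b2.2]

theorem intervalIntegrable_rpow_of_nonneg {c N : ℝ} (hc : -1 < c) {l : ℝ} :
    IntervalIntegrable (fun y : ℝ => y ^ c) volume l N :=
  intervalIntegral.intervalIntegrable_rpow' hc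

/-- Convergence of the rescaled perturbation along a sequence of polynomials. -/
theorem exists_tendsto_edgeKernel (hα : 0 < α) (hβ : 0 < β) (hγ : 0 < γ) (hAB : 0 < A + B)
    {p : ℕ → ℝ[X]} {q : ℝ → ℝ} {D I : ℝ}
    (hbd : ∀ R : ℝ, ∃ M : ℝ, 0 ≤ M ∧ ∀ᶠ n in atTop, ∀ y : ℝ, |y| ≤ R → |(p n).eval y| ≤ M)
    (hq : ∀ y, Tendsto (fun n => (p n).eval y) atTop (𝓝 (q y)))
    (hD : ∀ᶠ n : ℕ in atTop, ∫ y in (0 : ℝ)..(n : ℝ) ^ 2, |(p n).eval y| *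
        (y ^ (α + γ - 1) * (1 - y / (n : ℝ) ^ 2) ^ β) ≤ D)
    (hI : Tendsto (fun n : ℕ => ∫ y in (0 : ℝ)..(n : ℝ) ^ 2, (p n).eval y *
        (y ^ (α + γ - 1) * (1 - y / (n : ℝ) ^ 2) ^ β)) atTop (𝓝 I))
    {τ : ℝ} (hτ : 0 < τ) :
    ∃ l, Tendsto (fun n : ℕ => edgeKernel α β γ A B ((n : ℝ) ^ 2) (p n) τ) atTop (𝓝 l) := by
  set a := α + γ with ha
  have ha0 : 0 < a := add_pos hα hγ
  obtain ⟨K, hK, hpsi⟩ := exists_abs_edgeDiff_add_le (A := A) (B := B) hAB α γ hτ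
  rw [← ha] at hpsi
  -- The slowly decaying term -γτy^(a-1) is integrated separately, where convergence is the
  -- hypothesis `hI`. The rest, ψ, converges on [0, R] by domination and has a tail of size at most
  -- KD/R uniformly in n.
  set ψ : ℝ → ℝ := fun y => edgeDiff α γ A B τ y + γ * τ * y ^ (a - 1) with hψ
  have hψi : ∀ l r : ℝ, IntervalIntegrable ψ volume l r := fun l r =>
    ((continuous_edgeDiff hα hγ τ).intervalIntegrable _ _).add
      ((intervalIntegrable_rpow_of_nonneg (by linarith)).const_mul _)
  have hpe : ∀ n : ℕ, Continuous fun y : ℝ => (p n).eval y * (1 - y / (n : ℝ) ^ 2) ^ β := fun n =>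
    (p n).continuous.mul (continuous_one_sub_div_rpow hβ _)
  have hpi : ∀ (n : ℕ) (l r : ℝ), IntervalIntegrable
      (fun y => (p n).eval y * (1 - y / (n : ℝ) ^ 2) ^ β * ψ y) volume l r := fun n l r =>
    (hψi l r).continuousOn_mul (hpe n).continuousOn
  have hn2 : Tendsto (fun n : ℕ => (n : ℝ) ^ 2) atTop atTop :=
    (tendsto_pow_atTop two_ne_zero).comp tendsto_natCast_atTop_atTop
  refine exists_tendsto_of_approx fun ε hε => ?_
  set R := max (2 * τ) (K * (|D| + 1) / ε) with hR
  have hR1 : 2 * τ ≤ R := le_max_left _ _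
  have hR0 : 0 < R := by linarith
  have hR2 : K / R * (|D| + 1) ≤ ε := by
    rw [div_mul_eq_mul_div, div_le_iff₀ hR0, mul_comm ε, ← div_le_iff₀ hε]; exact le_max_right _ _
  obtain ⟨M, hM, hMn⟩ := hbd R
  have hlim : Tendsto (fun n : ℕ => ∫ y in (0 : ℝ)..R,
      (p n).eval y * (1 - y / (n : ℝ) ^ 2) ^ β * ψ y) atTop
      (𝓝 (∫ y in (0 : ℝ)..R, q y * ψ y)) := by
    refine intervalIntegral.tendsto_integral_filter_of_dominated_convergence
      (fun y => M * |ψ y|) (Eventually.of_forall fun n => (hpi n 0 R).def'.aestronglyMeasurable)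
      ?_ ((hψi 0 R).abs.const_mul M) (Eventually.of_forall fun y _ => ?_)
    · filter_upwards [hMn, hn2.eventually (eventually_ge_atTop R)] with n hn hnR
      refine Eventually.of_forall fun y hy => ?_
      rw [uIoc_of_le hR0.le] at hy
      rw [norm_mul, norm_mul, Real.norm_eq_abs, Real.norm_eq_abs, Real.norm_eq_abs]
      have hN : (0 : ℝ) < (n : ℝ) ^ 2 := by linarith
      have e1 : 0 ≤ 1 - y / (n : ℝ) ^ 2 := by
        rw [sub_nonneg, div_le_one hN]; linarith [hy.2]
      have e2 : 1 - y / (n : ℝ) ^ 2 ≤ 1 := by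
        have := div_nonneg hy.1.le hN.le
        linarith
      refine mul_le_mul_of_nonneg_right ?_ (abs_nonneg _)
      rw [abs_of_nonneg (Real.rpow_nonneg e1 _)]
      calc _ ≤ M * 1 := mul_le_mul (hn y (by rw [abs_of_pos hy.1]; exact hy.2))
            (Real.rpow_le_one e1 e2 hβ.le) (Real.rpow_nonneg e1 _) hM
        _ = M := mul_one M
    · have h1 : Tendsto (fun n : ℕ => (1 - y / (n : ℝ) ^ 2) ^ β) atTop (𝓝 1) := by
        have : Tendsto (fun n : ℕ => 1 - y / (n : ℝ) ^ 2) atTop (𝓝 1) := by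
          simpa using (tendsto_const_nhds.div_atTop hn2).const_sub (1 : ℝ)
        simpa using this.rpow_const (Or.inl one_ne_zero)
      simpa using ((hq y).mul h1).mul_const (ψ y)
  refine ⟨fun n => (∫ y in (0 : ℝ)..R, (p n).eval y * (1 - y / (n : ℝ) ^ 2) ^ β * ψ y) -
    γ * τ * ∫ y in (0 : ℝ)..(n : ℝ) ^ 2, (p n).eval y *
        (y ^ (a - 1) * (1 - y / (n : ℝ) ^ 2) ^ β), _, hlim.sub (hI.const_mul (γ * τ)), ?_⟩
  filter_upwards [hD, hn2.eventually (eventually_ge_atTop R)] with n hnD hnR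
  have hN : (0 : ℝ) < (n : ℝ) ^ 2 := by linarith
  have hint : IntervalIntegrable (fun y : ℝ => y ^ (a - 1) * (1 - y / (n : ℝ) ^ 2) ^ β)
      volume 0 ((n : ℝ) ^ 2) :=
    (intervalIntegrable_rpow_of_nonneg (by linarith)).mul_continuousOn
      (continuous_one_sub_div_rpow hβ _).continuousOn
  have e1 : edgeKernel α β γ A B ((n : ℝ) ^ 2) (p n) τ =
      (∫ y in (0 : ℝ)..(n : ℝ) ^ 2, (p n).eval y * (1 - y / (n : ℝ) ^ 2) ^ β * ψ y) -
        γ * τ * ∫ y in (0 : ℝ)..(n : ℝ) ^ 2, (p n).eval y *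
        (y ^ (a - 1) * (1 - y / (n : ℝ) ^ 2) ^ β) := by
    rw [← intervalIntegral.integral_const_mul, ← intervalIntegral.integral_sub (hpi n _ _)
      ((hint.continuousOn_mul (p n).continuous.continuousOn).const_mul _), edgeKernel]
    congr 1; ext y; simp only [hψ]; ring
  rw [e1, ← intervalIntegral.integral_add_adjacent_intervals (hpi n 0 R) (hpi n R _),
    sub_sub_sub_cancel_right, add_sub_cancel_left]
  have habs : IntervalIntegrable (fun y : ℝ => |(p n).eval y| *
      (y ^ (a - 1) * (1 - y / (n : ℝ) ^ 2) ^ β)) volume 0 ((n : ℝ) ^ 2) :=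
    hint.continuousOn_mul (p n).continuous.abs.continuousOn
  have hpt : ∀ y ∈ Ioc R ((n : ℝ) ^ 2), ‖(p n).eval y * (1 - y / (n : ℝ) ^ 2) ^ β * ψ y‖ ≤
      K / R * (|(p n).eval y| * (y ^ (a - 1) * (1 - y / (n : ℝ) ^ 2) ^ β)) := by
    intro y hy
    have e1 : 0 ≤ 1 - y / (n : ℝ) ^ 2 := by rw [sub_nonneg, div_le_one hN]; exact hy.2
    have e2 := Real.rpow_nonneg e1 β
    rw [norm_mul, norm_mul, Real.norm_eq_abs, Real.norm_eq_abs, Real.norm_eq_abs,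
      abs_of_nonneg e2]
    calc _ ≤ |(p n).eval y| * (1 - y / (n : ℝ) ^ 2) ^ β * (K / R * y ^ (a - 1)) := by
          gcongr; exact hpsi R y hR1 hy.1.le
      _ = _ := by ring
  have hsub : IntervalIntegrable (fun y : ℝ => |(p n).eval y| *
      (y ^ (a - 1) * (1 - y / (n : ℝ) ^ 2) ^ β)) volume R ((n : ℝ) ^ 2) :=
    habs.mono_set (by
      rw [uIcc_of_le hnR, uIcc_of_le hN.le]; exact Icc_subset_Icc_left hR0.le)
  have h1 := intervalIntegral.norm_integral_le_of_norm_le hnR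
    (Eventually.of_forall fun y hy => hpt y hy) (hsub.const_mul (K / R))
  rw [intervalIntegral.integral_const_mul, Real.norm_eq_abs] at h1
  refine h1.trans (le_trans ?_ hR2)
  refine mul_le_mul_of_nonneg_left ?_ (by positivity)
  have h2 : ∫ y in R..(n : ℝ) ^ 2, |(p n).eval y| *
      (y ^ (a - 1) * (1 - y / (n : ℝ) ^ 2) ^ β) ≤ D := by
    refine le_trans ?_ hnD
    refine intervalIntegral.integral_mono_interval hR0.le hnR le_rfl ?_ habs
    filter_upwards [ae_restrict_mem measurableSet_Ioc] with y hy
    have e1 : 0 ≤ 1 - y / (n : ℝ) ^ 2 := by rw [sub_nonneg, div_le_one hN]; exact hy.2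
    have := hy.1.le
    simp only [Pi.zero_apply]
    positivity
  linarith [le_abs_self D]

end kernel

/-! ### Holomorphic extension in τ -/

section holomorphic

/-- Holomorphic dependence of an integral on a parameter. -/
theorem differentiableOn_integral_of_bound {μ : Measure ℝ} {F : ℂ → ℝ → ℂ} {c : ℂ} {r : ℝ}
    {G : ℝ → ℝ} (hmeas : ∀ τ ∈ Metric.ball c r, AEStronglyMeasurable (F τ) μ)
    (hdiff : ∀ᵐ y ∂μ, DifferentiableOn ℂ (fun τ => F τ y) (Metric.ball c r))
    (hbound : ∀ᵐ y ∂μ, ∀ τ ∈ Metric.ball c r, ‖F τ y‖ ≤ G y) (hG : Integrable G μ) :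
    DifferentiableOn ℂ (fun τ => ∫ y, F τ y ∂μ) (Metric.ball c r) := by
  intro τ hτ
  obtain ⟨ρ, hρ, hsub⟩ : ∃ ρ > 0, Metric.ball τ (2 * ρ) ⊆ Metric.ball c r := by
    obtain ⟨ε, hε, h⟩ := Metric.isOpen_iff.1 Metric.isOpen_ball τ hτ
    exact ⟨ε / 2, by positivity, by rwa [mul_div_cancel₀ _ two_ne_zero]⟩
  have hmem : ∀ t ∈ Metric.ball τ ρ, Metric.closedBall t (ρ / 2) ⊆ Metric.ball c r := by
    intro t ht z hz
    refine hsub ?_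
    rw [Metric.mem_ball] at ht ⊢
    rw [Metric.mem_closedBall] at hz
    linarith [dist_triangle z t τ]
  have hder : ∀ᵐ y ∂μ, ∀ t ∈ Metric.ball τ ρ,
      HasDerivAt (fun τ => F τ y) (deriv (fun τ => F τ y) t) t := by
    filter_upwards [hdiff] with y hy t ht
    exact (hy.differentiableAt (Metric.isOpen_ball.mem_nhds
      (hmem t ht (Metric.mem_closedBall_self (by positivity))))).hasDerivAt
  -- Measurability of the derivative in y is not assumed; it follows because the derivative is a
  -- limit of measurable difference quotients.
  have hderm : AEStronglyMeasurable (fun y => deriv (fun τ => F τ y) τ) μ := by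
    set h : ℕ → ℂ := fun m => ((ρ / (m + 1) : ℝ) : ℂ) with hh
    have hh0 : Tendsto h atTop (𝓝 0) := by
      rw [hh, ← Complex.ofReal_zero]
      refine (Complex.continuous_ofReal.tendsto 0).comp ?_
      have := (tendsto_one_div_add_atTop_nhds_zero_nat (𝕜 := ℝ)).const_mul ρ
      simpa [div_eq_mul_inv] using this
    have hne : ∀ m, h m ≠ 0 := fun m => by
      simp only [hh]; exact_mod_cast (by positivity : ρ / ((m : ℝ) + 1) ≠ 0)
    have hb : ∀ m, τ + h m ∈ Metric.ball c r := fun m => hsub (by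
      rw [Metric.mem_ball, dist_eq_norm, add_sub_cancel_left, Complex.norm_real,
        Real.norm_eq_abs, abs_of_pos (by positivity), div_lt_iff₀ (by positivity)]
      have : (0 : ℝ) ≤ m := Nat.cast_nonneg m
      nlinarith)
    refine aestronglyMeasurable_of_tendsto_ae atTop
      (f := fun m y => (h m)⁻¹ • (F (τ + h m) y - F τ y))
      (fun m => AEStronglyMeasurable.const_smul ((hmeas _ (hb m)).sub (hmeas τ hτ)) ((h m)⁻¹)) ?_
    filter_upwards [hder] with y hy
    exact (hasDerivAt_iff_tendsto_slope_zero.1 (hy τ (Metric.mem_ball_self hρ))).comp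
      (tendsto_nhdsWithin_iff.2 ⟨hh0, Eventually.of_forall hne⟩)
  have hGF : ∀ᵐ y ∂μ, ‖F τ y‖ ≤ G y := hbound.mono fun y hy => hy τ hτ
  refine (hasDerivAt_integral_of_dominated_loc_of_deriv_le (Metric.ball_mem_nhds τ hρ)
    (bound := fun y => G y / (ρ / 2)) ?_ (hG.mono' (hmeas τ hτ) hGF) hderm ?_ (hG.div_const _)
    hder).2.differentiableAt.differentiableWithinAt
  · filter_upwards [Metric.isOpen_ball.mem_nhds hτ] with t ht using hmeas t ht
  · filter_upwards [hdiff, hbound] with y hy hb t ht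
    refine Complex.norm_deriv_le_of_forall_mem_sphere_norm_le (by positivity) ?_
      fun z hz => hb z (hmem t ht (Metric.sphere_subset_closedBall hz))
    refine DifferentiableOn.diffContOnCl ?_
    rw [closure_ball _ (by positivity)]
    exact hy.mono (hmem t ht)

/-- Membership estimates for the disc around `τ₀` of radius `τ₀ / 4`. -/
theorem mem_ball_quarter {τ₀ : ℝ} {τ : ℂ} (h : τ ∈ Metric.ball (τ₀ : ℂ) (τ₀ / 4)) :
    3 / 4 * τ₀ < τ.re ∧ τ.re < 5 / 4 * τ₀ ∧ ‖τ‖ ≤ 5 / 4 * τ₀ := by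
  rw [Metric.mem_ball, dist_eq_norm] at h
  have h1 := (Complex.abs_re_le_norm (τ - τ₀)).trans_lt h
  rw [Complex.sub_re, Complex.ofReal_re, abs_lt] at h1
  have hτ₀ : 0 < τ₀ := by linarith [(norm_nonneg _).trans_lt h]
  have h2 := norm_add_le (τ - τ₀) τ₀
  rw [sub_add_cancel, Complex.norm_real, Real.norm_eq_abs, abs_of_pos hτ₀] at h2
  exact ⟨by linarith [h1.1], by linarith [h1.2], by linarith⟩

theorem one_sub_div_estimates {N R : ℝ} {w : ℂ} (hR : 0 < R) (hN : 2 * R ≤ N) (hw : ‖w‖ ≤ R) :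
    0 < (1 - w / N).re ∧ ‖1 - w / N‖ ≤ 2 := by
  have hN0 : 0 < N := by linarith
  have h1 : ‖w / N‖ ≤ 1 / 2 := by
    rw [norm_div, Complex.norm_real, Real.norm_eq_abs, abs_of_pos hN0, div_le_iff₀ hN0]
    linarith
  have h2 := (Complex.abs_re_le_norm (w / N)).trans h1
  refine ⟨?_, (norm_sub_le _ _).trans ?_⟩
  · rw [Complex.sub_re, Complex.one_re]; linarith [le_abs_self (w / N).re]
  · rw [norm_one]; linarith

variable {α β γ : ℝ}

theorem ofReal_integrand {N : ℝ} (p : ℝ[X]) (β : ℝ) {y : ℝ} (hy : 0 ≤ 1 - y / N) :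
    (1 - (y : ℂ) / N) ^ (β : ℂ) * aeval (y : ℂ) p =
      (((1 - y / N) ^ β * p.eval y : ℝ) : ℂ) := by
  rw [Complex.ofReal_mul, Complex.ofReal_cpow hy, aeval_ofReal]; push_cast; rfl

theorem norm_weight_le (hβ : 0 < β) {N R M : ℝ} {p : ℝ[X]} (hR : 0 < R) (hN : 2 * R ≤ N)
    (hM : ∀ z : ℂ, ‖z‖ ≤ R → ‖aeval z p‖ ≤ M) {w : ℂ} (hw : ‖w‖ ≤ R) :
    ‖(1 - w / N) ^ (β : ℂ) * aeval w p‖ ≤ 2 ^ β * M := by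
  rw [norm_mul, Complex.norm_cpow_real]
  exact mul_le_mul (Real.rpow_le_rpow (norm_nonneg _) (one_sub_div_estimates hR hN hw).2 hβ.le)
    (hM w hw) (norm_nonneg _) (by positivity)

theorem differentiableAt_weight {N R : ℝ} (p : ℝ[X]) (β : ℝ) (hR : 0 < R) (hN : 2 * R ≤ N)
    {w : ℂ → ℂ} {τ : ℂ} (hd : DifferentiableAt ℂ w τ) (hw : ‖w τ‖ ≤ R) :
    DifferentiableAt ℂ (fun τ => (1 - w τ / N) ^ (β : ℂ) * aeval (w τ) p) τ := by
  have h : DifferentiableAt ℂ (fun τ => aeval (w τ) p) τ :=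
    DifferentiableAt.comp τ (Polynomial.differentiable_aeval p (w τ)) hd
  exact (((hd.div_const _).const_sub 1).cpow_const (Or.inl (one_sub_div_estimates hR hN hw).1)).mul
    h

theorem measurable_weight {N : ℝ} (p : ℝ[X]) (β : ℝ) {w : ℝ → ℂ} (hw : Measurable w) :
    Measurable fun y => (1 - w y / N) ^ (β : ℂ) * aeval (w y) p :=
  ((measurable_const.sub (hw.div_const _)).pow_const _).mul
    ((p.continuous_aeval (A := ℂ)).measurable.comp hw)

/-- The contribution of `(0, τ)`. -/
theorem exists_holomorphic_left (hα : 0 < α) (hβ : 0 < β) (hγ : 0 < γ) {τ₀ N M : ℝ} {p : ℝ[X]}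
    (hτ₀ : 0 < τ₀) (hN : 4 * τ₀ ≤ N) (hM : ∀ z : ℂ, ‖z‖ ≤ 2 * τ₀ → ‖aeval z p‖ ≤ M) :
    ∃ F : ℂ → ℂ, DifferentiableOn ℂ F (Metric.ball τ₀ (τ₀ / 4)) ∧
      (∀ τ ∈ Metric.ball (τ₀ : ℂ) (τ₀ / 4), ‖F τ‖ ≤
        (2 * τ₀) ^ (α + γ + 1) * (2 ^ β * M)) ∧
      ∀ τ : ℝ, (τ : ℂ) ∈ Metric.ball (τ₀ : ℂ) (τ₀ / 4) →
        F τ = ((∫ y in (0 : ℝ)..τ, y ^ α * (τ - y) ^ γ * ((1 - y / N) ^ β * p.eval y) : ℝ) : ℂ) := by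
  have hR : 0 < 2 * τ₀ := by positivity
  have hN' : 2 * (2 * τ₀) ≤ N := by linarith
  -- The substitution y = τz fixes the moving singular endpoint y = τ at z = 1; the real powers
  -- become τ^(α+γ+1) z^α (1-z)^γ, holomorphic in τ.
  set I : ℂ → ℝ → ℂ := fun τ z => τ ^ ((α + γ + 1 : ℝ) : ℂ) * ((z ^ α * (1 - z) ^ γ : ℝ) : ℂ) *
    ((1 - τ * z / N) ^ (β : ℂ) * aeval (τ * z) p) with hI
  have hw : ∀ τ ∈ Metric.ball (τ₀ : ℂ) (τ₀ / 4), ∀ z ∈ Ioo (0 : ℝ) 1, ‖τ * z‖ ≤ 2 * τ₀ := by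
    intro τ hτ z hz
    rw [norm_mul, Complex.norm_real, Real.norm_eq_abs, abs_of_pos hz.1]
    have := (mem_ball_quarter hτ).2.2
    nlinarith [norm_nonneg τ, hz.2, hz.1]
  have hb : ∀ τ ∈ Metric.ball (τ₀ : ℂ) (τ₀ / 4), ∀ z ∈ Ioo (0 : ℝ) 1, ‖I τ z‖ ≤
      (2 * τ₀) ^ (α + γ + 1) * (2 ^ β * M) := by
    intro τ hτ z hz
    have h1 : (0 : ℝ) ≤ 1 - z := by linarith [hz.2]
    have h2 : z ^ α * (1 - z) ^ γ ≤ 1 :=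
      mul_le_one₀ (Real.rpow_le_one hz.1.le hz.2.le hα.le) (Real.rpow_nonneg h1 _)
        (Real.rpow_le_one h1 (by linarith [hz.1]) hγ.le)
    have h3 : 0 ≤ z ^ α * (1 - z) ^ γ := mul_nonneg (Real.rpow_nonneg hz.1.le _)
      (Real.rpow_nonneg h1 _)
    have h4 := (mem_ball_quarter hτ).2.2
    rw [hI, norm_mul, norm_mul, Complex.norm_cpow_real, Complex.norm_real, Real.norm_eq_abs,
      abs_of_nonneg h3]
    refine mul_le_mul ?_ (norm_weight_le hβ hR hN' hM (hw τ hτ z hz)) (norm_nonneg _)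
      (by positivity)
    calc _ ≤ (2 * τ₀) ^ (α + γ + 1) * 1 := by gcongr; linarith
      _ = _ := mul_one _
  refine ⟨fun τ => ∫ z in Ioo (0 : ℝ) 1, I τ z, ?_, fun τ hτ => ?_, fun τ hτ => ?_⟩
  · refine differentiableOn_integral_of_bound
      (G := fun _ => (2 * τ₀) ^ (α + γ + 1) * (2 ^ β * M)) (fun τ _ => ?_) ?_ ?_
      (integrable_const _)
    · refine Measurable.aestronglyMeasurable ((measurable_const.mul
        (Complex.measurable_ofReal.comp ((measurable_id.pow_const _).mul
          ((measurable_const.sub measurable_id).pow_const _)))).mul (measurable_weight p β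
            (measurable_const.mul Complex.measurable_ofReal)))
    · filter_upwards [ae_restrict_mem measurableSet_Ioo] with z hz τ hτ
      refine (((differentiableAt_id.cpow_const (Or.inl ?_)).mul_const _).mul
        (differentiableAt_weight p β hR hN' (differentiableAt_id.mul_const (z : ℂ))
          (hw τ hτ z hz))).differentiableWithinAt
      have := (mem_ball_quarter hτ).1
      simp only [id]; linarith
    · filter_upwards [ae_restrict_mem measurableSet_Ioo] with z hz τ hτ using hb τ hτ z hz
  · refine (norm_setIntegral_le_of_norm_le_const (by simp) (hb τ hτ)).trans ?_
    simp
  · have hτ' := mem_ball_quarter hτ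
    rw [Complex.ofReal_re] at hτ'
    have h0 : 0 < τ := by linarith [hτ'.1]
    have hs := intervalIntegral.mul_integral_comp_mul_left (a := 0) (b := 1)
      (f := fun y => y ^ α * (τ - y) ^ γ * ((1 - y / N) ^ β * p.eval y)) (c := τ)
    rw [mul_zero, mul_one] at hs
    rw [← hs, ← intervalIntegral.integral_const_mul, intervalIntegral.integral_of_le zero_le_one,
      integral_Ioc_eq_integral_Ioo, ← integral_complex_ofReal]
    refine setIntegral_congr_fun measurableSet_Ioo fun z hz => ?_
    have h1 : 0 ≤ 1 - τ * z / N := by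
      rw [sub_nonneg, div_le_one (by linarith)]
      nlinarith [hz.1, hz.2]
    have e1 := ofReal_integrand p β h1
    rw [Complex.ofReal_mul] at e1
    have e2 : (τ - τ * z) ^ γ = τ ^ γ * (1 - z) ^ γ := by
      rw [← Real.mul_rpow h0.le (by linarith [hz.2])]; ring_nf
    simp only [hI]
    rw [e1, ← Complex.ofReal_cpow h0.le, e2, Real.mul_rpow h0.le hz.1.le, Real.rpow_add_one h0.ne',
      Real.rpow_add h0]
    push_cast; ring

/-- The contribution of `(τ, R)`. -/
theorem exists_holomorphic_middle (hα : 0 < α) (hβ : 0 < β) (hγ : 0 < γ) {τ₀ N M : ℝ} {p : ℝ[X]}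
    (hτ₀ : 0 < τ₀) (hN : 4 * τ₀ ≤ N) (hM : ∀ z : ℂ, ‖z‖ ≤ 2 * τ₀ → ‖aeval z p‖ ≤ M) :
    ∃ F : ℂ → ℂ, DifferentiableOn ℂ F (Metric.ball τ₀ (τ₀ / 4)) ∧
      (∀ τ ∈ Metric.ball (τ₀ : ℂ) (τ₀ / 4), ‖F τ‖ ≤
        (4 * τ₀) ^ (γ + 1) * (2 * τ₀) ^ α * (2 ^ β * M)) ∧
      ∀ τ : ℝ, (τ : ℂ) ∈ Metric.ball (τ₀ : ℂ) (τ₀ / 4) →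
        F τ = ((∫ y in τ..(2 * τ₀), y ^ α * (y - τ) ^ γ * ((1 - y / N) ^ β * p.eval y) : ℝ) : ℂ) := by
  have hR : 0 < 2 * τ₀ := by positivity
  have hN' : 2 * (2 * τ₀) ≤ N := by linarith
  -- The substitution y = τ + (2τ₀-τ)z fixes the singularity at z = 0. Its values have positive real
  -- part, so the principal power α is holomorphic along it.
  set W : ℂ → ℝ → ℂ := fun τ z => τ + ((2 * τ₀ : ℝ) - τ) * z with hW
  set I : ℂ → ℝ → ℂ := fun τ z => (((2 * τ₀ : ℝ) : ℂ) - τ) ^ ((γ + 1 : ℝ) : ℂ) * ((z ^ γ : ℝ) : ℂ) *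
    (W τ z) ^ (α : ℂ) * ((1 - W τ z / N) ^ (β : ℂ) * aeval (W τ z) p) with hI
  have hWe : ∀ τ z, W τ z = ((1 - z : ℝ) : ℂ) * τ + ((z * (2 * τ₀) : ℝ) : ℂ) := by
    intro τ z; simp only [hW]; push_cast; ring
  have hw : ∀ τ ∈ Metric.ball (τ₀ : ℂ) (τ₀ / 4), ∀ z ∈ Ioo (0 : ℝ) 1, ‖W τ z‖ ≤ 2 * τ₀ := by
    intro τ hτ z hz
    have := (mem_ball_quarter hτ).2.2
    rw [hWe]
    refine (norm_add_le _ _).trans ?_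
    rw [norm_mul, Complex.norm_real, Complex.norm_real, Real.norm_eq_abs, Real.norm_eq_abs,
      abs_of_pos (by linarith [hz.2]), abs_of_pos (by nlinarith [hz.1])]
    nlinarith [norm_nonneg τ, hz.2, hz.1]
  have hwre : ∀ τ ∈ Metric.ball (τ₀ : ℂ) (τ₀ / 4), ∀ z ∈ Ioo (0 : ℝ) 1, 0 < (W τ z).re := by
    intro τ hτ z hz
    have := (mem_ball_quarter hτ).1
    rw [hWe, Complex.add_re, Complex.re_ofReal_mul, Complex.ofReal_re]
    have h1 : 0 < (1 - z) * τ.re := mul_pos (by linarith [hz.2]) (by linarith)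
    have h2 : 0 < z * (2 * τ₀) := mul_pos hz.1 hR
    linarith
  have hsub : ∀ τ ∈ Metric.ball (τ₀ : ℂ) (τ₀ / 4), ‖((2 * τ₀ : ℝ) : ℂ) - τ‖ ≤ 4 * τ₀ := by
    intro τ hτ
    have := (mem_ball_quarter hτ).2.2
    refine (norm_sub_le _ _).trans ?_
    rw [Complex.norm_real, Real.norm_eq_abs, abs_of_pos hR]; linarith
  have hb : ∀ τ ∈ Metric.ball (τ₀ : ℂ) (τ₀ / 4), ∀ z ∈ Ioo (0 : ℝ) 1, ‖I τ z‖ ≤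
      (4 * τ₀) ^ (γ + 1) * (2 * τ₀) ^ α * (2 ^ β * M) := by
    intro τ hτ z hz
    have h3 : 0 ≤ z ^ γ := Real.rpow_nonneg hz.1.le _
    have h2 : z ^ γ ≤ 1 := Real.rpow_le_one hz.1.le hz.2.le hγ.le
    rw [hI, norm_mul, norm_mul, norm_mul, Complex.norm_cpow_real, Complex.norm_cpow_real,
      Complex.norm_real, Real.norm_eq_abs, abs_of_nonneg h3]
    refine mul_le_mul ?_ (norm_weight_le hβ hR hN' hM (hw τ hτ z hz)) (norm_nonneg _)
      (by positivity)
    calc _ ≤ (4 * τ₀) ^ (γ + 1) * 1 * (2 * τ₀) ^ α := by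
          gcongr
          · exact hsub τ hτ
          · exact hw τ hτ z hz
      _ = _ := by rw [mul_one]
  refine ⟨fun τ => ∫ z in Ioo (0 : ℝ) 1, I τ z, ?_, fun τ hτ => ?_, fun τ hτ => ?_⟩
  · refine differentiableOn_integral_of_bound
      (G := fun _ => (4 * τ₀) ^ (γ + 1) * (2 * τ₀) ^ α * (2 ^ β * M)) (fun τ _ => ?_) ?_ ?_
      (integrable_const _)
    · have hWm : Measurable (W τ) :=
        measurable_const.add (measurable_const.mul Complex.measurable_ofReal)
      exact Measurable.aestronglyMeasurable (((measurable_const.mul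
        (Complex.measurable_ofReal.comp (measurable_id.pow_const _))).mul
          (hWm.pow_const _)).mul (measurable_weight p β hWm))
    · filter_upwards [ae_restrict_mem measurableSet_Ioo] with z hz τ hτ
      have hWd : DifferentiableAt ℂ (fun τ => W τ z) τ :=
        differentiableAt_id.add ((differentiableAt_id.const_sub _).mul_const _)
      refine (((((differentiableAt_id.const_sub _).cpow_const (Or.inl ?_)).mul_const _).mul
        (hWd.cpow_const (Or.inl (hwre τ hτ z hz)))).mul
        (differentiableAt_weight p β hR hN' hWd (hw τ hτ z hz))).differentiableWithinAt
      have := (mem_ball_quarter hτ).2.1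
      simp only [id, Complex.sub_re, Complex.ofReal_re]; linarith
    · filter_upwards [ae_restrict_mem measurableSet_Ioo] with z hz τ hτ using hb τ hτ z hz
  · refine (norm_setIntegral_le_of_norm_le_const (by simp) (hb τ hτ)).trans ?_
    simp
  · have hτ' := mem_ball_quarter hτ
    rw [Complex.ofReal_re] at hτ'
    have h0 : 0 < τ := by linarith [hτ'.1]
    have h2 : 0 < 2 * τ₀ - τ := by linarith [hτ'.2.1]
    have hs := intervalIntegral.mul_integral_comp_add_mul (a := 0) (b := 1)
      (f := fun y => y ^ α * (y - τ) ^ γ * ((1 - y / N) ^ β * p.eval y)) (2 * τ₀ - τ) τ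
    rw [mul_zero, mul_one, add_zero, add_sub_cancel] at hs
    rw [← hs, ← intervalIntegral.integral_const_mul, intervalIntegral.integral_of_le zero_le_one,
      integral_Ioc_eq_integral_Ioo, ← integral_complex_ofReal]
    refine setIntegral_congr_fun measurableSet_Ioo fun z hz => ?_
    have hWr : W (τ : ℂ) z = ((τ + (2 * τ₀ - τ) * z : ℝ) : ℂ) := by simp only [hW]; push_cast; ring
    have hpos : 0 ≤ τ + (2 * τ₀ - τ) * z := by
      have := mul_pos h2 hz.1
      linarith
    have hle : τ + (2 * τ₀ - τ) * z ≤ 2 * τ₀ := by nlinarith [hz.2]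
    have h1 : 0 ≤ 1 - (τ + (2 * τ₀ - τ) * z) / N := by
      rw [sub_nonneg, div_le_one (by linarith)]; linarith
    have e1 := ofReal_integrand p β h1
    have e2 : (τ + (2 * τ₀ - τ) * z - τ) ^ γ = (2 * τ₀ - τ) ^ γ * z ^ γ := by
      rw [← Real.mul_rpow h2.le hz.1.le]; ring_nf
    simp only [hI]
    rw [hWr, e1, ← Complex.ofReal_sub, ← Complex.ofReal_cpow h2.le, ← Complex.ofReal_cpow hpos, e2,
      Real.rpow_add_one h2.ne']
    simp only [← Complex.ofReal_mul]
    congr 1; ring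

/-- The contribution of `(R, N)`. -/
theorem exists_holomorphic_tail (a β γ : ℝ) :
    ∃ K : ℝ, 0 ≤ K ∧ ∀ {τ₀ N D : ℝ} {p : ℝ[X]}, 0 < a → 0 < β → 0 < τ₀ → 4 * τ₀ ≤ N →
    (∫ y in (0 : ℝ)..N, |p.eval y| * (y ^ (a - 1) * (1 - y / N) ^ β) ≤ D) →
    ∃ F : ℂ → ℂ, DifferentiableOn ℂ F (Metric.ball τ₀ (τ₀ / 4)) ∧
      (∀ τ ∈ Metric.ball (τ₀ : ℂ) (τ₀ / 4), ‖F τ‖ ≤ K * (5 / 4 * τ₀) * D) ∧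
      ∀ τ : ℝ, (τ : ℂ) ∈ Metric.ball (τ₀ : ℂ) (τ₀ / 4) →
        F τ = ((∫ y in (2 * τ₀)..N, p.eval y * (1 - y / N) ^ β *
          (y ^ a * ((1 - τ / y) ^ γ - 1)) : ℝ) : ℂ) := by
  obtain ⟨K, hK, hKb⟩ := exists_norm_one_sub_cpow_sub_one_le γ
  refine ⟨K, hK, fun {τ₀ N D p} ha hβ hτ₀ hN hD => ?_⟩
  have hN0 : 0 < N := by linarith
  -- Beyond 2τ₀ there is no singularity, and subtracting 1 gains the factor τ/y that turns y^a into
  -- the controlled weight y^(a-1).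
  set I : ℂ → ℝ → ℂ := fun τ y => ((1 - τ / y) ^ (γ : ℂ) - 1) *
    ((p.eval y * (1 - y / N) ^ β * y ^ a : ℝ) : ℂ) with hI
  set G : ℝ → ℝ := fun y => K * (5 / 4 * τ₀) *
    (|p.eval y| * (y ^ (a - 1) * (1 - y / N) ^ β)) with hG
  have hw : ∀ τ ∈ Metric.ball (τ₀ : ℂ) (τ₀ / 4), ∀ y ∈ Ioo (2 * τ₀) N, ‖τ / y‖ ≤ 5 / 8 := by
    intro τ hτ y hy
    have hy0 : 0 < y := by linarith [hy.1]
    rw [norm_div, Complex.norm_real, Real.norm_eq_abs, abs_of_pos hy0, div_le_iff₀ hy0]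
    linarith [(mem_ball_quarter hτ).2.2, hy.1]
  have hb : ∀ τ ∈ Metric.ball (τ₀ : ℂ) (τ₀ / 4), ∀ y ∈ Ioo (2 * τ₀) N, ‖I τ y‖ ≤ G y := by
    intro τ hτ y hy
    have hy0 : 0 < y := by linarith [hy.1]
    have h1 : 0 ≤ 1 - y / N := by rw [sub_nonneg, div_le_one hN0]; exact hy.2.le
    have h2 := (hKb _ (hw τ hτ y hy))
    have h3 : ‖τ / (y : ℂ)‖ ≤ 5 / 4 * τ₀ / y := by
      rw [norm_div, Complex.norm_real, Real.norm_eq_abs, abs_of_pos hy0]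
      have := (mem_ball_quarter hτ).2.2
      gcongr
    rw [hI, norm_mul, Complex.norm_real, Real.norm_eq_abs, abs_mul, abs_mul,
      abs_of_nonneg (Real.rpow_nonneg h1 _), abs_of_nonneg (Real.rpow_nonneg hy0.le _)]
    have h4 : y ^ a = y ^ (a - 1) * y := by rw [← Real.rpow_add_one hy0.ne']; ring_nf
    calc _ ≤ K * (5 / 4 * τ₀ / y) * (|p.eval y| * (1 - y / N) ^ β * y ^ a) := by
          refine mul_le_mul_of_nonneg_right (h2.trans (mul_le_mul_of_nonneg_left h3 hK)) ?_
          have := Real.rpow_nonneg h1 β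
          positivity
      _ = G y := by rw [h4, hG]; field_simp
  have hint : IntervalIntegrable G volume 0 N :=
    (((intervalIntegrable_rpow_of_nonneg (by linarith)).mul_continuousOn
      (continuous_one_sub_div_rpow hβ N).continuousOn).continuousOn_mul
        p.continuous.abs.continuousOn).const_mul _
  have hGi : IntegrableOn G (Ioo (2 * τ₀) N) volume := by
    rw [intervalIntegrable_iff_integrableOn_Ioo_of_le hN0.le] at hint
    exact hint.mono_set (Ioo_subset_Ioo_left (by linarith))
  have hGI : ∫ y in Ioo (2 * τ₀) N, G y ≤ K * (5 / 4 * τ₀) * D := by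
    have h1 : ∫ y in (0 : ℝ)..N, G y ≤ K * (5 / 4 * τ₀) * D := by
      simp only [hG]
      rw [intervalIntegral.integral_const_mul]
      exact mul_le_mul_of_nonneg_left hD (by positivity)
    refine le_trans ?_ h1
    rw [intervalIntegral.integral_of_le hN0.le, integral_Ioc_eq_integral_Ioo]
    refine setIntegral_mono_set
      ((intervalIntegrable_iff_integrableOn_Ioo_of_le hN0.le).1 hint) ?_
      (Ioo_subset_Ioo_left (by linarith)).eventuallyLE
    filter_upwards [ae_restrict_mem measurableSet_Ioo] with y hy
    have h1 : 0 ≤ 1 - y / N := by rw [sub_nonneg, div_le_one hN0]; exact hy.2.le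
    have := hy.1.le
    simp only [Pi.zero_apply, hG]
    positivity
  refine ⟨fun τ => ∫ y in Ioo (2 * τ₀) N, I τ y, ?_, fun τ hτ => ?_, fun τ hτ => ?_⟩
  · refine differentiableOn_integral_of_bound (G := G) (fun τ _ => ?_) ?_ ?_ hGi
    · refine Measurable.aestronglyMeasurable ((((measurable_const.sub
        (measurable_const.div Complex.measurable_ofReal)).pow_const _).sub_const _).mul
          (Complex.measurable_ofReal.comp ?_))
      exact ((p.continuous.mul (continuous_one_sub_div_rpow hβ N)).measurable.mul
        (measurable_id.pow_const _))
    · filter_upwards [ae_restrict_mem measurableSet_Ioo] with y hy τ hτ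
      refine ((((differentiableAt_id.div_const _).const_sub 1).cpow_const
        (Or.inl ?_)).sub_const _ |>.mul_const _).differentiableWithinAt
      have := (Complex.abs_re_le_norm _).trans (hw τ hτ y hy)
      simp only [Complex.sub_re, Complex.one_re]
      linarith [le_abs_self (τ / (y : ℂ)).re]
    · filter_upwards [ae_restrict_mem measurableSet_Ioo] with y hy τ hτ using hb τ hτ y hy
  · refine (norm_integral_le_of_norm_le hGi ?_).trans hGI
    filter_upwards [ae_restrict_mem measurableSet_Ioo] with y hy using hb τ hτ y hy
  · have hτ' := mem_ball_quarter hτ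
    rw [Complex.ofReal_re] at hτ'
    rw [intervalIntegral.integral_of_le (by linarith), integral_Ioc_eq_integral_Ioo,
      ← integral_complex_ofReal]
    refine setIntegral_congr_fun measurableSet_Ioo fun y hy => ?_
    have hy0 : 0 < y := by linarith [hy.1]
    have h1 : 0 ≤ 1 - τ / y := by
      rw [sub_nonneg, div_le_one hy0]; linarith [hτ'.2.1, hy.1]
    simp only [hI]
    rw [show (1 : ℂ) - τ / y = ((1 - τ / y : ℝ) : ℂ) by push_cast; rfl, ← Complex.ofReal_cpow h1]
    push_cast; ring

/-- `edgeKernel` extends holomorphically to a disc, with uniform bounds. -/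
theorem exists_holomorphic_edgeKernel (hα : 0 < α) (hβ : 0 < β) (hγ : 0 < γ) {A B : ℝ}
    (hAB : 0 < A + B) {τ₀ : ℝ} (hτ₀ : 0 < τ₀) (M D : ℝ) :
    ∃ C : ℝ, ∀ (N : ℝ) (p : ℝ[X]), 4 * τ₀ ≤ N → (∀ z : ℂ, ‖z‖ ≤ 2 * τ₀ → ‖aeval z p‖ ≤ M) →
    (∫ y in (0 : ℝ)..N, |p.eval y| * (y ^ (α + γ - 1) * (1 - y / N) ^ β) ≤ D) →
    ∃ F : ℂ → ℂ, DifferentiableOn ℂ F (Metric.ball τ₀ (τ₀ / 4)) ∧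
      (∀ τ ∈ Metric.ball (τ₀ : ℂ) (τ₀ / 4), ‖F τ‖ ≤ C) ∧
      ∀ τ : ℝ, (τ : ℂ) ∈ Metric.ball (τ₀ : ℂ) (τ₀ / 4) →
        F τ = (edgeKernel α β γ A B N p τ : ℂ) := by
  obtain ⟨K, hK, htail⟩ := exists_holomorphic_tail (α + γ) β γ
  refine ⟨|A / (A + B)| * ((2 * τ₀) ^ (α + γ + 1) * (2 ^ β * M)) +
    (4 * τ₀) ^ (γ + 1) * (2 * τ₀) ^ α * (2 ^ β * M) +
    (2 ^ β * M * (2 * τ₀) ^ (α + γ) * |2 * τ₀ - 0|) + K * (5 / 4 * τ₀) * D,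
    fun N p hN hM hD => ?_⟩
  have hN0 : 0 < N := by linarith
  have hR : 0 < 2 * τ₀ := by positivity
  obtain ⟨F₁, hF₁, hb₁, he₁⟩ := exists_holomorphic_left hα hβ hγ hτ₀ hN hM
  obtain ⟨F₂, hF₂, hb₂, he₂⟩ := exists_holomorphic_middle hα hβ hγ hτ₀ hN hM
  obtain ⟨F₃, hF₃, hb₃, he₃⟩ := htail (add_pos hα hγ) hβ hτ₀ hN hD
  -- On (0, 2τ₀) the unperturbed part is constant in τ and is removed as a whole.
  set c : ℝ := ∫ y in (0 : ℝ)..(2 * τ₀), p.eval y * (1 - y / N) ^ β * y ^ (α + γ) with hc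
  have hcb : ‖(c : ℂ)‖ ≤ 2 ^ β * M * (2 * τ₀) ^ (α + γ) * |2 * τ₀ - 0| := by
    rw [Complex.norm_real]
    refine intervalIntegral.norm_integral_le_of_norm_le_const fun y hy => ?_
    rw [uIoc_of_le hR.le] at hy
    have h1 : 0 ≤ 1 - y / N := by rw [sub_nonneg, div_le_one hN0]; linarith [hy.2]
    have h2 : ‖(y : ℂ)‖ ≤ 2 * τ₀ := by
      rw [Complex.norm_real, Real.norm_eq_abs, abs_of_pos hy.1]; exact hy.2
    have h3 := norm_weight_le (N := N) hβ hR (by linarith) hM h2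
    rw [ofReal_integrand p β h1, Complex.norm_real, mul_comm] at h3
    rw [norm_mul, Real.norm_eq_abs (y ^ _), abs_of_nonneg (Real.rpow_nonneg hy.1.le _)]
    refine mul_le_mul h3 (Real.rpow_le_rpow hy.1.le hy.2 (add_pos hα hγ).le)
      (Real.rpow_nonneg hy.1.le _) ((norm_nonneg _).trans h3)
  refine ⟨fun τ => ((A / (A + B) : ℝ) : ℂ) * F₁ τ + F₂ τ - c + F₃ τ,
    (((hF₁.const_mul _).add hF₂).sub_const _).add hF₃, fun τ hτ => ?_, fun τ hτ => ?_⟩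
  · refine (norm_add_le _ _).trans (add_le_add ((norm_sub_le _ _).trans (add_le_add
      ((norm_add_le _ _).trans (add_le_add ?_ (hb₂ τ hτ))) hcb)) (hb₃ τ hτ))
    rw [norm_mul, Complex.norm_real, Real.norm_eq_abs]
    exact mul_le_mul_of_nonneg_left (hb₁ τ hτ) (abs_nonneg _)
  · have hτ' := mem_ball_quarter hτ
    rw [Complex.ofReal_re] at hτ'
    have h0 : 0 < τ := by linarith [hτ'.1]
    have h2 : τ < 2 * τ₀ := by linarith [hτ'.2.1]
    have hpe : Continuous fun y => p.eval y * (1 - y / N) ^ β :=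
      p.continuous.mul (continuous_one_sub_div_rpow hβ N)
    have hint : ∀ l r : ℝ, IntervalIntegrable
        (fun y => p.eval y * (1 - y / N) ^ β * edgeDiff α γ A B τ y) volume l r := fun l r =>
      (hpe.mul (continuous_edgeDiff hα hγ τ)).intervalIntegrable _ _
    have hpa : ∀ l r : ℝ, IntervalIntegrable
        (fun y => p.eval y * (1 - y / N) ^ β * y ^ (α + γ)) volume l r := fun l r =>
      (hpe.mul (continuous_id.rpow_const fun _ => Or.inr (add_pos hα hγ).le)).intervalIntegrable
        _ _
    have hstep : ∀ l r : ℝ, IntervalIntegrable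
        (fun y => p.eval y * (1 - y / N) ^ β *
          (y ^ α * stepPower γ A B (y - τ) / (A + B))) volume l r := fun l r =>
      (hpe.mul (((continuous_id.rpow_const fun _ => Or.inr hα.le).mul
        ((continuous_stepPower hγ).comp (continuous_id.sub continuous_const))).div_const _)
        ).intervalIntegrable _ _
    simp only
    rw [he₁ τ hτ, he₂ τ hτ, he₃ τ hτ]
    simp only [← Complex.ofReal_mul, ← Complex.ofReal_add, ← Complex.ofReal_sub]
    congr 1
    rw [edgeKernel, ← intervalIntegral.integral_add_adjacent_intervals (hint 0 (2 * τ₀))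
      (hint _ N)]
    congr 1
    · have e : ∫ y in (0 : ℝ)..(2 * τ₀), p.eval y * (1 - y / N) ^ β * edgeDiff α γ A B τ y =
          (∫ y in (0 : ℝ)..(2 * τ₀), p.eval y * (1 - y / N) ^ β *
            (y ^ α * stepPower γ A B (y - τ) / (A + B))) - c := by
        rw [hc, ← intervalIntegral.integral_sub (hstep _ _) (hpa _ _)]
        refine intervalIntegral.integral_congr fun y _ => ?_
        simp only [edgeDiff]; ring
      rw [e, ← intervalIntegral.integral_add_adjacent_intervals (hstep 0 τ) (hstep _ _),
        ← intervalIntegral.integral_const_mul]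
      congr 2
      · refine intervalIntegral_congr_Ioo h0.le fun y hy => ?_
        rw [stepPower_of_nonpos (by linarith [hy.2]), neg_sub]
        ring
      · refine intervalIntegral_congr_Ioo h2.le fun y hy => ?_
        rw [stepPower_of_pos (by linarith [hy.1])]
        field_simp
    · refine intervalIntegral_congr_Ioo (by linarith) fun y hy => ?_
      rw [edgeDiff_of_lt hAB h0 (by linarith [hy.1])]

end holomorphic

/-! ### Determinant bounds and convergence to a Fredholm determinant -/

section fredholm

open Matrix ComplexOrder in
/-- Hadamard's inequality in its arithmetic-mean form. -/
theorem norm_det_sq_le_exp {𝕜 ι : Type*} [RCLike 𝕜] [Fintype ι] [DecidableEq ι]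
    (M : Matrix ι ι 𝕜) :
    ‖M.det‖ ^ 2 ≤ Real.exp (∑ i, ∑ j, ‖M i j‖ ^ 2 - Fintype.card ι) := by
  have hH : (Mᴴ * M).PosSemidef := posSemidef_conjTranspose_mul_self M
  have htr : ∑ i, hH.1.eigenvalues i = ∑ i, ∑ j, ‖M i j‖ ^ 2 := by
    have h := hH.1.trace_eq_sum_eigenvalues
    have e : (Mᴴ * M).trace = ((∑ i, ∑ j, ‖M i j‖ ^ 2 : ℝ) : 𝕜) := by
      simp only [trace, diag_apply, mul_apply, conjTranspose_apply]
      push_cast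
      rw [Finset.sum_comm]
      refine Finset.sum_congr rfl fun i _ => Finset.sum_congr rfl fun j _ => ?_
      rw [RCLike.star_def, RCLike.conj_mul]
    rw [e] at h
    exact_mod_cast h.symm
  have hdet : ‖M.det‖ ^ 2 = ∏ i, hH.1.eigenvalues i := by
    have h := hH.1.det_eq_prod_eigenvalues
    have e : (Mᴴ * M).det = ((‖M.det‖ ^ 2 : ℝ) : 𝕜) := by
      rw [det_mul, det_conjTranspose, RCLike.star_def, RCLike.conj_mul]; push_cast; rfl
    rw [e] at h
    exact_mod_cast h
  rw [hdet, ← htr]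
  -- The elementary inequality λ ≤ exp(λ-1), applied to each eigenvalue of M*M.
  calc ∏ i, hH.1.eigenvalues i ≤ ∏ i, Real.exp (hH.1.eigenvalues i - 1) :=
        Finset.prod_le_prod (fun i _ => hH.eigenvalues_nonneg i) fun i _ => by
          linarith [Real.add_one_le_exp (hH.1.eigenvalues i - 1)]
    _ = _ := by
      rw [← Real.exp_sum, Finset.sum_sub_distrib, Finset.sum_const, Finset.card_univ,
        nsmul_eq_mul, mul_one]

/-- The diagonal contributes n + 2C to the sum of squares and the remaining terms C². The n cancels
against the dimension, so the bound is independent of n. -/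
theorem norm_det_one_add_sq_le {n : ℕ} (hn : 0 < n) {M : Matrix (Fin n) (Fin n) ℂ} {C : ℝ}
    (hM : ∀ i j, ‖M i j‖ ≤ C) :
    ‖(1 + ((n : ℂ)⁻¹) • M).det‖ ^ 2 ≤ Real.exp (2 * C + C ^ 2) := by
  have hn' : (0 : ℝ) < n := by exact_mod_cast hn
  have hC : 0 ≤ C := (norm_nonneg _).trans (hM ⟨0, hn⟩ ⟨0, hn⟩)
  refine (norm_det_sq_le_exp _).trans (Real.exp_le_exp.2 ?_)
  have h : ∀ i j, ‖(1 + ((n : ℂ)⁻¹) • M) i j‖ ^ 2 ≤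
      (if i = j then 1 + 2 * C / n else 0) + C ^ 2 / n ^ 2 := by
    intro i j
    have h1 : ‖((n : ℂ)⁻¹) * M i j‖ ≤ C / n := by
      rw [norm_mul, norm_inv, Complex.norm_natCast, div_eq_inv_mul]
      exact mul_le_mul_of_nonneg_left (hM i j) (by positivity)
    rw [Matrix.add_apply, Matrix.smul_apply, smul_eq_mul, Matrix.one_apply]
    split_ifs
    · have h2 := (norm_add_le (1 : ℂ) ((n : ℂ)⁻¹ * M i j)).trans (add_le_add_right h1 _)
      rw [norm_one] at h2
      calc _ ≤ (1 + C / n) ^ 2 := pow_le_pow_left₀ (norm_nonneg _) h2 2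
        _ = _ := by ring
    · rw [zero_add, zero_add]
      calc _ ≤ (C / n) ^ 2 := pow_le_pow_left₀ (norm_nonneg _) h1 2
        _ = _ := by ring
  have h2 := Finset.sum_le_sum fun i (_ : i ∈ Finset.univ) =>
    Finset.sum_le_sum fun j (_ : j ∈ Finset.univ) => h i j
  refine (sub_le_sub_right h2 _).trans (le_of_eq ?_)
  simp only [Finset.sum_add_distrib, Finset.sum_ite_eq, Finset.mem_univ, if_true, Finset.sum_const,
    Finset.card_univ, Fintype.card_fin, nsmul_eq_mul]
  field_simp; ring

/-- Scaling M by (kC²)^(-1/2) makes its squared Frobenius norm at most k, and `norm_det_sq_le_exp`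
then bounds the scaled determinant by 1. -/
theorem det_sq_le_of_bound {k : ℕ} {M : Matrix (Fin k) (Fin k) ℝ} {C : ℝ} (hC : 0 < C)
    (hM : ∀ i j, |M i j| ≤ C) : M.det ^ 2 ≤ (k * C ^ 2) ^ k := by
  rcases Nat.eq_zero_or_pos k with rfl | hk
  · simp
  have hk' : (0 : ℝ) < k := by exact_mod_cast hk
  have hs : 0 < k * C ^ 2 := by positivity
  set c := (Real.sqrt (k * C ^ 2))⁻¹ with hc
  have hc2 : c ^ 2 = (k * C ^ 2)⁻¹ := by rw [hc, inv_pow, Real.sq_sqrt hs.le]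
  have h := norm_det_sq_le_exp (c • M)
  have h1 : ∑ i, ∑ j, ‖(c • M) i j‖ ^ 2 ≤ Fintype.card (Fin k) := by
    calc ∑ i, ∑ j, ‖(c • M) i j‖ ^ 2 ≤ ∑ i : Fin k, ∑ j : Fin k, c ^ 2 * C ^ 2 := by
          refine Finset.sum_le_sum fun i _ => Finset.sum_le_sum fun j _ => ?_
          rw [Matrix.smul_apply, smul_eq_mul, norm_mul, mul_pow, Real.norm_eq_abs, sq_abs,
            Real.norm_eq_abs]
          exact mul_le_mul_of_nonneg_left (pow_le_pow_left₀ (abs_nonneg _) (hM i j) 2)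
            (sq_nonneg c)
      _ = _ := by
          simp only [Finset.sum_const, Finset.card_univ, Fintype.card_fin, nsmul_eq_mul, hc2]
          field_simp
  have h2 : ‖(c • M).det‖ ^ 2 ≤ 1 := h.trans (Real.exp_le_one_iff.2 (by linarith))
  rw [Matrix.det_smul, Fintype.card_fin, norm_mul, mul_pow, norm_pow, ← pow_mul, mul_comm k 2,
    pow_mul, Real.norm_eq_abs c, sq_abs, hc2, inv_pow, Real.norm_eq_abs, sq_abs,
    inv_mul_le_iff₀ (by positivity), mul_one] at h2
  exact h2

/-- The summable majorant of the Fredholm series. -/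
noncomputable def fredholmBound (C : ℝ) (k : ℕ) : ℝ :=
  ((1 / 4) ^ k + (4 * (Real.exp 1 * C ^ 2)) ^ k / k.factorial) / 2

theorem summable_fredholmBound (C : ℝ) : Summable (fredholmBound C) :=
  ((summable_geometric_of_lt_one (by norm_num) (by norm_num)).add
    (Real.summable_pow_div_factorial _)).div_const 2

/-- From k^k ≤ e^k k!, the square of the quotient y is at most (eC²)^k/k!. Then 2y ≤ 4^(-k) + 4^k y²
gives a summable majorant without square roots. -/
theorem abs_div_factorial_le {k : ℕ} {x C : ℝ} (h : x ^ 2 ≤ (k * C ^ 2) ^ k) :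
    |x| / k.factorial ≤ fredholmBound C k := by
  have hf : (0 : ℝ) < k.factorial := by exact_mod_cast k.factorial_pos
  have h1 : (k : ℝ) ^ k ≤ Real.exp 1 ^ k * k.factorial := by
    have := Real.pow_div_factorial_le_exp k (Nat.cast_nonneg k) k
    rwa [div_le_iff₀ hf, ← mul_one (k : ℝ), Real.exp_nat_mul, mul_one] at this
  have h2 : (x / k.factorial) ^ 2 ≤ (Real.exp 1 * C ^ 2) ^ k / k.factorial := by
    rw [div_pow, div_le_div_iff₀ (by positivity) hf]
    calc x ^ 2 * k.factorial ≤ ((k * C ^ 2) ^ k) * k.factorial := by gcongr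
      _ = (k : ℝ) ^ k * ((C ^ 2) ^ k * k.factorial) := by rw [mul_pow]; ring
      _ ≤ Real.exp 1 ^ k * k.factorial * ((C ^ 2) ^ k * k.factorial) := by gcongr
      _ = _ := by rw [mul_pow]; ring
  have e : |x| / k.factorial = |x / k.factorial| := by rw [abs_div, abs_of_pos hf]
  rw [e, fredholmBound]
  set y := |x / k.factorial| with hy
  have hy2 : y ^ 2 = (x / k.factorial) ^ 2 := sq_abs _
  have h3 : (0 : ℝ) ≤ ((1 / 2) ^ k - 2 ^ k * y) ^ 2 := sq_nonneg _
  have h4 : ((1 / 2 : ℝ) ^ k - 2 ^ k * y) ^ 2 = (1 / 4) ^ k + 4 ^ k * y ^ 2 - 2 * y := by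
    have e1 : ((1 / 2 : ℝ) ^ k) ^ 2 = (1 / 4) ^ k := by rw [← pow_mul, mul_comm, pow_mul]; norm_num
    have e2 : ((2 : ℝ) ^ k) ^ 2 = 4 ^ k := by rw [← pow_mul, mul_comm, pow_mul]; norm_num
    have e3 : (1 / 2 : ℝ) ^ k * 2 ^ k = 1 := by rw [← mul_pow]; norm_num
    rw [sub_sq, mul_pow, e1, e2]
    linear_combination (-2 * y) * e3
  have h5 : 4 ^ k * y ^ 2 ≤ (4 * (Real.exp 1 * C ^ 2)) ^ k / k.factorial := by
    rw [hy2, mul_pow (4 : ℝ), mul_div_assoc]; gcongr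
  linarith

/-- The sum of the principal minors of size `k`, as a sum over all index maps. -/
theorem sum_minors_eq {R : Type*} [CommRing R] {n : ℕ} (M : Matrix (Fin n) (Fin n) R) (k : ℕ) :
    ∑ f : Fin k → Fin n, (M.submatrix f f).det = k.factorial •
      ∑ s ∈ Finset.univ.powersetCard k,
        (M.submatrix (Subtype.val : s → Fin n) (Subtype.val : s → Fin n)).det := by
  classical
  have h1 : ∑ f : Fin k → Fin n, (M.submatrix f f).det =
      ∑ f : Fin k → Fin n with Function.Injective f, (M.submatrix f f).det := by
    refine (Finset.sum_filter_of_ne fun f _ hf => ?_).symm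
    by_contra hinj
    simp only [Function.Injective, not_forall] at hinj
    obtain ⟨i, j, hij, hne⟩ := hinj
    -- A repeated index gives a repeated row. Injective maps are then grouped by their image, each
    -- subset being enumerated in k! ways.
    refine hf (Matrix.det_zero_of_row_eq hne ?_)
    ext l; simp [hij]
  rw [h1, ← Finset.sum_fiberwise_of_maps_to (t := Finset.univ.powersetCard k)
    (g := fun f => Finset.univ.image f) (fun f hf => by
      simp only [Finset.mem_filter, Finset.mem_univ, true_and] at hf
      simp [Finset.mem_powersetCard, Finset.card_image_of_injective _ hf]), Finset.smul_sum]
  refine Finset.sum_congr rfl fun s hs => ?_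
  have hcard : Fintype.card (Fin k) = Fintype.card s := by
    simp [(Finset.mem_powersetCard.1 hs).2]
  have hfac : k.factorial = Fintype.card (Fin k ≃ s) := by
    rw [Fintype.card_equiv (Fintype.equivOfCardEq hcard), Fintype.card_fin]
  rw [hfac, ← Finset.card_univ (α := Fin k ≃ s), ← Finset.sum_const]
  symm
  refine Finset.sum_bij (fun e _ => fun i => ((e i : s) : Fin n)) (fun e _ => ?_)
    (fun e _ e' _ h => ?_) (fun f hf => ?_) (fun e _ => ?_)
  · simp only [Finset.mem_filter, Finset.mem_univ, true_and]
    refine ⟨Subtype.val_injective.comp e.injective, ?_⟩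
    ext x
    simp only [Finset.mem_image, Finset.mem_univ, true_and]
    constructor
    · rintro ⟨i, rfl⟩; exact (e i).2
    · intro hx; exact ⟨e.symm ⟨x, hx⟩, by simp⟩
  · ext i; exact congrArg Fin.val (congrFun h i)
  · simp only [Finset.mem_filter, Finset.mem_univ, true_and] at hf
    have hmem : ∀ i, f i ∈ s := fun i => by
      rw [← hf.2]; exact Finset.mem_image_of_mem _ (Finset.mem_univ i)
    refine ⟨Equiv.ofBijective (fun i => ⟨f i, hmem i⟩)
      ((Fintype.bijective_iff_injective_and_card _).2 ⟨fun i j h => hf.1 ?_, hcard⟩),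
      Finset.mem_univ _, ?_⟩
    · exact congrArg Subtype.val h
    · ext i; rfl
  · rw [← Matrix.det_submatrix_equiv_self e]; rfl

/-- Expansion in principal minors. The finite sum is written as a series so that the index set does
not depend on n. -/
theorem det_one_add_smul_eq_tsum {n : ℕ} (M : Matrix (Fin n) (Fin n) ℝ) (x : ℝ) :
    (1 + x • M).det = ∑' k : ℕ, x ^ k *
      (∑ f : Fin k → Fin n, (M.submatrix f f).det) / k.factorial := by
  set P : ℝ[X] := (1 + (X : ℝ[X]) • M.map C).det with hP
  have h1 : (1 + x • M).det = P.eval x := by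
    rw [hP, ← coe_evalRingHom, RingHom.map_det]
    congr 1
    ext i j
    simp only [RingHom.mapMatrix_apply, Matrix.map_apply, Matrix.add_apply, Matrix.smul_apply,
      Matrix.one_apply, smul_eq_mul, map_add, coe_evalRingHom]
    split_ifs <;> simp [mul_comm (M i j)]
  have h2 : ∀ k : ℕ, x ^ k * (∑ f : Fin k → Fin n, (M.submatrix f f).det) / k.factorial =
      P.coeff k * x ^ k := by
    intro k
    have hf : (k.factorial : ℝ) ≠ 0 := by exact_mod_cast k.factorial_ne_zero
    rw [hP, Matrix.coeff_det_one_add_X_smul_eq_sum_minors, sum_minors_eq, nsmul_eq_mul]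
    field_simp
  rw [h1, tsum_congr h2, eval_eq_sum_range, tsum_eq_sum]
  intro k hk
  rw [coeff_eq_zero_of_natDegree_lt (by simpa using hk), zero_mul]

/-- The index of the cell of the partition of `(0, 1]` into `n` parts that contains `u`. -/
noncomputable def cellIndex (n : ℕ) (u : ℝ) : ℕ := ⌈n * u⌉₊ - 1

theorem cellIndex_lt {n : ℕ} (hn : 0 < n) {u : ℝ} (hu : u ≤ 1) : cellIndex n u < n := by
  have : ⌈n * u⌉₊ ≤ n := Nat.ceil_le.2 (by
    have : (0 : ℝ) ≤ n := Nat.cast_nonneg n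
    nlinarith)
  rw [cellIndex]; omega

theorem tendsto_cellIndex_div {u : ℝ} (hu : 0 < u) :
    Tendsto (fun n : ℕ => (cellIndex n u : ℝ) / n) atTop (𝓝 u) := by
  have h1 : Tendsto (fun n : ℕ => u - 1 / (n : ℝ)) atTop (𝓝 u) := by
    simpa using (tendsto_const_nhds (x := u)).sub (tendsto_one_div_atTop_nhds_zero_nat (𝕜 := ℝ))
  refine tendsto_of_tendsto_of_tendsto_of_le_of_le' h1 tendsto_const_nhds ?_ ?_
  all_goals
    filter_upwards [eventually_gt_atTop 0] with n hn
    have hn' : (0 : ℝ) < n := by exact_mod_cast hn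
    have hc : 0 < ⌈(n : ℝ) * u⌉₊ := Nat.ceil_pos.2 (by positivity)
    have e : (cellIndex n u : ℝ) = ⌈(n : ℝ) * u⌉₊ - 1 := by
      rw [cellIndex, Nat.cast_sub (by omega), Nat.cast_one]
    rw [e]
  · rw [le_div_iff₀ hn', sub_mul, one_div_mul_cancel hn'.ne']
    linarith [Nat.le_ceil ((n : ℝ) * u)]
  · rw [div_le_iff₀ hn']
    linarith [Nat.ceil_lt_add_one (show 0 ≤ (n : ℝ) * u by positivity)]

theorem cellIndex_eq_of_mem {n j : ℕ} (hn : 0 < n) {u : ℝ}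
    (hu : u ∈ Ioc ((j : ℝ) / n) ((j + 1) / n)) : cellIndex n u = j := by
  have hn' : (0 : ℝ) < n := by exact_mod_cast hn
  have h1 := (div_lt_iff₀' hn').1 hu.1
  have h2 := (le_div_iff₀' hn').1 hu.2
  have : ⌈(n : ℝ) * u⌉₊ = j + 1 := (Nat.ceil_eq_iff (by omega)).2 (by
    rw [Nat.add_sub_cancel]; push_cast; exact ⟨h1, h2⟩)
  rw [cellIndex, this]; rfl

theorem mem_cell_cellIndex {n : ℕ} (hn : 0 < n) {u : ℝ} (hu : 0 < u) :
    u ∈ Ioc ((cellIndex n u : ℝ) / n) ((cellIndex n u + 1) / n) := by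
  have hn' : (0 : ℝ) < n := by exact_mod_cast hn
  have hc : 0 < ⌈(n : ℝ) * u⌉₊ := Nat.ceil_pos.2 (by positivity)
  have e : (cellIndex n u : ℝ) = ⌈(n : ℝ) * u⌉₊ - 1 := by
    rw [cellIndex, Nat.cast_sub (by omega), Nat.cast_one]
  rw [e]
  constructor
  · rw [div_lt_iff₀ hn']
    linarith [Nat.ceil_lt_add_one (show 0 ≤ (n : ℝ) * u by positivity)]
  · rw [le_div_iff₀ hn']
    linarith [Nat.le_ceil ((n : ℝ) * u)]

theorem measurable_cellIndex (n : ℕ) : Measurable (cellIndex n) :=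
  (measurable_from_top (f := fun m : ℕ => m - 1)).comp
    (Nat.measurable_ceil.comp (measurable_const.mul measurable_id))

/-- The integrand is constant on the n^k cells of the cube, each of volume n^(-k). Sums over growing
index sets become integrals over a fixed domain, to which dominated convergence applies. -/
theorem sum_fin_eq_integral {n : ℕ} (hn : 0 < n) (k : ℕ) (G : (Fin k → ℕ) → ℝ) :
    (n : ℝ)⁻¹ ^ k * ∑ f : Fin k → Fin n, G (fun p => f p) =
      ∫ u in Set.univ.pi fun _ : Fin k => Ioc (0 : ℝ) 1, G fun p => cellIndex n (u p) := by
  have hn' : (0 : ℝ) < n := by exact_mod_cast hn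
  set S : (Fin k → Fin n) → Set (Fin k → ℝ) := fun f =>
    Set.univ.pi fun p => Ioc (((f p : ℕ) : ℝ) / n) (((f p : ℕ) + 1) / n) with hS
  have hcell : ∀ f, ∀ u ∈ S f, (fun p => cellIndex n (u p)) = fun p => (f p : ℕ) := by
    intro f u hu
    funext p
    exact cellIndex_eq_of_mem hn (hu p (mem_univ p))
  have hU : (Set.univ.pi fun _ : Fin k => Ioc (0 : ℝ) 1) = ⋃ f, S f := by
    ext u
    simp only [mem_iUnion, hS, mem_univ_pi]
    constructor
    · intro hu
      exact ⟨fun p => ⟨cellIndex n (u p), cellIndex_lt hn (hu p).2⟩,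
        fun p => mem_cell_cellIndex hn (hu p).1⟩
    · rintro ⟨f, hf⟩ p
      refine ⟨lt_of_le_of_lt (by positivity) (hf p).1, (hf p).2.trans ?_⟩
      rw [div_le_one hn']
      exact_mod_cast (f p).2
  have hSm : ∀ f, MeasurableSet (S f) := fun f =>
    MeasurableSet.univ_pi fun p => measurableSet_Ioc
  have hvol : ∀ f, volume.real (S f) = (n : ℝ)⁻¹ ^ k := by
    intro f
    rw [Measure.real, hS, Real.volume_pi_Ioc, ENNReal.toReal_prod]
    simp only [add_div, add_sub_cancel_left, one_div]
    rw [Finset.prod_const, Finset.card_univ, Fintype.card_fin,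
      ENNReal.toReal_ofReal (by positivity)]
  have hcongr : ∀ f, ∀ u ∈ S f, G (fun p => cellIndex n (u p)) = G (fun p => (f p : ℕ)) :=
    fun f u hu => by rw [hcell f u hu]
  have hfin : ∀ f, volume (S f) ≠ ⊤ := fun f => by
    rw [hS, Real.volume_pi_Ioc]
    exact ENNReal.prod_ne_top fun _ _ => ENNReal.ofReal_ne_top
  rw [hU, integral_iUnion_fintype hSm ?_ ?_, Finset.mul_sum]
  · refine Finset.sum_congr rfl fun f _ => ?_
    rw [setIntegral_congr_fun (hSm f) (hcongr f), setIntegral_const, hvol, smul_eq_mul]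
  · intro f g hfg
    refine Set.disjoint_left.2 fun u hu hu' => hfg ?_
    have := (hcell f u hu).symm.trans (hcell g u hu')
    funext p
    exact Fin.ext (congrFun this p)
  · intro f
    exact (integrableOn_const (hfin f)).congr_fun (fun u hu => (hcongr f u hu).symm) (hSm f)

/-- Convergence of determinants to a Fredholm determinant. -/
theorem exists_tendsto_det_one_add {K : ℕ → ℕ → ℕ → ℝ} {C : ℝ} (hC : 0 < C)
    (hb : ∀ᶠ n in atTop, ∀ i j, i < n → j < n → |K n i j| ≤ C)
    (hlim : ∀ u ∈ Ioc (0 : ℝ) 1, ∀ v ∈ Ioc (0 : ℝ) 1, ∃ l,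
      Tendsto (fun n => K n (cellIndex n u) (cellIndex n v)) atTop (𝓝 l)) :
    ∃ l, Tendsto (fun n : ℕ =>
      (1 + (n : ℝ)⁻¹ • Matrix.of fun i j : Fin n => K n i j).det) atTop (𝓝 l) := by
  choose! Λ hΛ using hlim
  have hdet : ∀ᶠ n in atTop, ∀ (k : ℕ) (f : Fin k → ℕ), (∀ p, f p < n) →
      (Matrix.of fun p q : Fin k => K n (f p) (f q)).det ^ 2 ≤ (k * C ^ 2) ^ k := by
    filter_upwards [hb] with n hn k f hf
    exact det_sq_le_of_bound hC fun i j => hn _ _ (hf i) (hf j)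
  set cube : (k : ℕ) → Set (Fin k → ℝ) := fun k => Set.univ.pi fun _ => Ioc (0 : ℝ) 1
  have hcube : ∀ k, volume.real (cube k) = 1 := fun k => by
    rw [Measure.real, Real.volume_pi_Ioc, ENNReal.toReal_prod]; simp
  have hcubet : ∀ k, volume (cube k) ≠ ⊤ := fun k => by
    rw [Real.volume_pi_Ioc]
    exact ENNReal.prod_ne_top fun _ _ => ENNReal.ofReal_ne_top
  have hcubem : ∀ k, MeasurableSet (cube k) := fun k =>
    MeasurableSet.univ_pi fun p => measurableSet_Ioc
  have hrew : ∀ᶠ n : ℕ in atTop, ∑' k : ℕ, (∫ u in cube k, (Matrix.of fun p q : Fin k =>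
      K n (cellIndex n (u p)) (cellIndex n (u q))).det) / k.factorial =
      (1 + (n : ℝ)⁻¹ • Matrix.of fun i j : Fin n => K n i j).det := by
    filter_upwards [eventually_gt_atTop 0] with n hn
    rw [det_one_add_smul_eq_tsum]
    refine tsum_congr fun k => ?_
    rw [← sum_fin_eq_integral hn k (fun f => (Matrix.of fun p q : Fin k => K n (f p) (f q)).det)]
    rfl
  have hae : ∀ k, ∀ᶠ n : ℕ in atTop, ∀ u ∈ cube k, ‖(Matrix.of fun p q : Fin k =>
      K n (cellIndex n (u p)) (cellIndex n (u q))).det‖ ≤ fredholmBound C k * k.factorial := by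
    intro k
    filter_upwards [hdet, eventually_gt_atTop 0] with n hn hn0 u hu
    rw [Real.norm_eq_abs, ← div_le_iff₀ (by exact_mod_cast k.factorial_pos)]
    exact abs_div_factorial_le (hn k _ fun p => cellIndex_lt hn0 (hu p (mem_univ p)).2)
  -- Dominated convergence is used twice, in the series over k and inside each integral, with the
  -- same Hadamard majorant.
  have key := tendsto_tsum_of_dominated_convergence (𝓕 := atTop)
    (f := fun (n : ℕ) (k : ℕ) => (∫ u in cube k, (Matrix.of fun p q : Fin k =>
      K n (cellIndex n (u p)) (cellIndex n (u q))).det) / k.factorial)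
    (g := fun k => (∫ u in cube k, (Matrix.of fun p q : Fin k => Λ (u p) (u q)).det) /
      k.factorial) (summable_fredholmBound C) (fun k => ?_) ?_
  · exact ⟨_, key.congr' hrew⟩
  · refine Tendsto.div_const ?_ _
    refine tendsto_integral_filter_of_dominated_convergence
      (fun _ => fredholmBound C k * k.factorial) (Eventually.of_forall fun n => ?_) ?_
      (integrableOn_const (hcubet k)) ?_
    · refine Measurable.aestronglyMeasurable ?_
      have hm : Measurable fun u : Fin k → ℝ => fun p => cellIndex n (u p) :=
        measurable_pi_lambda _ fun p => (measurable_cellIndex n).comp (measurable_pi_apply p)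
      exact (measurable_of_countable (fun f : Fin k → ℕ =>
        (Matrix.of fun p q : Fin k => K n (f p) (f q)).det)).comp hm
    · filter_upwards [hae k] with n hn
      filter_upwards [ae_restrict_mem (hcubem k)] with u hu using hn u hu
    · filter_upwards [ae_restrict_mem (hcubem k)] with u hu
      have hc : Continuous fun M : Matrix (Fin k) (Fin k) ℝ => M.det := continuous_id.matrix_det
      refine (hc.tendsto _).comp (tendsto_pi_nhds.2 fun p => tendsto_pi_nhds.2 fun q => ?_)
      exact hΛ _ (hu p (mem_univ p)) _ (hu q (mem_univ q))
  · filter_upwards [hdet, eventually_gt_atTop 0] with n hn hn0 k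
    have hf : (0 : ℝ) < k.factorial := by exact_mod_cast k.factorial_pos
    rw [norm_div, Real.norm_of_nonneg hf.le, div_le_iff₀ hf]
    refine (norm_setIntegral_le_of_norm_le_const (lt_top_iff_ne_top.2 (hcubet k))
      (C := fredholmBound C k * k.factorial) fun u hu => ?_).trans
      (by rw [hcube, mul_one])
    rw [Real.norm_eq_abs, ← div_le_iff₀ hf]
    exact abs_div_factorial_le (hn k _ fun p => cellIndex_lt hn0 (hu p (mem_univ p)).2)

end fredholm

/-! ### The Hankel determinant in the hard-edge scaling -/

section edge_determinant

variable {α β γ A B : ℝ}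

theorem stepPower_div {N : ℝ} (hN : 0 < N) (u : ℝ) :
    stepPower γ A B (u / N) = stepPower γ A B u / N ^ γ := by
  rcases lt_or_ge 0 u with h | h
  · rw [stepPower_of_pos h, stepPower_of_pos (by positivity), Real.div_rpow h.le hN.le,
      mul_div_assoc]
  · rw [stepPower_of_nonpos h, stepPower_of_nonpos (div_nonpos_of_nonpos_of_nonneg h hN.le),
      ← neg_div, Real.div_rpow (by linarith) hN.le, mul_div_assoc]

/-- The perturbation matrix in the orthonormal basis of Jacobi polynomials. -/
noncomputable def edgeEntry (α β γ A B : ℝ) (τ : ℝ) (n j k : ℕ) : ℝ :=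
  edgeKernel α β γ A B ((n : ℝ) ^ 2) (edgePoly (α + γ) β n j * edgePoly (α + γ) β n k) τ

/-- The Hankel determinant in the hard-edge scaling, normalised to be `1` at `τ = 0`. -/
noncomputable def edgeDet (α β γ A B : ℝ) (n : ℕ) (τ : ℝ) : ℝ :=
  (1 + (n : ℝ)⁻¹ • Matrix.of fun j k : Fin n => edgeEntry α β γ A B τ n j k).det

/-- After x = y/n² the weight is, up to constants, the Jacobi weight with parameters α+γ, β plus the
perturbation `edgeDiff`. Orthogonality turns the first part into n times the identity. -/
theorem jacobiL_mul_eq_edgeEntry (hα : 0 < α) (hβ : 0 < β) (hγ : 0 < γ) (hAB : 0 < A + B)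
    {n : ℕ} (hn : 0 < n) (τ : ℝ) (j k : ℕ) :
    jacobiL A B hα hβ hγ (τ / (n : ℝ) ^ 2)
      ((C (edgeScale (α + γ) β n j)⁻¹ * jacPoly (α + γ) β j) *
        (C (edgeScale (α + γ) β n k)⁻¹ * jacPoly (α + γ) β k)) =
      (A + B) / ((n : ℝ) ^ 2) ^ (α + γ + 1) *
        ((if j = k then (n : ℝ) else 0) + edgeEntry α β γ A B τ n j k) := by
  have hn' : (0 : ℝ) < n := by exact_mod_cast hn
  set N : ℝ := (n : ℝ) ^ 2 with hN
  have hN0 : 0 < N := by positivity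
  set P : ℝ[X] := edgePoly (α + γ) β n j * edgePoly (α + γ) β n k with hP
  have hw := continuous_one_sub_div_rpow hβ N
  have i1 : IntervalIntegrable (fun y => P.eval y * (y ^ (α + γ) * (1 - y / N) ^ β)) volume 0 N :=
    (P.continuous.mul ((continuous_id.rpow_const fun _ => Or.inr (add_pos hα hγ).le).mul
      hw)).intervalIntegrable _ _
  have i2 : IntervalIntegrable (fun y => P.eval y * (1 - y / N) ^ β * edgeDiff α γ A B τ y)
      volume 0 N :=
    ((P.continuous.mul hw).mul (continuous_edgeDiff hα hγ τ)).intervalIntegrable _ _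
  rw [← integral_edgePoly_orthonormal (add_pos hα hγ).le hβ.le hn, edgeEntry, edgeKernel, ← hN,
    ← hP, ← intervalIntegral.integral_add i1 i2, jacobiL, weightFunctional_apply]
  have h := intervalIntegral.integral_comp_div (a := 0) (b := N) (fun x =>
    ((C (edgeScale (α + γ) β n j)⁻¹ * jacPoly (α + γ) β j) *
      (C (edgeScale (α + γ) β n k)⁻¹ * jacPoly (α + γ) β k)).eval x *
      jacobiWeight α β γ A B x (τ / N)) hN0.ne'
  rw [zero_div, div_self hN0.ne', smul_eq_mul] at h
  rw [← mul_right_inj' hN0.ne', ← h, ← intervalIntegral.integral_const_mul,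
    ← intervalIntegral.integral_const_mul]
  refine intervalIntegral_congr_Ioo hN0.le fun y hy => ?_
  have e : ((C (edgeScale (α + γ) β n j)⁻¹ * jacPoly (α + γ) β j) *
      (C (edgeScale (α + γ) β n k)⁻¹ * jacPoly (α + γ) β k)).eval (y / N) = P.eval y := by
    rw [hP, eval_mul, eval_mul (p := edgePoly _ _ _ _), eval_edgePoly, eval_edgePoly]; simp [hN]
  rw [e, jacobiWeight_eq, baseWeight, ← sub_div, stepPower_div hN0, edgeDiff,
    Real.div_rpow hy.1.le hN0.le, Real.rpow_add_one hN0.ne', Real.rpow_add hN0]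
  field_simp
  ring

/-- The constant does not depend on τ and so disappears from the logarithmic derivative. -/
theorem exists_hankelDet_eq_mul_edgeDet (hα : 0 < α) (hβ : 0 < β) (hγ : 0 < γ) (hAB : 0 < A + B)
    {n : ℕ} (hn : 0 < n) :
    ∃ c : ℝ, 0 < c ∧ ∀ τ, hankelDet α β γ A B n (τ / (n : ℝ) ^ 2) =
      c * edgeDet α β γ A B n τ := by
  have hn' : (0 : ℝ) < n := by exact_mod_cast hn
  set q : ℕ → ℝ[X] := fun j => C (edgeScale (α + γ) β n j)⁻¹ * jacPoly (α + γ) β j with hq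
  have ha := (add_pos hα hγ).le
  have hs : ∀ j, (edgeScale (α + γ) β n j)⁻¹ ≠ 0 := fun j =>
    inv_ne_zero (edgeScale_pos ha hβ.le hn j).ne'
  have hdeg : ∀ i, (q i).degree < (i + 1 : ℕ) := fun i => by
    simp only [hq]
    rw [degree_C_mul (hs i)]; exact degree_jacPoly_lt _ _ _
  set κ := ∏ i : Fin n, (q i).coeff i with hκ
  have hκ0 : 0 < κ ^ 2 := by
    refine sq_pos_of_ne_zero ?_
    exact Finset.prod_ne_zero_iff.2 fun i _ => by
      simp only [hq, coeff_C_mul, coeff_jacPoly]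
      exact mul_ne_zero (hs i) (jacCoeff_self_ne_zero ha hβ.le i)
  set μ : ℝ := (A + B) / ((n : ℝ) ^ 2) ^ (α + γ + 1) * n with hμ
  have hμ0 : 0 < μ := by positivity
  refine ⟨μ ^ n / κ ^ 2, by positivity, fun τ => ?_⟩
  have h := det_functional_of_triangular (jacobiL A B hα hβ hγ (τ / (n : ℝ) ^ 2)) n q hdeg
  rw [← hankelDet_eq_det hα hβ hγ, ← hκ] at h
  have hm : (Matrix.of fun i j : Fin n => jacobiL A B hα hβ hγ (τ / (n : ℝ) ^ 2) (q i * q j)) =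
      μ • (1 + (n : ℝ)⁻¹ • Matrix.of fun j k : Fin n => edgeEntry α β γ A B τ n j k) := by
    ext i j
    simp only [Matrix.of_apply, Matrix.smul_apply, Matrix.add_apply, smul_eq_mul, Matrix.one_apply,
      hq]
    rw [jacobiL_mul_eq_edgeEntry hα hβ hγ hAB hn, hμ]
    simp only [Fin.ext_iff]
    split_ifs
    · field_simp
    · field_simp; simp
  rw [hm, Matrix.det_smul, Fintype.card_fin] at h
  rw [edgeDet, div_mul_eq_mul_div, h, mul_div_cancel_left₀ _ hκ0.ne']

theorem edgeDet_zero (hAB : 0 < A + B) (n : ℕ) :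
    edgeDet α β γ A B n 0 = 1 := by
  have h : ∀ j k, edgeEntry α β γ A B 0 n j k = 0 := by
    intro j k
    rw [edgeEntry, edgeKernel]
    refine (intervalIntegral_congr_Ioo (by positivity) fun y hy => ?_).trans
      intervalIntegral.integral_zero
    rw [edgeDiff, sub_zero, stepPower_of_pos hy.1, Real.rpow_add hy.1]
    field_simp; ring
  have h0 : (Matrix.of fun j k : Fin n => edgeEntry α β γ A B 0 n j k) = 0 := by
    ext j k; exact h j k
  rw [edgeDet, h0, smul_zero, add_zero, Matrix.det_one]

theorem hankelDet_zero (hα : 0 < α) (hβ : 0 < β) (hγ : 0 < γ) (n : ℕ) :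
    hankelDet α β γ A B n 0 = (A + B) ^ n * ∏ k ∈ Finset.range n,
      opNorm (betaFunctional (α + γ) β (by linarith) (by linarith)) k := by
  rw [hankelDet_eq_det hα hβ hγ, ← det_functional_eq_prod
    (isPosFunctional_betaFunctional (by linarith) (by linarith)) n]
  have h : jacobiL A B hα hβ hγ 0 =
      (A + B) • betaFunctional (α + γ) β (by linarith) (by linarith) := by
    ext i
    simp only [LinearMap.comp_apply, LinearMap.smul_apply, jacobiL, betaFunctional,
      weightFunctional_apply, smul_eq_mul]
    rw [← intervalIntegral.integral_const_mul]
    refine intervalIntegral_congr_Ioo zero_le_one fun x hx => ?_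
    rw [jacobiWeight_eq, baseWeight, baseWeight, sub_zero, stepPower_of_pos hx.1,
      Real.rpow_add hx.1]
    ring
  rw [h]
  have e : (Matrix.of fun i j : Fin n => ((A + B) • betaFunctional (α + γ) β (by linarith)
      (by linarith)) (X ^ ((i : ℕ) + (j : ℕ)))) = (A + B) • (Matrix.of fun i j : Fin n =>
      (betaFunctional (α + γ) β (by linarith) (by linarith)) (X ^ ((i : ℕ) + (j : ℕ)))) := by
    ext i j; rfl
  rw [e, Matrix.det_smul, Fintype.card_fin]

/-- Restrict the norm to [t, 1], where x^α ≥ (x-t)^α, and map [0, 1] affinely onto [t, 1]. The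
weight becomes the Jacobi weight, and making the rescaled polynomial monic costs (1-t)^(2k); the
minimality `opNorm_le` concludes. -/
theorem le_opNorm_jacobiL (hα : 0 < α) (hβ : 0 < β) (hγ : 0 < γ) (hA : 0 ≤ A) (hAB : 0 < A + B)
    {t : ℝ} (ht : t ∈ Ioo (0 : ℝ) 1) (k : ℕ) :
    (A + B) * (1 - t) ^ (α + β + γ + 1 + 2 * k) *
      opNorm (betaFunctional (α + γ) β (by linarith) (by linarith)) k ≤
    opNorm (jacobiL A B hα hβ hγ t) k := by
  set q := monicOP (jacobiL A B hα hβ hγ t) k with hq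
  have hs : 0 < 1 - t := by linarith [ht.2]
  set Q : ℝ[X] := C ((1 - t) ^ k)⁻¹ * q.comp (C (1 - t) * X + C t) with hQ
  have hqm : q.Monic := monicOP_monic _ _
  have hqd : q.natDegree = k := natDegree_monicOP _ _
  have hlin : (C (1 - t) * X + C t : ℝ[X]).natDegree = 1 := natDegree_linear hs.ne'
  have hcd : (q.comp (C (1 - t) * X + C t)).natDegree = k := by
    rw [natDegree_comp, hlin, hqd, mul_one]
  have hQd : Q.natDegree = k := by
    rw [hQ, natDegree_C_mul (by positivity), hcd]
  have hQm : Q.Monic := by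
    rw [Monic, hQ, leadingCoeff_mul, leadingCoeff_C, leadingCoeff_comp (by rw [hlin]; simp),
      leadingCoeff_linear hs.ne', hqm.leadingCoeff, hqd, one_mul, inv_mul_cancel₀ (by positivity)]
  have h1 := opNorm_le (isPosFunctional_betaFunctional (a := α + γ) (b := β) (by linarith)
    (by linarith)) hQm hQd
  have h2 : opNorm (jacobiL A B hα hβ hγ t) k = jacobiL A B hα hβ hγ t (q * q) := rfl
  rw [h2]
  refine (mul_le_mul_of_nonneg_left h1 (by positivity)).trans ?_
  simp only [betaFunctional, jacobiL, weightFunctional_apply]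
  have hint : ∀ l r : ℝ, IntervalIntegrable (fun x => (q * q).eval x *
      ((A + B) * ((x - t) ^ (α + γ) * (1 - x) ^ β))) volume l r := fun l r =>
    (((q * q).continuous).mul (continuous_const.mul
      (((continuous_id.sub continuous_const).rpow_const fun _ => Or.inr (add_pos hα hγ).le).mul
      ((continuous_const.sub continuous_id).rpow_const fun _ => Or.inr hβ.le)))).intervalIntegrable
        _ _
  have hint' : IntervalIntegrable (fun x => (q * q).eval x * jacobiWeight α β γ A B x t)
      volume 0 1 :=
    (intervalIntegrable_jacobiWeight hα hβ hγ t).continuousOn_mul (q * q).continuous.continuousOn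
  have hsub : IntervalIntegrable (fun x => (q * q).eval x * jacobiWeight α β γ A B x t)
      volume t 1 := hint'.mono_set (by
    rw [uIcc_of_le ht.2.le, uIcc_of_le zero_le_one]; exact Icc_subset_Icc_left ht.1.le)
  have hsq : ∀ x, 0 ≤ (q * q).eval x := fun x => by rw [eval_mul]; exact mul_self_nonneg _
  calc _ = ∫ x in t..1, (q * q).eval x * ((A + B) * ((x - t) ^ (α + γ) * (1 - x) ^ β)) := by
        have h := intervalIntegral.mul_integral_comp_mul_add (a := 0) (b := 1) (f := fun x =>
          (q * q).eval x * ((A + B) * ((x - t) ^ (α + γ) * (1 - x) ^ β))) (1 - t) t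
        rw [mul_zero, zero_add, mul_one, sub_add_cancel] at h
        rw [← h, ← intervalIntegral.integral_const_mul, ← intervalIntegral.integral_const_mul]
        refine intervalIntegral_congr_Ioo zero_le_one fun z hz => ?_
        have e1 : (1 - t) * z + t - t = (1 - t) * z := by ring
        have e2 : 1 - ((1 - t) * z + t) = (1 - t) * (1 - z) := by ring
        have e3 : (1 - t) ^ (α + β + γ + 1 + 2 * k) =
            (1 - t) * ((1 - t) ^ (α + γ) * (1 - t) ^ β) * ((1 - t) ^ k) ^ 2 := by
          rw [show α + β + γ + 1 + 2 * (k : ℝ) = (α + γ) + β + 1 + ((k * 2 : ℕ) : ℝ) by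
            push_cast; ring, Real.rpow_add hs, Real.rpow_natCast, Real.rpow_add_one hs.ne',
            Real.rpow_add hs, pow_mul]
          ring
        rw [e1, e2, Real.mul_rpow hs.le hz.1.le, Real.mul_rpow hs.le (by linarith [hz.2]), e3,
          baseWeight, hQ]
        simp only [eval_mul, eval_C, eval_comp, eval_add, eval_X]
        field_simp
    _ ≤ ∫ x in t..1, (q * q).eval x * jacobiWeight α β γ A B x t := by
        refine intervalIntegral.integral_mono_on_of_le_Ioo ht.2.le (hint _ _) hsub fun x hx => ?_
        refine mul_le_mul_of_nonneg_left ?_ (hsq x)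
        have h1 : 0 < x - t := by linarith [hx.1]
        have h2 : 0 ≤ 1 - x := by linarith [hx.2]
        rw [jacobiWeight_eq, baseWeight, stepPower_of_pos h1, Real.rpow_add h1]
        have h3 : (x - t) ^ α ≤ x ^ α := Real.rpow_le_rpow h1.le (by linarith [ht.1]) hα.le
        calc _ = (A + B) * (x - t) ^ γ * (1 - x) ^ β * (x - t) ^ α := by ring
          _ ≤ (A + B) * (x - t) ^ γ * (1 - x) ^ β * x ^ α := by gcongr
          _ = _ := by ring
    _ ≤ _ := by
        refine intervalIntegral.integral_mono_interval ht.1.le ht.2.le le_rfl ?_ hint'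
        filter_upwards [ae_restrict_mem measurableSet_Ioc] with x hx
        have h1 := hx.1.le
        have h2 : 0 ≤ 1 - x := by linarith [hx.2]
        simp only [Pi.zero_apply]
        refine mul_nonneg (hsq x) ?_
        rw [jacobiWeight_eq]
        exact mul_nonneg (mul_nonneg (Real.rpow_nonneg h1 _) (Real.rpow_nonneg h2 _))
          (stepPower_nonneg hA hAB _)

theorem exp_neg_two_mul_le {t : ℝ} (h0 : 0 ≤ t) (h1 : t ≤ 1 / 2) : Real.exp (-(2 * t)) ≤ 1 - t := by
  rw [Real.exp_neg, inv_le_comm₀ (Real.exp_pos _) (by linarith)]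
  refine le_trans ?_ (Real.add_one_le_exp (2 * t))
  rw [inv_le_iff_one_le_mul₀ (by linarith)]
  nlinarith

/-- The product of the norm bounds over k < n is a power of 1-t with exponent O(n²), and t = τ/n²,
so a bound independent of n remains. It makes the limit positive and the logarithmic derivative
harmless. -/
theorem le_edgeDet (hα : 0 < α) (hβ : 0 < β) (hγ : 0 < γ) (hA : 0 ≤ A) (hAB : 0 < A + B)
    {n : ℕ} {τ : ℝ} (hτ : 0 < τ) (hn : 2 * τ ≤ (n : ℝ) ^ 2) :
    Real.exp (-(2 * (α + β + γ + 3) * τ)) ≤ edgeDet α β γ A B n τ := by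
  have hn0 : 0 < n := by
    rcases Nat.eq_zero_or_pos n with rfl | h
    · norm_num at hn; linarith
    · exact h
  have hn1 : (1 : ℝ) ≤ n := by exact_mod_cast hn0
  set t := τ / (n : ℝ) ^ 2 with ht
  have ht0 : 0 < t := by positivity
  have ht1 : t ≤ 1 / 2 := by rw [ht, div_le_iff₀ (by positivity)]; linarith
  have hs : 0 < 1 - t := by linarith
  obtain ⟨c, hc, h⟩ := exists_hankelDet_eq_mul_edgeDet (A := A) (B := B) hα hβ hγ hAB hn0
  have h0 := h 0
  rw [edgeDet_zero hAB, mul_one, zero_div, hankelDet_zero hα hβ hγ] at h0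
  have hτ' := h τ
  rw [← ht, hankelDet_eq_prod hα hβ hγ hA hAB n ⟨ht0, by linarith⟩] at hτ'
  set b : ℕ → ℝ := opNorm (betaFunctional (α + γ) β (by linarith) (by linarith)) with hb
  have hb0 : ∀ k, 0 < b k := fun k =>
    opNorm_pos (isPosFunctional_betaFunctional (by linarith) (by linarith)) k
  -- Each exponent α+β+γ+1+2k is at most (α+β+γ+3)n, since k ≤ n and n ≥ 1.
  have hle : ∀ k ∈ Finset.range n, Real.exp (-(2 * (α + β + γ + 3) * τ / n)) * ((A + B) * b k) ≤
      opNorm (jacobiL A B hα hβ hγ t) k := by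
    intro k hk
    have hk' : (k : ℝ) ≤ n := by exact_mod_cast (Finset.mem_range.1 hk).le
    refine le_trans ?_ (le_opNorm_jacobiL hα hβ hγ hA hAB ⟨ht0, by linarith⟩ k)
    have h1 : Real.exp (-(2 * (α + β + γ + 3) * τ / n)) ≤ (1 - t) ^ (α + β + γ + 1 + 2 * k) := by
      have e : Real.exp (-(2 * (α + β + γ + 3) * τ / n)) =
          Real.exp (-(2 * t)) ^ ((α + β + γ + 3) * n) := by
        rw [← Real.exp_mul]; congr 1; rw [ht]; field_simp
      rw [e]
      calc _ ≤ (1 - t) ^ ((α + β + γ + 3) * n) :=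
            Real.rpow_le_rpow (Real.exp_pos _).le (exp_neg_two_mul_le ht0.le ht1) (by positivity)
        _ ≤ _ := Real.rpow_le_rpow_of_exponent_ge hs (by linarith) (by nlinarith)
    have h2 := mul_le_mul_of_nonneg_right h1 (mul_pos hAB (hb0 k)).le
    linarith
  have hprod := Finset.prod_le_prod (fun k hk => (by have := hb0 k; positivity)) hle
  rw [Finset.prod_mul_distrib, Finset.prod_mul_distrib, Finset.prod_const, Finset.prod_const,
    Finset.card_range, h0, hτ', ← Real.exp_nat_mul, mul_comm c] at hprod
  have := le_of_mul_le_mul_right hprod hc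
  rwa [show (n : ℝ) * -(2 * (α + β + γ + 3) * τ / n) = -(2 * (α + β + γ + 3) * τ) by
    field_simp] at this

end edge_determinant

/-! ### Limit and holomorphic bounds for the scaled determinants -/

section edge_limit

variable {α β γ A B : ℝ}

/-- The bound 2|pq| ≤ p² + q² reduces to the diagonal integrals; it controls the tails uniformly in
all indices. -/
theorem integral_abs_edgePoly_mul_le {a b : ℝ} (ha : 0 < a) (hb : 0 < b) {n j k : ℕ} (hj : j < n)
    (hk : k < n) :
    ∫ y in (0 : ℝ)..(n : ℝ) ^ 2, |(edgePoly a b n j * edgePoly a b n k).eval y| *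
      (y ^ (a - 1) * (1 - y / (n : ℝ) ^ 2) ^ b) ≤ (3 + a + b) / a := by
  have hn : (0 : ℝ) < (n : ℝ) ^ 2 := by
    have : (0 : ℝ) < n := by exact_mod_cast (by omega : 0 < n)
    positivity
  have hint : IntervalIntegrable (fun y : ℝ => y ^ (a - 1) * (1 - y / (n : ℝ) ^ 2) ^ b)
      volume 0 ((n : ℝ) ^ 2) :=
    (intervalIntegrable_rpow_of_nonneg (by linarith)).mul_continuousOn
      (continuous_one_sub_div_rpow hb _).continuousOn
  have hi : ∀ P : ℝ[X], IntervalIntegrable (fun y : ℝ => P.eval y *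
      (y ^ (a - 1) * (1 - y / (n : ℝ) ^ 2) ^ b)) volume 0 ((n : ℝ) ^ 2) := fun P =>
    hint.continuousOn_mul P.continuous.continuousOn
  have h1 := integral_edgePoly_sq_div_le ha hb.le hj
  have h2 := integral_edgePoly_sq_div_le ha hb.le hk
  have h3 : ∫ y in (0 : ℝ)..(n : ℝ) ^ 2, |(edgePoly a b n j * edgePoly a b n k).eval y| *
      (y ^ (a - 1) * (1 - y / (n : ℝ) ^ 2) ^ b) ≤
      ∫ y in (0 : ℝ)..(n : ℝ) ^ 2, (1 / 2 * ((edgePoly a b n j * edgePoly a b n j).eval y *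
        (y ^ (a - 1) * (1 - y / (n : ℝ) ^ 2) ^ b)) +
        1 / 2 * ((edgePoly a b n k * edgePoly a b n k).eval y *
        (y ^ (a - 1) * (1 - y / (n : ℝ) ^ 2) ^ b))) := by
    refine intervalIntegral.integral_mono_on_of_le_Ioo hn.le
      (hint.continuousOn_mul (edgePoly a b n j * edgePoly a b n k).continuous.abs.continuousOn)
      (((hi _).const_mul _).add ((hi _).const_mul _)) fun y hy => ?_
    have e1 : 0 ≤ 1 - y / (n : ℝ) ^ 2 := by rw [sub_nonneg, div_le_one hn]; exact hy.2.le
    have e2 : 0 ≤ y ^ (a - 1) * (1 - y / (n : ℝ) ^ 2) ^ b :=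
      mul_nonneg (Real.rpow_nonneg hy.1.le _) (Real.rpow_nonneg e1 _)
    simp only [eval_mul, abs_mul]
    have e3 : |(edgePoly a b n j).eval y| * |(edgePoly a b n k).eval y| ≤
        1 / 2 * ((edgePoly a b n j).eval y * (edgePoly a b n j).eval y) +
        1 / 2 * ((edgePoly a b n k).eval y * (edgePoly a b n k).eval y) := by
      nlinarith [sq_nonneg (|(edgePoly a b n j).eval y| - |(edgePoly a b n k).eval y|),
        sq_abs ((edgePoly a b n j).eval y), sq_abs ((edgePoly a b n k).eval y)]
    exact (mul_le_mul_of_nonneg_right e3 e2).trans_eq (by ring)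
  rw [intervalIntegral.integral_add ((hi _).const_mul _) ((hi _).const_mul _),
    intervalIntegral.integral_const_mul, intervalIntegral.integral_const_mul] at h3
  linarith

theorem exists_norm_aeval_mul_le {a b : ℝ} (ha : 0 < a) (hb : 0 < b) (R : ℝ) :
    ∃ M : ℝ, 0 ≤ M ∧ ∀ n j k : ℕ, j < n → k < n → ∀ z : ℂ, ‖z‖ ≤ R →
      ‖aeval z (edgePoly a b n j * edgePoly a b n k)‖ ≤ M := by
  obtain ⟨M, hM, h⟩ := exists_norm_aeval_edgePoly_le ha hb R
  refine ⟨M * M, by positivity, fun n j k hj hk z hz => ?_⟩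
  rw [map_mul, norm_mul]
  exact mul_le_mul (h n j hj z hz) (h n k hk z hz) (norm_nonneg _) hM

theorem exists_holomorphic_edgeEntry (hα : 0 < α) (hβ : 0 < β) (hγ : 0 < γ) (hAB : 0 < A + B)
    {τ₀ : ℝ} (hτ₀ : 0 < τ₀) :
    ∃ C : ℝ, 0 < C ∧ ∀ n j k : ℕ, 4 * τ₀ ≤ (n : ℝ) ^ 2 → j < n → k < n →
    ∃ F : ℂ → ℂ, DifferentiableOn ℂ F (Metric.ball τ₀ (τ₀ / 4)) ∧
      (∀ τ ∈ Metric.ball (τ₀ : ℂ) (τ₀ / 4), ‖F τ‖ ≤ C) ∧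
      ∀ τ : ℝ, (τ : ℂ) ∈ Metric.ball (τ₀ : ℂ) (τ₀ / 4) →
        F τ = (edgeEntry α β γ A B τ n j k : ℂ) := by
  have ha := add_pos hα hγ
  obtain ⟨M, -, hM⟩ := exists_norm_aeval_mul_le ha hβ (2 * τ₀)
  obtain ⟨C, hC⟩ := exists_holomorphic_edgeKernel (A := A) (B := B) hα hβ hγ hAB hτ₀ M
    ((3 + (α + γ) + β) / (α + γ))
  refine ⟨|C| + 1, by positivity, fun n j k hn hj hk => ?_⟩
  obtain ⟨F, h1, h2, h3⟩ := hC _ _ hn (hM n j k hj hk) (integral_abs_edgePoly_mul_le ha hβ hj hk)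
  exact ⟨F, h1, fun τ hτ => (h2 τ hτ).trans (by linarith [le_abs_self C]), h3⟩

theorem ofReal_mem_ball {τ₀ τ r : ℝ} : (τ : ℂ) ∈ Metric.ball (τ₀ : ℂ) r ↔ |τ - τ₀| < r := by
  rw [Metric.mem_ball, dist_eq_norm, ← Complex.ofReal_sub, Complex.norm_real, Real.norm_eq_abs]

theorem eventually_le_natCast_sq (x : ℝ) : ∀ᶠ n : ℕ in atTop, x ≤ (n : ℝ) ^ 2 :=
  ((tendsto_pow_atTop two_ne_zero).comp tendsto_natCast_atTop_atTop).eventually_ge_atTop x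

theorem exists_tendsto_edgeDet (hα : 0 < α) (hβ : 0 < β) (hγ : 0 < γ) (hAB : 0 < A + B)
    {τ : ℝ} (hτ : 0 < τ) :
    ∃ l, Tendsto (fun n => edgeDet α β γ A B n τ) atTop (𝓝 l) := by
  have ha := add_pos hα hγ
  obtain ⟨C, hC, hF⟩ := exists_holomorphic_edgeEntry (A := A) (B := B) hα hβ hγ hAB hτ
  refine exists_tendsto_det_one_add hC ?_ fun u hu v hv => ?_
  · filter_upwards [eventually_le_natCast_sq (4 * τ)] with n hn i j hi hj
    obtain ⟨F, -, h2, h3⟩ := hF n i j hn hi hj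
    have hmem : (τ : ℂ) ∈ Metric.ball (τ : ℂ) (τ / 4) := Metric.mem_ball_self (by positivity)
    have := h2 τ hmem
    rwa [h3 τ hmem, Complex.norm_real] at this
  · have hu' := tendsto_cellIndex_div hu.1
    have hv' := tendsto_cellIndex_div hv.1
    obtain ⟨q₁, hq₁⟩ := exists_tendsto_eval_edgePoly ha hβ hu.1 hu'
    obtain ⟨q₂, hq₂⟩ := exists_tendsto_eval_edgePoly ha hβ hv.1 hv'
    obtain ⟨I, hI⟩ := exists_tendsto_integral_edgePoly_div ha hβ hu.1 hv.1 hu' hv'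
    refine exists_tendsto_edgeKernel hα hβ hγ hAB (q := fun y => q₁ y * q₂ y) (fun R => ?_)
      (fun y => ?_) (D := (3 + (α + γ) + β) / (α + γ)) ?_ hI hτ
    · obtain ⟨M, hM, h⟩ := exists_norm_aeval_mul_le ha hβ R
      refine ⟨M, hM, ?_⟩
      filter_upwards [eventually_gt_atTop 0] with n hn y hy
      have := h n _ _ (cellIndex_lt hn hu.2) (cellIndex_lt hn hv.2) y
        (by rwa [Complex.norm_real])
      rwa [aeval_ofReal, Complex.norm_real] at this
    · simp only [eval_mul]
      exact (hq₁ y).mul (hq₂ y)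
    · filter_upwards [eventually_gt_atTop 0] with n hn
      exact integral_abs_edgePoly_mul_le ha hβ (cellIndex_lt hn hu.2) (cellIndex_lt hn hv.2)

theorem exists_holomorphic_edgeDet (hα : 0 < α) (hβ : 0 < β) (hγ : 0 < γ) (hAB : 0 < A + B)
    {τ₀ : ℝ} (hτ₀ : 0 < τ₀) :
    ∃ C : ℝ, 0 < C ∧ ∀ n : ℕ, 4 * τ₀ ≤ (n : ℝ) ^ 2 →
    ∃ F : ℂ → ℂ, DifferentiableOn ℂ F (Metric.ball τ₀ (τ₀ / 4)) ∧
      (∀ τ ∈ Metric.ball (τ₀ : ℂ) (τ₀ / 4), ‖F τ‖ ≤ C) ∧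
      ∀ τ : ℝ, (τ : ℂ) ∈ Metric.ball (τ₀ : ℂ) (τ₀ / 4) →
        F τ = (edgeDet α β γ A B n τ : ℂ) := by
  obtain ⟨C, hC, hF⟩ := exists_holomorphic_edgeEntry (A := A) (B := B) hα hβ hγ hAB hτ₀
  refine ⟨Real.exp (2 * C + C ^ 2), Real.exp_pos _, fun n hn => ?_⟩
  have hn0 : 0 < n := by
    rcases Nat.eq_zero_or_pos n with rfl | h
    · norm_num at hn; linarith
    · exact h
  choose F hF1 hF2 hF3 using fun (i j : Fin n) => hF n i j hn i.2 j.2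
  refine ⟨fun τ => (1 + ((n : ℂ)⁻¹) • Matrix.of fun i j : Fin n => F i j τ).det, ?_,
    fun τ hτ => ?_, fun τ hτ => ?_⟩
  · simp only [Matrix.det_apply']
    refine DifferentiableOn.fun_sum fun σ _ => DifferentiableOn.const_mul
      (DifferentiableOn.fun_finsetProd fun i _ => ?_) _
    simp only [Matrix.add_apply, Matrix.smul_apply, Matrix.of_apply, smul_eq_mul]
    exact ((hF1 _ _).const_mul _).const_add _
  · have h := norm_det_one_add_sq_le hn0 (M := Matrix.of fun i j : Fin n => F i j τ)
      (fun i j => hF2 i j τ hτ)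
    -- Hadamard bounds the square of the determinant by E; since E ≥ 1, E ≤ E², which avoids a
    -- square root.
    have h1 : 1 ≤ Real.exp (2 * C + C ^ 2) := Real.one_le_exp (by positivity)
    refine le_of_sq_le_sq ?_ (Real.exp_pos _).le
    refine h.trans ?_
    nlinarith
  · simp only
    rw [edgeDet, ← Complex.ofRealHom_eq_coe (Matrix.det _), RingHom.map_det]
    congr 1
    ext i j
    simp only [RingHom.mapMatrix_apply, Matrix.map_apply, Matrix.add_apply, Matrix.smul_apply,
      Matrix.of_apply, smul_eq_mul, map_add, map_mul, Complex.ofRealHom_eq_coe, hF3 i j τ hτ,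
      Matrix.one_apply]
    split_ifs <;> simp

end edge_limit

/-! ### Uniformly bounded holomorphic families -/

section normal_families

/-- Two Cauchy estimates bound the second derivative by C/ρ², and the mean value inequality is
applied twice. -/
theorem norm_taylor_two_le {F : ℂ → ℂ} {c : ℂ} {ρ C : ℝ} (hρ : 0 < ρ)
    (hF : DifferentiableOn ℂ F (Metric.ball c (4 * ρ)))
    (hC : ∀ z ∈ Metric.ball c (4 * ρ), ‖F z‖ ≤ C) {h : ℂ} (hh : ‖h‖ ≤ ρ) :
    ‖F (c + h) - F c - h * deriv F c‖ ≤ C / ρ / ρ * ‖h‖ ^ 2 := by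
  have hsub : ∀ {z : ℂ} {R : ℝ}, z ∈ Metric.closedBall c R → R ≤ 2 * ρ →
      Metric.closedBall z ρ ⊆ Metric.ball c (4 * ρ) := by
    intro z R hz hR w hw
    rw [Metric.mem_closedBall] at hz hw
    rw [Metric.mem_ball]
    linarith [dist_triangle w z c]
  have hda : ∀ z ∈ Metric.ball c (4 * ρ), DifferentiableAt ℂ F z := fun z hz =>
    hF.differentiableAt (Metric.isOpen_ball.mem_nhds hz)
  have hF' : DifferentiableOn ℂ (deriv F) (Metric.ball c (4 * ρ)) :=
    hF.deriv Metric.isOpen_ball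
  have hb1 : ∀ z ∈ Metric.closedBall c (2 * ρ), ‖deriv F z‖ ≤ C / ρ := fun z hz =>
    Complex.norm_deriv_le_of_forall_mem_sphere_norm_le hρ
      (DifferentiableOn.diffContOnCl (by
        rw [closure_ball _ hρ.ne']; exact hF.mono (hsub hz le_rfl)))
      fun w hw => hC w (hsub hz le_rfl (Metric.sphere_subset_closedBall hw))
  have hb2 : ∀ z ∈ Metric.closedBall c ρ, ‖deriv (deriv F) z‖ ≤ C / ρ / ρ := fun z hz =>
    Complex.norm_deriv_le_of_forall_mem_sphere_norm_le hρ
      (DifferentiableOn.diffContOnCl (by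
        rw [closure_ball _ hρ.ne']; exact hF'.mono (hsub hz (by linarith))))
      fun w hw => hb1 w (by
        rw [Metric.mem_closedBall] at hz ⊢
        rw [Metric.mem_sphere] at hw
        linarith [dist_triangle w z c])
  have hball : Metric.closedBall c ‖h‖ ⊆ Metric.ball c (4 * ρ) :=
    (Metric.closedBall_subset_closedBall hh).trans
      (Metric.closedBall_subset_ball (by linarith))
  have hc : c ∈ Metric.closedBall c ‖h‖ := Metric.mem_closedBall_self (norm_nonneg _)
  have h1 : ∀ z ∈ Metric.closedBall c ‖h‖, ‖deriv F z - deriv F c‖ ≤ C / ρ / ρ * ‖h‖ := by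
    intro z hz
    have := (convex_closedBall c ‖h‖).norm_image_sub_le_of_norm_hasDerivWithin_le
      (f := deriv F) (f' := deriv (deriv F)) (fun x hx =>
        (hF'.differentiableAt (Metric.isOpen_ball.mem_nhds (hball hx))).hasDerivAt.hasDerivWithinAt)
      (fun x hx => hb2 x (Metric.closedBall_subset_closedBall hh hx)) hc hz
    refine this.trans (mul_le_mul_of_nonneg_left ?_ ?_)
    · rwa [← dist_eq_norm]
    · exact (norm_nonneg _).trans (hb2 c (Metric.mem_closedBall_self hρ.le))
  have h2 := (convex_closedBall c ‖h‖).norm_image_sub_le_of_norm_hasDerivWithin_le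
    (f := fun z => F z - z * deriv F c) (f' := fun z => deriv F z - 1 * deriv F c) (fun x hx =>
      ((hda x (hball hx)).hasDerivAt.sub ((hasDerivAt_id x).mul_const _)).hasDerivWithinAt)
    (fun x hx => by rw [one_mul]; exact h1 x hx) hc (y := c + h)
    (by rw [Metric.mem_closedBall, dist_eq_norm, add_sub_cancel_left])
  rw [add_sub_cancel_left] at h2
  calc _ = ‖F (c + h) - (c + h) * deriv F c - (F c - c * deriv F c)‖ := by congr 1; ring
    _ ≤ _ := h2
    _ = _ := by ring

/-- A complex derivative of a function that is real on the real axis. -/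
theorem hasDerivAt_of_eq_ofReal {F : ℂ → ℂ} {f : ℝ → ℝ} {τ : ℝ}
    (h : ∀ᶠ y : ℝ in 𝓝 τ, F y = f y) (hF : DifferentiableAt ℂ F τ) :
    DifferentiableAt ℝ f τ ∧ deriv F τ = ((deriv f τ : ℝ) : ℂ) := by
  have h1 : HasDerivAt (fun y : ℝ => (f y : ℂ)) (deriv F τ) τ :=
    hF.hasDerivAt.comp_ofReal.congr_of_eventuallyEq (h.mono fun y hy => hy.symm)
  have h2 : HasDerivAt f (deriv F τ).re τ := by
    exact (Complex.reCLM.hasFDerivAt (x := (f τ : ℂ))).comp_hasDerivAt τ h1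
  exact ⟨h2.differentiableAt, by rw [h2.deriv]; exact h1.unique h2.ofReal_comp⟩

/-- A sequence of functions that extend holomorphically to a disc, with a uniform bound. -/
def IsNormalAt (f : ℕ → ℝ → ℝ) (τ₀ r : ℝ) : Prop :=
  ∃ C : ℝ, ∀ᶠ n in atTop, ∃ F : ℂ → ℂ, DifferentiableOn ℂ F (Metric.ball (τ₀ : ℂ) r) ∧
    (∀ z ∈ Metric.ball (τ₀ : ℂ) r, ‖F z‖ ≤ C) ∧
    ∀ τ : ℝ, (τ : ℂ) ∈ Metric.ball (τ₀ : ℂ) r → F τ = (f n τ : ℂ)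

theorem eventually_ofReal_mem_ball {τ τ₀ r : ℝ} (hτ : (τ : ℂ) ∈ Metric.ball (τ₀ : ℂ) r) :
    ∀ᶠ y : ℝ in 𝓝 τ, (y : ℂ) ∈ Metric.ball (τ₀ : ℂ) r :=
  (Complex.continuous_ofReal.tendsto τ).eventually (Metric.isOpen_ball.mem_nhds hτ)

variable {f : ℕ → ℝ → ℝ} {τ₀ r : ℝ}

/-- The second-order Taylor bound is uniform in n. Difference quotients, which converge, therefore
approximate the derivatives uniformly, so the derivatives converge; the limit function inherits the
Taylor bound and is differentiable with that derivative. -/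
theorem IsNormalAt.exists_tendsto_deriv (hf : IsNormalAt f τ₀ r) {g : ℝ → ℝ}
    (hg : ∀ τ : ℝ, (τ : ℂ) ∈ Metric.ball (τ₀ : ℂ) r → Tendsto (fun n => f n τ) atTop (𝓝 (g τ)))
    {τ : ℝ} (hτ : (τ : ℂ) ∈ Metric.ball (τ₀ : ℂ) r) :
    ∃ l, Tendsto (fun n => deriv (f n) τ) atTop (𝓝 l) ∧ HasDerivAt g l τ := by
  obtain ⟨C, hC⟩ := hf
  set ρ : ℝ := (r - dist (τ : ℂ) τ₀) / 4 with hρ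
  have hρ0 : 0 < ρ := by
    rw [Metric.mem_ball] at hτ
    rw [hρ]; linarith
  have hsub : Metric.ball (τ : ℂ) (4 * ρ) ⊆ Metric.ball (τ₀ : ℂ) r :=
    Metric.ball_subset_ball' (by rw [hρ]; linarith)
  set K : ℝ := |C / ρ / ρ| with hK
  have htay : ∀ᶠ n in atTop, ∀ h : ℝ, |h| ≤ ρ →
      |f n (τ + h) - f n τ - h * deriv (f n) τ| ≤ K * h ^ 2 := by
    filter_upwards [hC] with n ⟨F, hF, hb, hFf⟩ h hh
    have h1 := norm_taylor_two_le hρ0 (hF.mono hsub) (fun z hz => hb z (hsub hz)) (h := (h : ℂ))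
      (by rwa [Complex.norm_real])
    have hmem : ((τ + h : ℝ) : ℂ) ∈ Metric.ball (τ₀ : ℂ) r := hsub (by
      rw [ofReal_mem_ball, add_sub_cancel_left]; linarith)
    have hd := (hasDerivAt_of_eq_ofReal ((eventually_ofReal_mem_ball hτ).mono hFf)
      (hF.differentiableAt (Metric.isOpen_ball.mem_nhds hτ))).2
    rw [hd, ← Complex.ofReal_add, hFf _ hmem, hFf _ hτ, ← Complex.ofReal_mul, ← Complex.ofReal_sub,
      ← Complex.ofReal_sub, Complex.norm_real, Complex.norm_real, Real.norm_eq_abs,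
      Real.norm_eq_abs, sq_abs] at h1
    exact h1.trans (mul_le_mul_of_nonneg_right (le_abs_self _) (sq_nonneg _))
  have hlim : ∀ h : ℝ, |h| ≤ ρ → Tendsto (fun n => f n (τ + h)) atTop (𝓝 (g (τ + h))) := fun h hh =>
    hg _ (hsub (by rw [ofReal_mem_ball, add_sub_cancel_left]; linarith))
  have hlim0 := hg τ hτ
  obtain ⟨l, hl⟩ : ∃ l, Tendsto (fun n => deriv (f n) τ) atTop (𝓝 l) := by
    refine exists_tendsto_of_approx fun ε hε => ?_
    set h : ℝ := min ρ (ε / (K + 1)) with hh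
    have hK0 : 0 ≤ K := abs_nonneg _
    have h0 : 0 < h := lt_min hρ0 (by positivity)
    have hKh : K * h ≤ ε := by
      have h1 : h ≤ ε / (K + 1) := min_le_right _ _
      rw [le_div_iff₀ (by positivity)] at h1
      nlinarith
    have hhρ : |h| ≤ ρ := by rw [abs_of_pos h0]; exact min_le_left _ _
    refine ⟨fun n => (f n (τ + h) - f n τ) / h, _, ((hlim h hhρ).sub hlim0).div_const h, ?_⟩
    filter_upwards [htay] with n hn
    have h1 := hn h hhρ
    have e : deriv (f n) τ - (f n (τ + h) - f n τ) / h =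
        -(f n (τ + h) - f n τ - h * deriv (f n) τ) / h := by field_simp; ring
    rw [e, abs_div, abs_neg, abs_of_pos h0, div_le_iff₀ h0]
    nlinarith
  refine ⟨l, hl, ?_⟩
  have hgt : ∀ h : ℝ, |h| ≤ ρ → |g (τ + h) - g τ - h * l| ≤ K * h ^ 2 := fun h hh =>
    le_of_tendsto (((hlim h hh).sub hlim0).sub (hl.const_mul h)).abs
      (htay.mono fun n hn => hn h hh)
  rw [hasDerivAt_iff_isLittleO_nhds_zero]
  refine Asymptotics.IsBigO.trans_isLittleO (g := fun h : ℝ => h ^ 2) ?_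
    (Asymptotics.isLittleO_pow_id one_lt_two)
  refine Asymptotics.IsBigO.of_bound K ?_
  filter_upwards [Metric.closedBall_mem_nhds (0 : ℝ) hρ0] with h hh
  rw [mem_closedBall_zero_iff] at hh
  rw [Real.norm_eq_abs, Real.norm_eq_abs, smul_eq_mul, abs_of_nonneg (sq_nonneg h)]
  exact hgt h hh

/-- Cauchy's estimate costs only a slightly smaller disc, so the convergence result can be iterated
to second derivatives. -/
theorem IsNormalAt.normal_deriv (hf : IsNormalAt f τ₀ r) {r' : ℝ} (hr : r' < r) :
    IsNormalAt (fun n => deriv (f n)) τ₀ r' := by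
  obtain ⟨C, hC⟩ := hf
  have hρ : 0 < (r - r') / 2 := by linarith
  have hsub : Metric.ball (τ₀ : ℂ) r' ⊆ Metric.ball (τ₀ : ℂ) r := Metric.ball_subset_ball hr.le
  refine ⟨C / ((r - r') / 2), ?_⟩
  filter_upwards [hC] with n ⟨F, hF, hb, hFf⟩
  refine ⟨deriv F, (hF.deriv Metric.isOpen_ball).mono hsub, fun z hz => ?_,
    fun τ hτ => (hasDerivAt_of_eq_ofReal ((eventually_ofReal_mem_ball (hsub hτ)).mono hFf)
      (hF.differentiableAt (Metric.isOpen_ball.mem_nhds (hsub hτ)))).2⟩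
  have hcl : Metric.closedBall z ((r - r') / 2) ⊆ Metric.ball (τ₀ : ℂ) r := by
    intro w hw
    rw [Metric.mem_closedBall] at hw
    rw [Metric.mem_ball] at hz ⊢
    linarith [dist_triangle w z τ₀]
  refine Complex.norm_deriv_le_of_forall_mem_sphere_norm_le hρ (DifferentiableOn.diffContOnCl ?_)
    fun w hw => hb w (hcl (Metric.sphere_subset_closedBall hw))
  rw [closure_ball _ hρ.ne']
  exact hF.mono hcl

/-- Normality of a rescaled logarithmic derivative. -/
theorem IsNormalAt.mul_log_deriv (hf : IsNormalAt f τ₀ r) (hr : 0 < r) {δ : ℝ} (hδ : 0 < δ)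
    (hle : ∀ᶠ n in atTop, δ ≤ f n τ₀) :
    ∃ r' : ℝ, 0 < r' ∧ r' ≤ r ∧ IsNormalAt
      (fun n τ => τ * (1 - τ / (n : ℝ) ^ 2) * (deriv (f n) τ / f n τ)) τ₀ r' := by
  obtain ⟨C, hC⟩ := hf
  set D : ℝ := |C| / (r / 2) with hD
  have hD0 : 0 ≤ D := by positivity
  -- On this radius the function moves by at most Dr' ≤ δ/2 from its centre value, so its modulus
  -- stays at least δ/2 at complex points too.
  set r' : ℝ := min (r / 2) (δ / (2 * (D + 1))) with hr'
  have h0 : 0 < r' := lt_min (by positivity) (by positivity)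
  have h1 : r' ≤ r / 2 := min_le_left _ _
  have h2 : D * r' ≤ δ / 2 := by
    have : r' ≤ δ / (2 * (D + 1)) := min_le_right _ _
    rw [le_div_iff₀ (by positivity)] at this
    nlinarith
  have hsub : Metric.ball (τ₀ : ℂ) r' ⊆ Metric.ball (τ₀ : ℂ) r :=
    Metric.ball_subset_ball (by linarith)
  refine ⟨r', h0, by linarith, (|τ₀| + r) * (1 + (|τ₀| + r)) * (D / (δ / 2)), ?_⟩
  filter_upwards [hC, hle, eventually_ge_atTop 1] with n ⟨F, hF, hb, hFf⟩ hn hn1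
  have hd : ∀ z ∈ Metric.ball (τ₀ : ℂ) r', ‖deriv F z‖ ≤ D := by
    intro z hz
    have hcl : Metric.closedBall z (r / 2) ⊆ Metric.ball (τ₀ : ℂ) r := by
      intro w hw
      rw [Metric.mem_closedBall] at hw
      rw [Metric.mem_ball] at hz ⊢
      linarith [dist_triangle w z τ₀]
    refine Complex.norm_deriv_le_of_forall_mem_sphere_norm_le (by positivity)
      (DifferentiableOn.diffContOnCl ?_)
      fun w hw => (hb w (hcl (Metric.sphere_subset_closedBall hw))).trans (le_abs_self C)
    rw [closure_ball _ (by positivity)]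
    exact hF.mono hcl
  have hda : ∀ z ∈ Metric.ball (τ₀ : ℂ) r', DifferentiableAt ℂ F z := fun z hz =>
    hF.differentiableAt (Metric.isOpen_ball.mem_nhds (hsub hz))
  have hlow : ∀ z ∈ Metric.ball (τ₀ : ℂ) r', δ / 2 ≤ ‖F z‖ := by
    intro z hz
    have h3 := (convex_ball (τ₀ : ℂ) r').norm_image_sub_le_of_norm_deriv_le hda hd
      (Metric.mem_ball_self h0) hz
    have h4 : ‖z - τ₀‖ ≤ r' := by rw [← dist_eq_norm]; exact (Metric.mem_ball.1 hz).le
    have h5 : δ ≤ ‖F τ₀‖ := by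
      rw [hFf τ₀ (Metric.mem_ball_self hr), Complex.norm_real]
      exact hn.trans (le_abs_self _)
    have h6 := norm_sub_norm_le (F τ₀) (F z)
    rw [norm_sub_rev] at h6
    have h7 := mul_le_mul_of_nonneg_left h4 hD0
    linarith
  have hne : ∀ z ∈ Metric.ball (τ₀ : ℂ) r', F z ≠ 0 := fun z hz h => by
    have := hlow z hz
    rw [h, norm_zero] at this
    linarith
  refine ⟨fun z => z * (1 - z / (n : ℂ) ^ 2) * (deriv F z / F z), ?_, fun z hz => ?_,
    fun τ hτ => ?_⟩
  · exact (differentiableOn_id.mul ((differentiableOn_id.div_const _).const_sub 1)).mul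
      (((hF.deriv Metric.isOpen_ball).mono hsub).div (hF.mono hsub) hne)
  · have hz1 : ‖z‖ ≤ |τ₀| + r := by
      have h4 : ‖z - τ₀‖ ≤ r' := by rw [← dist_eq_norm]; exact (Metric.mem_ball.1 hz).le
      have h5 := norm_add_le (z - τ₀) τ₀
      rw [sub_add_cancel, Complex.norm_real, Real.norm_eq_abs] at h5
      linarith
    have hz2 : ‖1 - z / (n : ℂ) ^ 2‖ ≤ 1 + (|τ₀| + r) := by
      refine (norm_sub_le _ _).trans ?_
      rw [norm_one, norm_div, norm_pow, Complex.norm_natCast]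
      have hn1' : (1 : ℝ) ≤ n := by exact_mod_cast hn1
      have := div_le_self (norm_nonneg z) (one_le_pow₀ hn1' (n := 2))
      linarith
    rw [norm_mul, norm_mul, norm_div]
    have h5 := hlow z hz
    have h6 := hd z hz
    gcongr
  · have hd' := (hasDerivAt_of_eq_ofReal ((eventually_ofReal_mem_ball (hsub hτ)).mono hFf)
      (hda τ hτ)).2
    simp only
    rw [hd', hFf τ (hsub hτ)]
    push_cast; rfl

end normal_families

/-! ### Passage to the limit in the differential equation -/

section sigma_form

variable {α β γ A B : ℝ}

/-- In the centred variables X, Z and Y = -d/2-X-Z the discriminant shows no cancelling high powers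
of n: the combination d(2X + d/2), which is the W of `edgeSigma_ode`, stays bounded in the scaling.
-/
theorem recS_sq_sub_eq {m t p r d X Z : ℝ} (hd : d = 2 * m + (α + β + γ))
    (hX : X = p - t * r - β / 2) (hZ : Z = r - γ / 2) :
    recS α β γ m t p r ^ 2 - 4 * recF α β γ m t p r * (r * (r - γ)) =
      -(d / 2) * (2 * X + d / 2) * (d / 2 + 2 * Z) * (d / 2 + 2 * (-(d / 2) - X - Z)) -
        (X ^ 2 * (β ^ 2 - α ^ 2 - γ ^ 2) + (-(d / 2) - X - Z) ^ 2 * (α ^ 2 - β ^ 2 - γ ^ 2) +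
          Z ^ 2 * (γ ^ 2 - α ^ 2 - β ^ 2)) / 2 +
        (α ^ 4 + β ^ 4 + γ ^ 4 - 2 * α ^ 2 * β ^ 2 - 2 * α ^ 2 * γ ^ 2 - 2 * β ^ 2 * γ ^ 2) / 16 := by
  subst hd hX hZ
  unfold recS recF
  ring

/-- The logarithmic derivative in the hard-edge variable. -/
noncomputable def edgeSigma (α β γ A B : ℝ) (n : ℕ) (τ : ℝ) : ℝ :=
  -hankelH α β γ A B n (τ / (n : ℝ) ^ 2)

/-- The rescaled finite-`n` equation. -/
theorem edgeSigma_ode (hα : 0 < α) (hβ : 0 < β) (hγ : 0 < γ) (hA : 0 ≤ A) (hAB : 0 < A + B)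
    {n : ℕ} (hn : 0 < n) {τ d W ζ ξ : ℝ} (hτ0 : 0 < τ) (hτ : τ < (n : ℝ) ^ 2)
    (hd : d = 2 * n + (α + β + γ))
    (hW : W = 2 * (edgeSigma α β γ A B n τ - τ * deriv (edgeSigma α β γ A B n) τ) +
      ((α + γ) ^ 2 - β ^ 2) / 2)
    (hζ : ζ = 2 * (n / d) * deriv (edgeSigma α β γ A B n) τ + γ * (2 / d - 1 / n))
    (hξ : ξ = W * (1 / d) * (1 / n) - d / n / 2) :
    (τ * (1 - τ / (n : ℝ) ^ 2) * deriv (deriv (edgeSigma α β γ A B n)) τ * (2 * (n / d))) ^ 2 =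
      -2 * W * (d / n / 2 + ζ) * (d / n / 2 + (-(d / n) - ξ - ζ)) -
        (ξ ^ 2 * (β ^ 2 - α ^ 2 - γ ^ 2) + (-(d / n) - ξ - ζ) ^ 2 * (α ^ 2 - β ^ 2 - γ ^ 2) +
          ζ ^ 2 * (γ ^ 2 - α ^ 2 - β ^ 2)) / 2 +
        (α ^ 4 + β ^ 4 + γ ^ 4 - 2 * α ^ 2 * β ^ 2 - 2 * α ^ 2 * γ ^ 2 - 2 * β ^ 2 * γ ^ 2) / 4 *
          (1 / n) ^ 2 := by
  have hn' : (0 : ℝ) < n := by exact_mod_cast hn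
  have hd0 : 0 < d := by rw [hd]; positivity
  obtain ⟨p, r, r₁, h⟩ := hankelH_ode (A := A) (B := B) hα hβ hγ hA hAB hn.ne'
  have hmem : ∀ y ∈ Ioo 0 ((n : ℝ) ^ 2), y / (n : ℝ) ^ 2 ∈ Ioo (0 : ℝ) 1 := fun y hy =>
    ⟨div_pos hy.1 (by positivity), (div_lt_one (by positivity)).2 hy.2⟩
  have hdiv : ∀ y : ℝ, HasDerivAt (fun y : ℝ => y / (n : ℝ) ^ 2) (1 / (n : ℝ) ^ 2) y := fun y =>
    (hasDerivAt_id y).div_const _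
  have h1 : ∀ y ∈ Ioo 0 ((n : ℝ) ^ 2), deriv (edgeSigma α β γ A B n) y =
      -((n * γ - (2 * n + (α + β + γ)) * r (y / (n : ℝ) ^ 2)) * (1 / (n : ℝ) ^ 2)) := by
    intro y hy
    have he : edgeSigma α β γ A B n = -(hankelH α β γ A B n ∘ fun y => y / (n : ℝ) ^ 2) := rfl
    rw [he]
    exact ((h _ (hmem y hy)).2.1.comp y (hdiv y)).neg.deriv
  have hτm : τ ∈ Ioo 0 ((n : ℝ) ^ 2) := ⟨hτ0, hτ⟩
  have h2 : deriv (deriv (edgeSigma α β γ A B n)) τ =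
      -(-(2 * n + (α + β + γ)) * r₁ (τ / (n : ℝ) ^ 2) * (1 / (n : ℝ) ^ 2) * (1 / (n : ℝ) ^ 2)) := by
    have he : deriv (edgeSigma α β γ A B n) =ᶠ[𝓝 τ] fun y =>
        -((n * γ - (2 * n + (α + β + γ)) * r (y / (n : ℝ) ^ 2)) * (1 / (n : ℝ) ^ 2)) := by
      filter_upwards [isOpen_Ioo.mem_nhds hτm] with y hy using h1 y hy
    rw [he.deriv_eq]
    exact (((h _ (hmem τ hτm)).2.2.1.comp τ (hdiv τ)).mul_const _).neg.deriv
  obtain ⟨e0, -, -, e3⟩ := h _ (hmem τ hτm)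
  have h0 : edgeSigma α β γ A B n τ = -hankelH α β γ A B n (τ / (n : ℝ) ^ 2) := rfl
  rw [e0] at h0
  replace h1 := h1 τ hτm
  rw [← hd] at h0 h1 h2
  set t := τ / (n : ℝ) ^ 2 with ht
  have htτ : τ = n ^ 2 * t := by rw [ht]; field_simp
  generalize edgeSigma α β γ A B n τ = S at *
  generalize hS1 : deriv (edgeSigma α β γ A B n) τ = S1 at *
  generalize deriv (deriv (edgeSigma α β γ A B n)) τ = S2 at *
  have hX : n * ξ / 2 = p t - t * r t - β / 2 := by
    rw [hξ, hW, h0, h1, htτ]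
    field_simp
    rw [hd]; ring
  have hZ : n * ζ / 2 = r t - γ / 2 := by
    rw [hζ, h1]; field_simp; ring
  have key := recS_sq_sub_eq (t := t) hd hX hZ
  rw [← e3] at key
  have eL : (τ * (1 - t) * S2 * (2 * (n / d))) ^ 2 =
      4 / (n : ℝ) ^ 2 * (t * (t - 1) * r₁ t) ^ 2 := by
    rw [h2, htτ]; field_simp; ring
  have eW : W = d * (2 * (n * ξ / 2) + d / 2) := by rw [hξ]; field_simp; ring
  rw [eL, key, eW]
  field_simp
  ring

theorem edgeSigma_eq (hα : 0 < α) (hβ : 0 < β) (hγ : 0 < γ) (hA : 0 ≤ A) (hAB : 0 < A + B)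
    {n : ℕ} (hn : 0 < n) {τ : ℝ} (hτ0 : 0 < τ) (hτ : τ < (n : ℝ) ^ 2) :
    edgeSigma α β γ A B n τ = τ * (1 - τ / (n : ℝ) ^ 2) *
      (deriv (edgeDet α β γ A B n) τ / edgeDet α β γ A B n τ) := by
  have hn' : (0 : ℝ) < n := by exact_mod_cast hn
  obtain ⟨c, hc, h⟩ := exists_hankelDet_eq_mul_edgeDet (A := A) (B := B) hα hβ hγ hAB hn
  have ht : τ / (n : ℝ) ^ 2 ∈ Ioo (0 : ℝ) 1 :=
    ⟨by positivity, (div_lt_one (by positivity)).2 hτ⟩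
  have hpos := hankelDet_pos hα hβ hγ hA hAB n ht
  have hd := (differentiableAt_hankelDet (A := A) (B := B) hα hβ hγ n
    (τ / (n : ℝ) ^ 2)).hasDerivAt
  have he : edgeDet α β γ A B n = fun y => hankelDet α β γ A B n (y / (n : ℝ) ^ 2) / c := by
    ext y; rw [h y, mul_div_cancel_left₀ _ hc.ne']
  have hd2 : HasDerivAt (edgeDet α β γ A B n)
      (deriv (hankelDet α β γ A B n) (τ / (n : ℝ) ^ 2) * (1 / (n : ℝ) ^ 2) / c) τ := by
    rw [he]
    exact (hd.comp τ ((hasDerivAt_id τ).div_const _)).div_const c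
  rw [edgeSigma, hankelH, (hd.log hpos.ne').deriv, hd2.deriv, he]
  field_simp
  ring

theorem isNormalAt_edgeDet (hα : 0 < α) (hβ : 0 < β) (hγ : 0 < γ) (hAB : 0 < A + B)
    {τ₀ : ℝ} (hτ₀ : 0 < τ₀) : IsNormalAt (edgeDet α β γ A B) τ₀ (τ₀ / 4) := by
  obtain ⟨C, -, h⟩ := exists_holomorphic_edgeDet (A := A) (B := B) hα hβ hγ hAB hτ₀
  exact ⟨C, (eventually_le_natCast_sq (4 * τ₀)).mono h⟩

theorem IsNormalAt.congr {f g : ℕ → ℝ → ℝ} {τ₀ r : ℝ} (hf : IsNormalAt f τ₀ r)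
    (h : ∀ᶠ n in atTop, ∀ τ : ℝ, (τ : ℂ) ∈ Metric.ball (τ₀ : ℂ) r → f n τ = g n τ) :
    IsNormalAt g τ₀ r := by
  obtain ⟨C, hC⟩ := hf
  refine ⟨C, ?_⟩
  filter_upwards [hC, h] with n ⟨F, hF, hb, hFf⟩ hn
  exact ⟨F, hF, hb, fun τ hτ => by rw [hFf τ hτ, hn τ hτ]⟩

theorem eventually_le_edgeDet (hα : 0 < α) (hβ : 0 < β) (hγ : 0 < γ) (hA : 0 ≤ A)
    (hAB : 0 < A + B) {τ : ℝ} (hτ : 0 < τ) :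
    ∀ᶠ n in atTop, Real.exp (-(2 * (α + β + γ + 3) * τ)) ≤ edgeDet α β γ A B n τ :=
  (eventually_le_natCast_sq (2 * τ)).mono fun _ hn => le_edgeDet hα hβ hγ hA hAB hτ hn

theorem exists_isNormalAt_edgeSigma (hα : 0 < α) (hβ : 0 < β) (hγ : 0 < γ) (hA : 0 ≤ A)
    (hAB : 0 < A + B) {τ₀ : ℝ} (hτ₀ : 0 < τ₀) :
    ∃ r : ℝ, 0 < r ∧ r ≤ τ₀ / 4 ∧ IsNormalAt (edgeSigma α β γ A B) τ₀ r := by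
  obtain ⟨r, hr0, hr, h⟩ := (isNormalAt_edgeDet hα hβ hγ hAB hτ₀).mul_log_deriv (by positivity)
    (Real.exp_pos _) (eventually_le_edgeDet hα hβ hγ hA hAB hτ₀)
  refine ⟨r, hr0, hr, h.congr ?_⟩
  filter_upwards [eventually_le_natCast_sq (2 * τ₀), eventually_gt_atTop 0] with n hn hn0 τ hτ
  rw [ofReal_mem_ball, abs_lt] at hτ
  exact (edgeSigma_eq hα hβ hγ hA hAB hn0 (by linarith) (by linarith)).symm

theorem tendsto_one_sub_div_sq (τ : ℝ) :
    Tendsto (fun n : ℕ => 1 - τ / (n : ℝ) ^ 2) atTop (𝓝 1) := by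
  simpa using ((tendsto_const_nhds (x := τ)).div_atTop
    ((tendsto_pow_atTop two_ne_zero).comp tendsto_natCast_atTop_atTop)).const_sub (1 : ℝ)

/-- A quotient of limits; the denominator has a positive limit by the uniform lower bound. -/
theorem exists_tendsto_edgeSigma (hα : 0 < α) (hβ : 0 < β) (hγ : 0 < γ) (hA : 0 ≤ A)
    (hAB : 0 < A + B) {τ : ℝ} (hτ : 0 < τ) :
    ∃ l, Tendsto (fun n => edgeSigma α β γ A B n τ) atTop (𝓝 l) := by
  have hlim : ∀ y : ℝ, ∃ l, 0 < y → Tendsto (fun n => edgeDet α β γ A B n y) atTop (𝓝 l) := by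
    intro y
    by_cases hy : 0 < y
    · obtain ⟨l, hl⟩ := exists_tendsto_edgeDet (A := A) (B := B) hα hβ hγ hAB hy
      exact ⟨l, fun _ => hl⟩
    · exact ⟨0, fun h => absurd h hy⟩
  choose D hD using hlim
  obtain ⟨l, hl, -⟩ := (isNormalAt_edgeDet hα hβ hγ hAB hτ).exists_tendsto_deriv (g := D)
    (fun y hy => hD y (by rw [ofReal_mem_ball, abs_lt] at hy; linarith))
    (Metric.mem_ball_self (by positivity))
  have hD0 : 0 < D τ := (Real.exp_pos _).trans_le
    (ge_of_tendsto (hD τ hτ) (eventually_le_edgeDet hα hβ hγ hA hAB hτ))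
  refine ⟨_, (((tendsto_one_sub_div_sq τ).const_mul τ).mul (hl.div (hD τ hτ) hD0.ne')).congr' ?_⟩
  filter_upwards [eventually_le_natCast_sq (2 * τ), eventually_gt_atTop 0] with n hn hn0
  exact (edgeSigma_eq hα hβ hγ hA hAB hn0 hτ (by linarith)).symm

/-- The limit of the rescaled logarithmic derivative and its equation. -/
theorem exists_limit_edgeSigma (hα : 0 < α) (hβ : 0 < β) (hγ : 0 < γ) (hA : 0 ≤ A)
    (hAB : 0 < A + B) :
    ∃ g : ℝ → ℝ, ∀ τ : ℝ, 0 < τ → Tendsto (fun n => edgeSigma α β γ A B n τ) atTop (𝓝 (g τ)) ∧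
      DifferentiableAt ℝ g τ ∧ DifferentiableAt ℝ (deriv g) τ ∧
      (τ * deriv (deriv g) τ) ^ 2 = 4 * deriv g τ * (1 + deriv g τ) * (g τ - τ * deriv g τ) +
        ((α + γ) * deriv g τ + γ) ^ 2 := by
  -- Placing the condition inside lets the choice produce a function on all of ℝ; its values at y ≤
  -- 0 are immaterial.
  have hlim : ∀ y : ℝ, ∃ l, 0 < y → Tendsto (fun n => edgeSigma α β γ A B n y) atTop (𝓝 l) := by
    intro y
    by_cases hy : 0 < y
    · obtain ⟨l, hl⟩ := exists_tendsto_edgeSigma hα hβ hγ hA hAB hy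
      exact ⟨l, fun _ => hl⟩
    · exact ⟨0, fun h => absurd h hy⟩
  choose g hg using hlim
  refine ⟨g, fun τ hτ => ?_⟩
  obtain ⟨r, hr0, hr, hN⟩ := exists_isNormalAt_edgeSigma hα hβ hγ hA hAB hτ
  have hpos : ∀ y : ℝ, (y : ℂ) ∈ Metric.ball (τ : ℂ) r → 0 < y := fun y hy => by
    rw [ofReal_mem_ball, abs_lt] at hy; linarith
  have h1 : ∀ y : ℝ, (y : ℂ) ∈ Metric.ball (τ : ℂ) r →
      Tendsto (fun n => deriv (edgeSigma α β γ A B n) y) atTop (𝓝 (deriv g y)) ∧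
        DifferentiableAt ℝ g y := by
    intro y hy
    obtain ⟨l, hl, hd⟩ := hN.exists_tendsto_deriv (g := g) (fun y hy => hg y (hpos y hy)) hy
    rw [hd.deriv]
    exact ⟨hl, hd.differentiableAt⟩
  have hself : (τ : ℂ) ∈ Metric.ball (τ : ℂ) r := Metric.mem_ball_self hr0
  obtain ⟨l, hl, hd⟩ := (hN.normal_deriv (half_lt_self hr0)).exists_tendsto_deriv (g := deriv g)
    (fun y hy => (h1 y (Metric.ball_subset_ball (by linarith) hy)).1)
    (Metric.mem_ball_self (half_pos hr0))
  obtain ⟨hS1, hdg⟩ := h1 τ hself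
  refine ⟨hg τ hτ, hdg, hd.differentiableAt, ?_⟩
  rw [hd.deriv]
  have hS := hg τ hτ
  have hinv : Tendsto (fun n : ℕ => 1 / (n : ℝ)) atTop (𝓝 0) :=
    tendsto_one_div_atTop_nhds_zero_nat
  set d : ℕ → ℝ := fun n => 2 * n + (α + β + γ) with hd'
  have hdn : Tendsto (fun n : ℕ => d n / n) atTop (𝓝 2) := by
    have h2 : Tendsto (fun n : ℕ => 2 + (α + β + γ) * (1 / (n : ℝ))) atTop (𝓝 2) := by
      simpa using (hinv.const_mul (α + β + γ)).const_add 2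
    refine h2.congr' ?_
    filter_upwards [eventually_gt_atTop 0] with n hn
    have : (n : ℝ) ≠ 0 := by exact_mod_cast hn.ne'
    simp only [hd']; field_simp
  have hnd : Tendsto (fun n : ℕ => (n : ℝ) / d n) atTop (𝓝 (1 / 2)) := by
    have := hdn.inv₀ two_ne_zero
    simp only [inv_div] at this
    simpa using this
  have hdi : Tendsto (fun n : ℕ => 1 / d n) atTop (𝓝 0) := by
    have := hnd.mul hinv
    rw [mul_zero] at this
    refine this.congr' ?_
    filter_upwards [eventually_gt_atTop 0] with n hn
    have : (n : ℝ) ≠ 0 := by exact_mod_cast hn.ne'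
    field_simp
  have hdi2 : Tendsto (fun n : ℕ => 2 / d n) atTop (𝓝 0) := by
    have := hdi.const_mul 2
    simpa [div_eq_mul_inv] using this
  set W : ℕ → ℝ := fun n => 2 * (edgeSigma α β γ A B n τ -
    τ * deriv (edgeSigma α β γ A B n) τ) + ((α + γ) ^ 2 - β ^ 2) / 2 with hWdef
  have hW : Tendsto W atTop (𝓝 (2 * (g τ - τ * deriv g τ) + ((α + γ) ^ 2 - β ^ 2) / 2)) :=
    ((hS.sub (hS1.const_mul τ)).const_mul 2).add_const _
  set ζ : ℕ → ℝ := fun n => 2 * (n / d n) * deriv (edgeSigma α β γ A B n) τ +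
    γ * (2 / d n - 1 / n) with hζdef
  have hζ : Tendsto ζ atTop (𝓝 (2 * (1 / 2) * deriv g τ + γ * (0 - 0))) :=
    ((hnd.const_mul 2).mul hS1).add ((hdi2.sub hinv).const_mul γ)
  set ξ : ℕ → ℝ := fun n => W n * (1 / d n) * (1 / n) - d n / n / 2 with hξdef
  have hξ : Tendsto ξ atTop
      (𝓝 ((2 * (g τ - τ * deriv g τ) + ((α + γ) ^ 2 - β ^ 2) / 2) * 0 * 0 - 2 / 2)) :=
    ((hW.mul hdi).mul hinv).sub (hdn.div_const 2)
  -- In the limit ζ → g', ξ → -1 and η → -1-g', while d/(2n) → 1. The terms in β² then cancel and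
  -- the others form the square ((α+γ)g' + γ)².
  have hη := (hdn.neg.sub hξ).sub hζ
  have hL := ((((tendsto_one_sub_div_sq τ).const_mul τ).mul hl).mul (hnd.const_mul 2)).pow 2
  have hR := ((((hW.const_mul (-2)).mul ((hdn.div_const 2).add hζ)).mul
    ((hdn.div_const 2).add hη)).sub (((((hξ.pow 2).mul_const (β ^ 2 - α ^ 2 - γ ^ 2)).add
      ((hη.pow 2).mul_const (α ^ 2 - β ^ 2 - γ ^ 2))).add
        ((hζ.pow 2).mul_const (γ ^ 2 - α ^ 2 - β ^ 2))).div_const 2)).add ((hinv.pow 2).const_mul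
    ((α ^ 4 + β ^ 4 + γ ^ 4 - 2 * α ^ 2 * β ^ 2 - 2 * α ^ 2 * γ ^ 2 - 2 * β ^ 2 * γ ^ 2) / 4))
  have heq := tendsto_nhds_unique (hL.congr' ?_) hR
  · ring_nf at heq ⊢
    linarith
  · filter_upwards [eventually_le_natCast_sq (2 * τ), eventually_gt_atTop 0] with n hn hn0
    exact edgeSigma_ode hα hβ hγ hA hAB hn0 hτ (by linarith) rfl rfl rfl rfl

end sigma_form

end

/-! ### Change of sign s = -τ -/

theorem mainTheorem4 (α β γ A B : ℝ) (hα : 0 < α) (hβ : 0 < β) (hγ : 0 < γ)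
    (hA : 0 ≤ A) (hAB : 0 < A + B) :
    (∀ n : ℕ, ∀ t ∈ Set.Ioo (0 : ℝ) 1,
      0 < hankelDet α β γ A B n t ∧ DifferentiableAt ℝ (hankelDet α β γ A B n) t) ∧
    ∃ σ : ℝ → ℝ,
      (∀ s : ℝ, s < 0 →
        Filter.Tendsto (fun n : ℕ => -hankelH α β γ A B n (-s / (n : ℝ) ^ 2))
          Filter.atTop (nhds (σ s))) ∧
      ∀ s : ℝ, s < 0 →
        DifferentiableAt ℝ σ s ∧ DifferentiableAt ℝ (deriv σ) s ∧
        (s * deriv (deriv σ) s) ^ 2 =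
          4 * deriv σ s * (deriv σ s - 1) * (σ s - s * deriv σ s) +
            ((α + γ) * deriv σ s - γ) ^ 2 := by
  refine ⟨fun n t ht => ⟨hankelDet_pos hα hβ hγ hA hAB n ht,
    differentiableAt_hankelDet hα hβ hγ n t⟩, ?_⟩
  obtain ⟨g, hg⟩ := exists_limit_edgeSigma hα hβ hγ hA hAB
  have h1 : deriv (fun s => g (-s)) = fun s => -deriv g (-s) := funext fun s => deriv_comp_neg g s
  have h2 : ∀ s, deriv (fun s => -deriv g (-s)) s = deriv (deriv g) (-s) := fun s => by
    rw [deriv.fun_neg, deriv_comp_neg, neg_neg]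
  refine ⟨fun s => g (-s), fun s hs => (hg (-s) (by linarith)).1, fun s hs => ?_⟩
  obtain ⟨-, hd1, hd2, hode⟩ := hg (-s) (by linarith)
  rw [h1, h2]
  refine ⟨hd1.comp s differentiableAt_id.neg, (hd2.comp s differentiableAt_id.neg).neg, ?_⟩
  linear_combination hode
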